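/- Let $G$ be a non-solvable generalized Baumslag--Solitar group, i.e. a non-solvable group isomorphic to the fundamental group of a finite graph of groups with all vertex and edge groups infinite cyclic. Let $\mathcal D$ be its cyclic deformation space: the metric simplicial trees with a minimal simplicial isometric $G$-action without inversions all of whose vertex and edge stabilizers are infinite cyclic (all trees in $\mathcal D$ have the same elliptic subgroups, those that fix a point; an element fixing no point is loxodromic). Write $\|g\|_T=\inf_{x\in T}d(x,gx)$. A cyclic factor of $G$ is a subgroup conjugate to $\pi_1(\Gamma_0)$ for a connected subgraph $\Gamma_0$ of a finite graph $\Gamma$ of infinite cyclic groups with an identification $G\simeq\pi_1(\Gamma)$. An outer automorphism $\phi\in\mathrm{Out}(G)$ is fully irreducible if no power $\phi^n$, $n\ge 1$, preserves the conjugacy class of a proper non-elliptic cyclic factor. It is pseudo-atoroidal if for no loxodromic $g\in G$ is the sequence $(\|\phi^n(g)\|_T)_{n\in\mathbb N}$ bounded (this does not depend on $T\in\mathcal D$). A train track representative of $\phi$ is a map $f:T\to T$ with $T\in\mathcal D$ such that: $f(gx)=\psi(g)f(x)$ for all $g\in G$, $x\in T$, for some automorphism $\psi$ in the class $\phi$;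 $f$ sends vertices to vertices; there is $\lambda>0$ such that $f$ maps every edge linearly, with stretch factor $\lambda$, onto a non-backtracking path; at every vertex there are at least two gates, where the gates at $v$ are the classes of the equivalence relation on edges with origin $v$ generated by $e\sim e'$ if $f(e)\cap f(e')$ has non-zero length; and for every edge $e$ and $k\in\mathbb N$ the path $f^k(e)$ crosses only turns $\{e_1,e_2\}$ with $e_1$, $e_2$ in distinct gates. A periodic Nielsen path for $f$ is a segment $\eta=[x,y]\subset T$ with $x\ne y$ such that $g[f^n(x),f^n(y)]=\eta$ for some $g\in G$, $n\ge 1$. Suppose that $\phi\in\mathrm{Out}(G)$ is fully irreducible and pseudo-atoroidal and has a train track representative $f:T\to T$. Then there is $m\in\mathbb N$ such that no non-backtracking path in $T$ is a concatenation of more than $m$ periodic Nielsen paths for $f$. If moreover $f_-:T_-\to T_-$ is a train track representative of $\phi^{-1}$, then $m$ can be chosen such that also no non-backtracking path in $T_-$ is a concatenation of more than $m$ periodic Nielsen paths for $f_-$. -/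

import Mathlib

noncomputable section

namespace GBS

universe u v

/-! ### Graphs of infinite cyclic groups and their fundamental groups -/

/-- A finite graph of infinite cyclic groups, with chosen generators of all vertex and edge groups:
the inclusion of the edge group of `e` into the vertex group at `t e` is multiplication by the
nonzero integer `label e`. The edge groups of `e` and `bar e` are the same. -/
structure CyclicGraph where
  V : Type
  E : Type
  [finV : Finite V]
  [finE : Finite E]
  bar : E → E
  bar_bar : ∀ e, bar (bar e) = e
  bar_ne : ∀ e, bar e ≠ e
  o : E → V
  t : E → V
  o_eq : ∀ e, o e = t (bar e)
  label : E → ℤ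
  label_ne : ∀ e, label e ≠ 0

namespace CyclicGraph

variable (Γ : CyclicGraph)

/-- A subgraph. -/
structure Sub where
  verts : Set Γ.V
  edges : Set Γ.E
  bar_mem : ∀ e ∈ edges, Γ.bar e ∈ edges
  t_mem : ∀ e ∈ edges, Γ.t e ∈ verts

/-- The whole graph, as a subgraph. -/
def whole : Γ.Sub where
  verts := Set.univ
  edges := Set.univ
  bar_mem := fun _ _ => trivial
  t_mem := fun _ _ => trivial

/-- The edges in `τ` form a maximal subtree of the subgraph `S`: they lie in `S`, they connect any
two vertices of `S`, and there is no non-backtracking loop in `τ`. -/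
structure IsMaximalTree (S : Γ.Sub) (τ : Set Γ.E) : Prop where
  subset : τ ⊆ S.edges
  bar_mem : ∀ e ∈ τ, Γ.bar e ∈ τ
  nonempty : S.verts.Nonempty
  connected : ∀ a ∈ S.verts, ∀ b ∈ S.verts,
    Relation.ReflTransGen (fun x y => ∃ e ∈ τ, Γ.o e = x ∧ Γ.t e = y) a b
  no_loop : ∀ (l : List Γ.E) (hl : l ≠ []), (∀ e ∈ l, e ∈ τ) →
    l.IsChain (fun e e' => Γ.t e = Γ.o e') → l.IsChain (fun e e' => Γ.bar e ≠ e') →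
    Γ.o (l.head hl) ≠ Γ.t (l.getLast hl)

/-- The free generator that becomes the generator of the vertex group at `x`. -/
def vgen (x : Γ.V) : FreeGroup (Γ.V ⊕ Γ.E) := FreeGroup.of (Sum.inl x)

/-- The free generator that becomes the stable letter of the edge `e`. -/
def egen (e : Γ.E) : FreeGroup (Γ.V ⊕ Γ.E) := FreeGroup.of (Sum.inr e)

/-- The relators of the fundamental group with respect to `τ`. -/
def rels (τ : Set Γ.E) : Set (FreeGroup (Γ.V ⊕ Γ.E)) :=
  {r | ∃ (e : Γ.E) (h : ℤ), r = Γ.egen e * Γ.vgen (Γ.t e) ^ (Γ.label e * h) * Γ.egen (Γ.bar e) *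
      (Γ.vgen (Γ.o e) ^ (Γ.label (Γ.bar e) * h))⁻¹} ∪
  {r | ∃ e ∈ τ, r = Γ.egen e}

/-- The fundamental group of the graph of groups with respect to the maximal subtree `τ`. -/
abbrev Pi1 (τ : Set Γ.E) : Type := PresentedGroup (Γ.rels τ)

/-- The fundamental group of a subgraph `S`, as a subgroup of the fundamental group of the whole
graph; it is meant for `τ` such that `τ ∩ S.edges` is a maximal subtree of `S`. -/
def subPi1 (S : Γ.Sub) (τ : Set Γ.E) : Subgroup (Γ.Pi1 τ) :=
  Subgroup.closure
    ({x | ∃ a ∈ S.verts, x = PresentedGroup.mk (Γ.rels τ) (Γ.vgen a)} ∪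
     {x | ∃ e ∈ S.edges, x = PresentedGroup.mk (Γ.rels τ) (Γ.egen e)})

end CyclicGraph

/-- Generalized Baumslag-Solitar groups. -/
def IsGBS (G : Type u) [Group G] : Prop :=
  ∃ (Γ : CyclicGraph) (τ : Set Γ.E), Γ.IsMaximalTree Γ.whole τ ∧ Nonempty (G ≃* Γ.Pi1 τ)

/-- `H` is a cyclic factor: it is conjugate to the fundamental group of a (connected, nonempty)
subgraph of a graph of infinite cyclic groups whose fundamental group is identified with `G`. -/
def IsCyclicFactor {G : Type u} [Group G] (H : Subgroup G) : Prop :=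
  ∃ (Γ : CyclicGraph) (τ : Set Γ.E) (S : Γ.Sub) (Ψ : G ≃* Γ.Pi1 τ) (g : G),
    Γ.IsMaximalTree Γ.whole τ ∧ Γ.IsMaximalTree S (τ ∩ S.edges) ∧
    H = ((Γ.subPi1 S τ).comap Ψ.toMonoidHom).map (MulAut.conj g).toMonoidHom

/-! ### Outer automorphisms -/

instance innNormal (G : Type u) [Group G] : (MulAut.conj (G := G)).range.Normal where
  conj_mem := by
    rintro _ ⟨g, rfl⟩ φ
    exact ⟨φ g, by ext x; simp⟩

/-- The outer automorphism group. -/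
abbrev Out (G : Type u) [Group G] : Type u := MulAut G ⧸ (MulAut.conj (G := G)).range

/-! ### Metric simplicial trees with an action -/

/-- A metric simplicial tree with a simplicial isometric action of `G` without inversions. The
oriented edges are the ordered pairs of adjacent vertices. -/
structure GTree (G : Type u) [Group G] where
  V : Type v
  [act : MulAction G V]
  graph : SimpleGraph V
  isTree : graph.IsTree
  len : V → V → ℝ
  adj_smul : ∀ (g : G) (a b : V), graph.Adj a b → graph.Adj (g • a) (g • b)
  no_inversion : ∀ (g : G) (a b : V), graph.Adj a b → ¬ (g • a = b ∧ g • b = a)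
  len_pos : ∀ a b, graph.Adj a b → 0 < len a b
  len_symm : ∀ a b, len a b = len b a
  len_smul : ∀ (g : G) (a b : V), graph.Adj a b → len (g • a) (g • b) = len a b

namespace GTree

variable {G : Type u} [Group G] (T : GTree.{u, v} G)

instance : MulAction G T.V := T.act

/-- The points of the geometric realization, in barycentric coordinates: formal convex combinations
of one vertex or of two adjacent vertices. -/
def Point : Type v :=
  {p : T.V →₀ ℝ // ∃ a b : T.V, (a = b ∨ T.graph.Adj a b) ∧ ∃ s ∈ Set.Icc (0 : ℝ) 1,
    p = Finsupp.single a (1 - s) + Finsupp.single b s}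

variable {T}

/-- A vertex, as a point. -/
def vert (a : T.V) : T.Point :=
  ⟨Finsupp.single a 1, a, a, Or.inl rfl, 0, by simp, by simp⟩

instance : SMul G T.Point where
  smul g p := ⟨Finsupp.mapDomain (fun a => g • a) p.1, by
    obtain ⟨a, b, hab, s, hs, hp⟩ := p.2
    refine ⟨g • a, g • b, ?_, s, hs, ?_⟩
    · exact hab.imp (fun h => by rw [h]) (T.adj_smul g a b)
    · rw [hp, Finsupp.mapDomain_add, Finsupp.mapDomain_single, Finsupp.mapDomain_single]⟩

/-- The closed edge between the vertices `a` and `b`. -/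
def edge (a b : T.V) : Set T.Point :=
  {p | ∃ s ∈ Set.Icc (0 : ℝ) 1, p.1 = Finsupp.single a (1 - s) + Finsupp.single b s}

/-- `IsPathLength p q L`: there is a piecewise linear path of length `L` from `p` to `q`. Each piece
is a segment contained in one closed edge, which is isometric to `[0, len a b]`. -/
inductive IsPathLength : T.Point → T.Point → ℝ → Prop
  | refl (p : T.Point) : IsPathLength p p 0
  | step (a b : T.V) (p q r : T.Point) (L : ℝ) (hab : T.graph.Adj a b)
      (hp : p ∈ edge a b) (hq : q ∈ edge a b) (h : IsPathLength q r L) :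
      IsPathLength p r (|p.1 b - q.1 b| * T.len a b + L)

/-- The path metric on the geometric realization. -/
def dist (p q : T.Point) : ℝ := sInf {L | IsPathLength p q L}

variable (T)

/-- The translation length of `g`. -/
def translationLength (g : G) : ℝ := ⨅ p : T.Point, dist p (g • p)

/-- A subgroup is elliptic if it fixes a point. -/
def IsElliptic (H : Subgroup G) : Prop := ∃ p : T.Point, ∀ h ∈ H, h • p = p

/-- An element is loxodromic if it fixes no point. -/
def IsLoxodromic (g : G) : Prop := ∀ p : T.Point, g • p ≠ p

/-- There is no proper invariant subtree. -/
def IsMinimal : Prop :=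
  ∀ S : Set T.V, (∀ (g : G), ∀ a ∈ S, g • a ∈ S) → (T.graph.induce S).Connected → S = Set.univ

/-- The tree belongs to the cyclic deformation space: it is minimal, and all vertex and edge
stabilizers are infinite cyclic. -/
structure IsCyclicTree : Prop where
  minimal : T.IsMinimal
  vertex : ∀ a : T.V, IsCyclic (MulAction.stabilizer G a) ∧ Infinite (MulAction.stabilizer G a)
  edge : ∀ a b : T.V, T.graph.Adj a b →
    IsCyclic (MulAction.stabilizer G a ⊓ MulAction.stabilizer G b : Subgroup G) ∧
    Infinite (MulAction.stabilizer G a ⊓ MulAction.stabilizer G b : Subgroup G)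

/-! ### Properties of outer automorphisms

Ellipticity, loxodromy and boundedness of translation lengths are tested in a tree `T` of the cyclic
deformation space; they are the same for all trees of that space. -/

/-- `φ` is fully irreducible: no power with positive exponent preserves the conjugacy class of a
proper non-elliptic cyclic factor. (Vertex groups and `G` itself are excluded.) -/
def IsFullyIrreducible (φ : Out G) : Prop :=
  ∀ H : Subgroup G, IsCyclicFactor H → H ≠ ⊤ → ¬ T.IsElliptic H →
    ∀ ψ : MulAut G, (ψ : Out G) = φ → ∀ n : ℕ, 1 ≤ n →
      ¬ ∃ g : G, H.map (ψ ^ n).toMonoidHom = H.map (MulAut.conj g).toMonoidHom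

/-- The conjugacy class of `g` is pseudo-periodic for `φ`. -/
def IsPseudoPeriodic (φ : Out G) (g : G) : Prop :=
  ∀ ψ : MulAut G, (ψ : Out G) = φ →
    BddAbove (Set.range fun n : ℕ => T.translationLength ((ψ ^ n) g))

/-- `φ` is pseudo-atoroidal: no conjugacy class of loxodromic elements is pseudo-periodic. -/
def IsPseudoAtoroidal (φ : Out G) : Prop :=
  ∀ g : G, T.IsLoxodromic g → ¬ T.IsPseudoPeriodic φ g

/-! ### Train track maps and periodic Nielsen paths -/

variable {T}

/-- `f` is a representative for `φ`. -/
def IsRepresentative (φ : Out G) (f : T.Point → T.Point) : Prop :=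
  ∃ ψ : MulAut G, (ψ : Out G) = φ ∧ ∀ (g : G) (p : T.Point), f (g • p) = ψ g • f p

/-- The gate structure induced by `f`, on the edges `(a, b)` with origin `a`: the equivalence
relation generated by `f(e) ∩ f(e')` having nonzero length. (For `f` injective on edges, this
intersection is a segment, so this means that it is not a single point.) -/
def SameGate (f : T.Point → T.Point) (a : T.V) : T.V → T.V → Prop :=
  Relation.EqvGen fun b c => T.graph.Adj a b ∧ T.graph.Adj a c ∧
    (f '' edge a b ∩ f '' edge a c).Nontrivial

/-- `f` is a train track representative for `φ`, linear on edges with the same stretch factor on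
all edges. The field `stretch` says that `f` is a linear parametrization of a nondegenerate
non-backtracking path on each edge. In `legal`, the path `f^k(e)` crosses the turn of the edges
`(x, y)` and `(x, z)` if it contains both edges. -/
structure IsTrainTrack (φ : Out G) (f : T.Point → T.Point) : Prop where
  representative : IsRepresentative φ f
  vertices : ∀ a : T.V, ∃ b : T.V, f (vert a) = vert b
  stretch : ∃ lam : ℝ, 0 < lam ∧ ∀ a b : T.V, T.graph.Adj a b →
    ∀ p ∈ edge a b, ∀ q ∈ edge a b, dist (f p) (f q) = lam * dist p q
  two_gates : ∀ a : T.V, ∃ b c : T.V, T.graph.Adj a b ∧ T.graph.Adj a c ∧ ¬ SameGate f a b c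
  legal : ∀ a b : T.V, T.graph.Adj a b → ∀ (k : ℕ) (x y z : T.V),
    T.graph.Adj x y → T.graph.Adj x z → y ≠ z →
    edge x y ⊆ f^[k] '' edge a b → edge x z ⊆ f^[k] '' edge a b → ¬ SameGate f x y z

/-- The (nondegenerate) non-backtracking path from `x` to `y` is a periodic Nielsen path for `f`.
For a path `η` from `x` to `y`, the path `[f^n(η)]` is the one from `f^n(x)` to `f^n(y)`, and paths
are determined by their endpoints. (If `g [f^n(η)]` is `η` with the reverse orientation then the
condition holds for `2 n`.) -/
def IsPeriodicNielsenPath (f : T.Point → T.Point) (x y : T.Point) : Prop :=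
  x ≠ y ∧ ∃ (g : G) (n : ℕ), 1 ≤ n ∧ g • f^[n] x = x ∧ g • f^[n] y = y

/-- `x 0, …, x k` are the successive endpoints of a non-backtracking (that is, geodesic)
concatenation of `k` periodic Nielsen paths for `f`. -/
def IsNielsenConcatenation (f : T.Point → T.Point) (k : ℕ) (x : ℕ → T.Point) : Prop :=
  (∀ i < k, IsPeriodicNielsenPath f (x i) (x (i + 1))) ∧
  dist (x 0) (x k) = ∑ i ∈ Finset.range k, dist (x i) (x (i + 1))

/-- It is impossible to concatenate more than `m` periodic Nielsen paths for `f`. -/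
def NielsenConcatenationBound (f : T.Point → T.Point) (m : ℕ) : Prop :=
  ∀ (k : ℕ) (x : ℕ → T.Point), IsNielsenConcatenation f k x → k ≤ m

end GTree

end GBS

end

/-! A train track map `f` is `lam`-Lipschitz, and its iterates stretch every edge by exactly `lam ^
n`; segments stretched in this way are called legal. The tree carries a loxodromic element, whose
translation lengths along the orbit of φ would stay bounded if `lam ≤ 1`, so `lam > 1`
(`LegalMap.one_lt`). The iterates of a periodic Nielsen path have bounded length, so bounded
cancellation (`LegalMap.bounded_cancellation`) bounds the length of its legal subsegments.

A periodic Nielsen path starts with a legal segment from `x` to an illegal corner at a vertex `v`,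
and no iterate of `f` removes this corner (`LegalMap.exists_nielsenCorner`). The vertex `v` and the
directions on both sides of it determine `x` (`NielsenCorner.eq`), because a change of position of
`x` would be multiplied by `lam ^ n` while only a bounded error is allowed. Up to the action of `G`
there are finitely many such local pictures. In a long concatenation two of them therefore differ by
some `h`, which moves an initial endpoint `x i` to a later one `x j`. This `h` shifts along the
geodesic, hence is loxodromic, and the iterates of `x i` and `x j` stay at bounded distance because
Nielsen paths join these points. So the conjugacy class of `h` is pseudo-periodic, a contradiction.

For φ⁻¹ the same argument applies once φ⁻¹ is known to be pseudo-atoroidal in `T'`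
(`LegalMap.isPseudoAtoroidal_inv`). Vertex groups of `T'` are elliptic in `T`
(`LegalMap.translationLength_eq_zero`), so a bounded orbit of φ⁻¹ in `T'` gives a bounded backward
orbit of φ in `T`. Each of its elements is represented by a periodic sequence of vertices with legal
steps. The minimal period is bounded and does not increase under `f`, so it is constant far enough
back. There, applying `f` and tightening never loses a whole step, the tightened sequences run along
axes with bounded steps, and two of them agree locally up to translation. Tightening is a local
operation, so the lengths repeat forever and the forward orbit is bounded too, which is excluded
(`LegalMap.not_bounded_backward`). -/

noncomputable section

namespace GBS

universe u v w

/-! ### Tree metrics -/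

/-- A geodesic metric space satisfying the four point condition, that is, a real tree. -/
class TreeMetric (X : Type*) [MetricSpace X] : Prop where
  exists_between : ∀ (x y : X) (t : ℝ), 0 ≤ t → t ≤ dist x y →
    ∃ z, dist x z = t ∧ dist z y = dist x y - t
  four_point : ∀ x y z w : X,
    dist x y + dist z w ≤ max (dist x z + dist y w) (dist x w + dist y z)

section TreeMetric

variable {X : Type*} [MetricSpace X]

/-- The point `z` lies on the segment from `x` to `y`. -/
def Between (x z y : X) : Prop := dist x z + dist z y = dist x y

theorem Between.symm {x z y : X} (h : Between x z y) : Between y z x := by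
  unfold Between at *
  rw [dist_comm y z, dist_comm z x, dist_comm y x]; linarith

theorem Between.left (x y : X) : Between x x y := by simp [Between]

theorem Between.right (x y : X) : Between x y y := by simp [Between]

theorem Between.eq_of_self {x z : X} (h : Between x z x) : z = x := by
  unfold Between at h
  rw [dist_self, dist_comm z x] at h
  have : dist x z = 0 := by linarith [dist_nonneg (x := x) (y := z)]
  exact (dist_eq_zero.1 this).symm

/-- If `z ∈ [x, y]` and `w ∈ [x, z]` then `w ∈ [x, y]`. -/
theorem Between.trans_left {x w z y : X} (h : Between x z y) (h' : Between x w z) :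
    Between x w y := by
  unfold Between at *
  linarith [dist_triangle x w y, dist_triangle w z y]

/-- If `z ∈ [x, y]` and `w ∈ [x, z]` then `z ∈ [w, y]`. -/
theorem Between.trans_right {x w z y : X} (h : Between x z y) (h' : Between x w z) :
    Between w z y := by
  unfold Between at *
  linarith [dist_triangle x w y, dist_triangle w z y]

/-- If `z ∈ [x, y]` and `w ∈ [z, y]` then `w ∈ [x, y]`. -/
theorem Between.trans_left_symm {x w z y : X} (h : Between x z y) (h' : Between z w y) :
    Between x w y := (h.symm.trans_left h'.symm).symm

/-- If `z ∈ [x, y]` and `w ∈ [z, y]` then `z ∈ [x, w]`. -/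
theorem Between.trans_right_symm {x w z y : X} (h : Between x z y) (h' : Between z w y) :
    Between x z w := (h.symm.trans_right h'.symm).symm

theorem Between.dist_le_left {x z y : X} (h : Between x z y) : dist x z ≤ dist x y := by
  unfold Between at h; linarith [dist_nonneg (x := z) (y := y)]

theorem Between.dist_le_right {x z y : X} (h : Between x z y) : dist z y ≤ dist x y := by
  unfold Between at h; linarith [dist_nonneg (x := x) (y := z)]

theorem Between.map_isometry {Y : Type*} [MetricSpace Y] {g : X → Y}
    (hg : ∀ x y, dist (g x) (g y) = dist x y) {x z y : X}
    (h : Between x z y) : Between (g x) (g z) (g y) := by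
  unfold Between at *; rw [hg, hg, hg]; exact h

variable [TreeMetric X]

theorem exists_between_dist (x y : X) {t : ℝ} (h0 : 0 ≤ t) (h1 : t ≤ dist x y) :
    ∃ z, Between x z y ∧ dist x z = t := by
  obtain ⟨z, hz, hz'⟩ := TreeMetric.exists_between x y t h0 h1
  exact ⟨z, by unfold Between; linarith, hz⟩

theorem Between.eq_of_dist_eq {x y z z' : X} (h : Between x z y) (h' : Between x z' y)
    (hd : dist x z = dist x z') : z = z' := by
  have := TreeMetric.four_point x y z z'
  unfold Between at *
  rw [dist_comm y z', dist_comm y z] at this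
  refine dist_le_zero.1 ?_
  rcases le_max_iff.1 this with h1 | h1 <;> linarith

theorem Between.order {x y z w : X} (h : Between x z y) (h' : Between x w y)
    (hd : dist x z ≤ dist x w) : Between x z w ∧ Between z w y := by
  have := TreeMetric.four_point x y z w
  unfold Between at *
  rw [dist_comm y w, dist_comm y z] at this
  have := dist_triangle x z w
  have : dist z w = dist x w - dist x z := by
    rcases le_max_iff.1 ‹dist x y + dist z w ≤ _› with h1 | h1 <;> linarith
  constructor <;> linarith

/-- Two points of a segment: one of them is before the other. -/
theorem Between.total {x y z w : X} (h : Between x z y) (h' : Between x w y) :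
    Between x z w ∨ Between x w z :=
  (le_total (dist x z) (dist x w)).imp (fun hd => (h.order h' hd).1) fun hd => (h'.order h hd).1

/-- Segments with a nondegenerate overlap concatenate to a segment. -/
theorem Between.glue {p q q' r : X} (h : Between p q q') (h' : Between q q' r) (hne : q ≠ q') :
    Between p q r ∧ Between p q' r := by
  have h4 := TreeMetric.four_point p q' q r
  have hp := dist_pos.2 hne
  unfold Between at *
  rw [dist_comm q' q] at h4
  have := dist_triangle p q r
  have := dist_triangle p q' r
  have := dist_triangle q q' r
  -- The first alternative would give `2 * dist q q' ≤ 0`.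
  rcases le_max_iff.1 h4 with h1 | h1
  · linarith
  · constructor <;> linarith

/-- The median is placed on `[x, y]` at distance the Gromov product of `y` and `z` at `x`. The four
point condition bounds `dist z m` from above, and the triangle inequality shows that the bound is
attained. -/
theorem exists_median (x y z : X) : ∃ m, Between x m y ∧ Between y m z ∧ Between x m z := by
  have hxy := dist_triangle x z y
  have hyz := dist_triangle y x z
  have hxz := dist_triangle x y z
  rw [dist_comm z y] at hxy
  rw [dist_comm y x] at hyz
  obtain ⟨m, hm, hd⟩ := exists_between_dist x y
    (t := (dist x y + dist x z - dist y z) / 2) (by linarith) (by linarith)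
  have h4 := TreeMetric.four_point z m x y
  unfold Between at *
  have hzm : dist z m ≤ (dist x z + dist y z - dist x y) / 2 := by
    rw [dist_comm z x, dist_comm z y, dist_comm m x] at h4
    rcases le_max_iff.1 h4 with h1 | h1 <;> linarith
  have h1 := dist_triangle x m z
  have h2 := dist_triangle y m z
  rw [dist_comm m z] at h1 h2
  rw [dist_comm y m] at h2
  refine ⟨m, hm, ?_, ?_⟩
  · rw [dist_comm y m, dist_comm m z]; linarith
  · rw [dist_comm m z]; linarith

/-- The median of three points of a real tree. -/
def med (x y z : X) : X := (exists_median x y z).choose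

theorem med_between_left (x y z : X) : Between x (med x y z) y :=
  (exists_median x y z).choose_spec.1

theorem med_between_right (x y z : X) : Between y (med x y z) z :=
  (exists_median x y z).choose_spec.2.1

theorem med_between (x y z : X) : Between x (med x y z) z :=
  (exists_median x y z).choose_spec.2.2

theorem dist_med (x y z : X) : dist x (med x y z) = (dist x y + dist x z - dist y z) / 2 := by
  have h1 := med_between_left x y z
  have h2 := med_between_right x y z
  have h3 := med_between x y z
  unfold Between at *
  rw [dist_comm y] at h2
  linarith

theorem dist_med_middle (x y z : X) :
    dist y (med x y z) = (dist x y + dist y z - dist x z) / 2 := by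
  have h1 := med_between_left x y z
  have h2 := med_between_right x y z
  have h3 := med_between x y z
  unfold Between at *
  rw [dist_comm y] at h2 ⊢
  linarith

theorem eq_med {x y z m : X} (h1 : Between x m y) (h2 : Between y m z) (h3 : Between x m z) :
    m = med x y z := by
  refine h1.eq_of_dist_eq (med_between_left x y z) ?_
  rw [dist_med]
  unfold Between at *
  rw [dist_comm y m] at h2
  linarith

theorem med_map {Y : Type*} [MetricSpace Y] [TreeMetric Y] {g : X → Y}
    (hg : ∀ x y, dist (g x) (g y) = dist x y) (x y z : X) :
    g (med x y z) = med (g x) (g y) (g z) :=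
  eq_med ((med_between_left x y z).map_isometry hg) ((med_between_right x y z).map_isometry hg)
    ((med_between x y z).map_isometry hg)

/-- Maps which preserve distances and agree on the endpoints of a segment agree on the segment. -/
theorem Between.map_eq_map {W Y : Type*} [MetricSpace W] [MetricSpace Y] [TreeMetric Y]
    {g g' : W → Y} (hg : ∀ x y, dist (g x) (g y) = dist x y)
    (hg' : ∀ x y, dist (g' x) (g' y) = dist x y)
    {x y z : W} (h : Between x z y) (hx : g x = g' x) (hy : g y = g' y) : g z = g' z := by
  refine (h.map_isometry hg).eq_of_dist_eq (y := g y) ?_ ?_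
  · rw [hx, hy]; exact h.map_isometry hg'
  · rw [hg, hx, hg']

/-- A point of `[x, y]` belongs to `[x, z]` or to `[z, y]`. -/
theorem Between.or_between {x p y : X} (h : Between x p y) (z : X) :
    Between x p z ∨ Between z p y := by
  rcases h.total (med_between x z y) with h1 | h1
  · exact Or.inl ((med_between_left x z y).trans_left h1)
  · have h2 : Between (med x z y) p y := h.trans_right h1
    exact Or.inr ((med_between_right x z y).trans_left_symm h2)

/-- Local geodesics are geodesics. -/
theorem dist_eq_sum_of_local {m : ℕ → X} (n : ℕ)
    (hb : ∀ i, i + 2 ≤ n → Between (m i) (m (i + 1)) (m (i + 2)))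
    (hne : ∀ i, i + 1 ≤ n → m i ≠ m (i + 1)) :
    dist (m 0) (m n) = ∑ i ∈ Finset.range n, dist (m i) (m (i + 1)) := by
  have key : ∀ n, (∀ i, i + 2 ≤ n → Between (m i) (m (i + 1)) (m (i + 2))) →
      (∀ i, i + 1 ≤ n → m i ≠ m (i + 1)) → 1 ≤ n → Between (m 0) (m (n - 1)) (m n) := by
    intro n
    induction n with
    | zero => intro _ _ h; omega
    | succ k ih =>
      intro hb hne _
      rcases Nat.eq_zero_or_pos k with rfl | hk
      · exact Between.left _ _
      · have h1 := ih (fun i hi => hb i (by omega)) (fun i hi => hne i (by omega)) hk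
        obtain ⟨j, rfl⟩ : ∃ j, k = j + 1 := ⟨k - 1, by omega⟩
        exact (h1.glue (hb j (by omega)) (hne j (by omega))).2
  induction n with
  | zero => simp
  | succ k ih =>
    rw [Finset.sum_range_succ, ← ih (fun i hi => hb i (by omega)) (fun i hi => hne i (by omega))]
    exact Eq.symm (key (k + 1) hb hne (by omega))

/-- An isometry that folds the segment from `x` to its image onto more than half of itself fixes
a point. -/
theorem exists_fixed_of_backtrack {g : X → X} (hg : ∀ x y, dist (g x) (g y) = dist x y) {x : X}
    (hδ : dist x (g x) ≤ 2 * dist (g x) (med x (g x) (g (g x)))) : ∃ p, g p = p := by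
  have m1 := med_between_left x (g x) (g (g x))
  have m2 := med_between_right x (g x) (g (g x))
  set m := med x (g x) (g (g x))
  have hn := dist_nonneg (x := x) (y := g x)
  -- The fixed point is the midpoint `p` of `[x, g x]`. Both `p` and `g p` lie on the common initial
  -- part of the segments from `g x` to `x` and to `g (g x)`, at the same distance from `g x`.
  obtain ⟨p, hp, hpd⟩ := exists_between_dist x (g x) (t := dist x (g x) / 2)
    (by linarith) (by linarith)
  obtain ⟨q, hq, hqd⟩ := exists_between_dist (g x) m (t := dist x (g x) / 2)
    (by linarith) (by linarith)
  have e1 : q = p := by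
    refine (m1.symm.trans_left hq).eq_of_dist_eq hp.symm ?_
    unfold Between at hp
    rw [dist_comm (g x) p]; linarith
  have e2 : q = g p := by
    refine (m2.trans_left hq).eq_of_dist_eq (hp.map_isometry hg) ?_
    rw [hg]; linarith
  exact ⟨p, by rw [← e2, e1]⟩

/-- An isometry without fixed points translates some point along an axis. -/
theorem exists_axis_point {g : X → X} [Nonempty X] (hg : ∀ x y, dist (g x) (g y) = dist x y)
    (hfix : ∀ x, g x ≠ x) : ∃ p, Between p (g p) (g (g p)) := by
  obtain ⟨x⟩ := ‹Nonempty X›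
  have hδ : ¬ dist x (g x) ≤ 2 * dist (g x) (med x (g x) (g (g x))) := fun h => by
    obtain ⟨p, hp⟩ := exists_fixed_of_backtrack hg h
    exact hfix p hp
  have m1 := med_between_left x (g x) (g (g x))
  have m2 := med_between_right x (g x) (g (g x))
  have m3 := med_between x (g x) (g (g x))
  set m := med x (g x) (g (g x))
  have m1' := m1
  unfold Between at m1'
  rw [dist_comm m] at m1'
  have hn := dist_nonneg (x := x) (y := m)
  have hn' := dist_nonneg (x := g x) (y := m)
  -- The distance is chosen so that `g p` is the branch point `m`. Less than half of the segment is
  -- folded, so `p` comes before `m` on `[x, g x]`.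
  obtain ⟨p, hp, hpd⟩ := exists_between_dist x (g x) (t := dist (g x) m)
    (by linarith) (by linarith)
  have e : g p = m := (hp.map_isometry hg).eq_of_dist_eq m2 (by rw [hg, hpd])
  refine ⟨p, ?_⟩
  rw [e]
  have h1 : Between x p m := (hp.order m1 (by linarith)).1
  have h2 : Between p m (g (g x)) := m3.trans_right h1
  have h3 : Between m (g m) (g (g x)) := by
    refine (m2.order (m1.map_isometry hg) ?_).2
    rw [hg]; linarith
  exact h2.trans_right_symm h3

end TreeMetric

end GBS

end

noncomputable section

namespace GBS

universe u v w

/-! ### The metric of a simplicial tree -/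

section Sides

variable {V : Type*} (Γ : SimpleGraph V)

/-- The vertices on the side of `b` of the edge between `a` and `b`. -/
def side (a b : V) : Set V := {c | (Γ.deleteEdges {s(a, b)}).Reachable b c}

variable {Γ}

theorem mem_side_self (a b : V) : b ∈ side Γ a b := SimpleGraph.Reachable.refl _

theorem notMem_side (hΓ : Γ.IsTree) {a b : V} (h : Γ.Adj a b) : a ∉ side Γ a b := by
  intro ha
  have := SimpleGraph.isAcyclic_iff_forall_isBridge.1 hΓ.isAcyclic
    (show s(a, b) ∈ Γ.edgeSet from h)
  exact SimpleGraph.isBridge_iff.1 this (SimpleGraph.Reachable.symm ha)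

theorem eq_of_mem_side_of_notMem {a b c c' : V} (h : Γ.Adj c c')
    (hc : c ∈ side Γ a b) (hc' : c' ∉ side Γ a b) : c = b ∧ c' = a := by
  by_cases he : s(c, c') = s(a, b)
  · rcases Sym2.eq_iff.1 he with ⟨rfl, rfl⟩ | ⟨rfl, rfl⟩
    · exact absurd (mem_side_self _ _) hc'
    · exact ⟨rfl, rfl⟩
  · exfalso
    refine hc' (SimpleGraph.Reachable.trans hc (SimpleGraph.Adj.reachable ?_))
    rw [SimpleGraph.deleteEdges_adj]
    exact ⟨h, he⟩

theorem notMem_side_swap (hΓ : Γ.IsTree) {a b c : V} (h : Γ.Adj a b) (hc : c ∈ side Γ a b) :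
    c ∉ side Γ b a := by
  intro hc'
  refine notMem_side hΓ h (SimpleGraph.Reachable.trans hc ?_)
  unfold side at hc'
  rw [Sym2.eq_swap] at hc'
  exact SimpleGraph.Reachable.symm hc'

theorem mem_side_or (hΓ : Γ.IsTree) (a b c : V) : c ∈ side Γ a b ∨ c ∈ side Γ b a := by
  obtain ⟨W⟩ := hΓ.connected.preconnected c b
  induction W with
  | nil => exact Or.inl (mem_side_self _ _)
  | @cons c c' b h W ih =>
    rcases ih with h1 | h1
    · by_contra! hn
      obtain ⟨-, rfl⟩ := eq_of_mem_side_of_notMem h.symm h1 hn.1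
      exact hn.2 (mem_side_self _ _)
    · by_contra! hn
      obtain ⟨-, rfl⟩ := eq_of_mem_side_of_notMem h.symm h1 hn.2
      exact hn.1 (mem_side_self _ _)

/-- The half-tree of `(a, b)` is connected and does not contain the edge `{a', b'}`, so a walk
inside it never crosses from one side of that edge to the other. -/
theorem mem_side_iff_of_notMem {a b a' b' c c' : V} (hn : ¬ (a' ∈ side Γ a b ∧ b' ∈ side Γ a b))
    (hc : c ∈ side Γ a b) (hc' : c' ∈ side Γ a b) : c ∈ side Γ a' b' ↔ c' ∈ side Γ a' b' := by
  have key : ∀ {c c' : V} (_ : (Γ.deleteEdges {s(a, b)}).Walk c c'), c ∈ side Γ a b →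
      (c ∈ side Γ a' b' ↔ c' ∈ side Γ a' b') := by
    intro c c' W
    induction W with
    | nil => intro _; rfl
    | @cons c d c' h W ih =>
      intro hc
      have hd : d ∈ side Γ a b := SimpleGraph.Reachable.trans hc h.reachable
      have hadj : Γ.Adj c d := (SimpleGraph.deleteEdges_adj.1 h).1
      rw [← ih hd]
      constructor
      · intro h1
        by_contra h2
        obtain ⟨rfl, rfl⟩ := eq_of_mem_side_of_notMem hadj h1 h2
        exact hn ⟨hd, hc⟩
      · intro h1
        by_contra h2
        obtain ⟨rfl, rfl⟩ := eq_of_mem_side_of_notMem hadj.symm h1 h2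
        exact hn ⟨hc, hd⟩
  obtain ⟨W⟩ := SimpleGraph.Reachable.trans (SimpleGraph.Reachable.symm hc) hc'
  exact key W hc

/-- Half-trees that do not contain `o` are nested or disjoint. -/
theorem side_nested (hΓ : Γ.IsTree) {a b a' b' o c : V} (h : Γ.Adj a b)
    (ho : o ∉ side Γ a b) (ho' : o ∉ side Γ a' b') (hc : c ∈ side Γ a b)
    (hc' : c ∈ side Γ a' b') : side Γ a b ⊆ side Γ a' b' ∨ side Γ a' b' ⊆ side Γ a b := by
  -- If both ends of the second edge are in the first half-tree, the complementary half-tree does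
  -- not contain that edge and is on one side of it, namely the side of `o`. Otherwise the first
  -- half-tree itself is on one side, namely the side of `c`.
  by_cases hn : a' ∈ side Γ a b ∧ b' ∈ side Γ a b
  · right
    intro d hd
    by_contra hd'
    have hn' : ¬ (a' ∈ side Γ b a ∧ b' ∈ side Γ b a) := fun h2 =>
      notMem_side_swap hΓ h hn.1 h2.1
    have h1 : d ∈ side Γ b a := (mem_side_or hΓ a b d).resolve_left hd'
    have h2 : o ∈ side Γ b a := (mem_side_or hΓ a b o).resolve_left ho
    exact ho' ((mem_side_iff_of_notMem hn' h1 h2).1 hd)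
  · left
    intro d hd
    exact (mem_side_iff_of_notMem hn hc hd).1 hc'

theorem start_notMem_side (hΓ : Γ.IsTree) {a b : V} (W : Γ.Walk a b) (hW : W.IsPath)
    (d : Γ.Dart) (hd : d ∈ W.darts) : a ∉ side Γ d.fst d.snd := by
  induction W with
  | nil => simp at hd
  | @cons a c b h W ih =>
    rw [SimpleGraph.Walk.cons_isPath_iff] at hW
    rw [SimpleGraph.Walk.darts_cons, List.mem_cons] at hd
    rcases hd with rfl | hd
    · exact notMem_side hΓ h
    · intro ha
      obtain ⟨h1, h2⟩ := eq_of_mem_side_of_notMem h ha (ih hW.1 hd)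
      exact hW.2 (h1 ▸ W.dart_snd_mem_support_of_mem_darts hd)

theorem end_mem_side (hΓ : Γ.IsTree) {a b : V} (W : Γ.Walk a b) (hW : W.IsPath)
    (d : Γ.Dart) (hd : d ∈ W.darts) : b ∈ side Γ d.fst d.snd := by
  have := start_notMem_side hΓ W.reverse hW.reverse d.symm (by
    rw [SimpleGraph.Walk.mem_darts_reverse]; simpa using hd)
  exact (mem_side_or hΓ _ _ b).resolve_right this

/-- The indicator function of a half-tree. -/
def sideInd (Γ : SimpleGraph V) (a b c : V) : ℝ := (side Γ a b).indicator 1 c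

theorem sideInd_of_mem {a b c : V} (h : c ∈ side Γ a b) : sideInd Γ a b c = 1 := by
  simp [sideInd, h]

theorem sideInd_of_notMem {a b c : V} (h : c ∉ side Γ a b) : sideInd Γ a b c = 0 := by
  simp [sideInd, h]

theorem sideInd_cases (a b c : V) :
    (c ∈ side Γ a b ∧ sideInd Γ a b c = 1) ∨ (c ∉ side Γ a b ∧ sideInd Γ a b c = 0) := by
  by_cases h : c ∈ side Γ a b
  · exact Or.inl ⟨h, sideInd_of_mem h⟩
  · exact Or.inr ⟨h, sideInd_of_notMem h⟩

theorem sideInd_swap (hΓ : Γ.IsTree) {a b : V} (h : Γ.Adj a b) (c : V) :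
    sideInd Γ b a c = 1 - sideInd Γ a b c := by
  rcases mem_side_or hΓ a b c with hc | hc
  · rw [sideInd_of_mem hc, sideInd_of_notMem (notMem_side_swap hΓ h hc)]; simp
  · rw [sideInd_of_mem hc, sideInd_of_notMem (notMem_side_swap hΓ h.symm hc)]; simp

end Sides

/-! ### Edge coordinates and the path metric -/

namespace GTree

variable {G : Type u} [Group G] {T : GTree.{u, v} G}

/-- The coordinate of a point with respect to the edge from `a` to `b`: it is `0` on the side of
`a`, `1` on the side of `b`, and linear on the edge. -/
def coord (a b : T.V) (p : T.Point) : ℝ :=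
  Finsupp.linearCombination ℝ (sideInd T.graph a b) p.1

theorem coord_of_eq {x y a b : T.V} {p : T.Point} {s : ℝ}
    (hp : p.1 = Finsupp.single a (1 - s) + Finsupp.single b s) :
    coord x y p = (1 - s) * sideInd T.graph x y a + s * sideInd T.graph x y b := by
  simp [coord, hp, Finsupp.linearCombination_single]
  ring

theorem coord_vert (x y a : T.V) : coord x y (vert a) = sideInd T.graph x y a := by
  simp [coord, vert, Finsupp.linearCombination_single]

/-- The point of the edge between `a` and `b` with coordinate `s`. -/
def edgePoint {a b : T.V} (h : T.graph.Adj a b) {s : ℝ} (hs : s ∈ Set.Icc (0 : ℝ) 1) : T.Point :=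
  ⟨Finsupp.single a (1 - s) + Finsupp.single b s, a, b, Or.inr h, s, hs, rfl⟩

theorem edgePoint_mem {a b : T.V} (h : T.graph.Adj a b) {s : ℝ} (hs : s ∈ Set.Icc (0 : ℝ) 1) :
    edgePoint h hs ∈ edge a b := ⟨s, hs, rfl⟩

theorem edge_eq_of_apply {a b : T.V} (h : T.graph.Adj a b) {p : T.Point} (hp : p ∈ edge a b) :
    p.1 b ∈ Set.Icc (0 : ℝ) 1 ∧
      p.1 = Finsupp.single a (1 - p.1 b) + Finsupp.single b (p.1 b) := by
  obtain ⟨s, hs, hp⟩ := hp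
  have hb : p.1 b = s := by rw [hp]; simp [h.ne]
  rw [hb]; exact ⟨hs, hp⟩

theorem edgePoint_apply {a b : T.V} (h : T.graph.Adj a b) {s : ℝ} (hs : s ∈ Set.Icc (0 : ℝ) 1) :
    (edgePoint h hs).1 b = s := by
  simp [edgePoint, h.ne]

theorem edge_ext {a b : T.V} (h : T.graph.Adj a b) {p q : T.Point} (hp : p ∈ edge a b)
    (hq : q ∈ edge a b) (hpq : p.1 b = q.1 b) : p = q := by
  apply Subtype.ext
  rw [(edge_eq_of_apply h hp).2, (edge_eq_of_apply h hq).2, hpq]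

theorem edge_swap (a b : T.V) : (edge a b : Set T.Point) = edge b a := by
  have : ∀ a b : T.V, (edge a b : Set T.Point) ⊆ edge b a := by
    rintro a b p ⟨s, hs, hp⟩
    exact ⟨1 - s, ⟨by linarith [hs.2], by linarith [hs.1]⟩, by rw [hp, add_comm]; simp⟩
  exact (this a b).antisymm (this b a)

theorem vert_mem_edge_left (a b : T.V) : vert a ∈ (edge a b : Set T.Point) :=
  ⟨0, by simp, by simp [vert]⟩

theorem vert_mem_edge_right (a b : T.V) : vert b ∈ (edge a b : Set T.Point) :=
  ⟨1, by simp, by simp [vert]⟩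

theorem vert_injective {a b : T.V} (h : (vert a : T.Point) = vert b) : a = b := by
  have := congrArg Subtype.val h
  simpa [vert, Finsupp.single_left_inj] using this

theorem coord_edge {a b : T.V} (h : T.graph.Adj a b) {p : T.Point} (hp : p ∈ edge a b) :
    coord a b p = p.1 b := by
  rw [coord_of_eq (edge_eq_of_apply h hp).2, sideInd_of_mem (mem_side_self a b),
    sideInd_of_notMem (notMem_side T.isTree h)]; ring

theorem point_cases (p : T.Point) :
    (∃ a, p = vert a) ∨ ∃ a b, T.graph.Adj a b ∧ p ∈ edge a b := by
  obtain ⟨a, b, hab, s, hs, hp⟩ := p.2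
  rcases hab with rfl | hab
  · left
    refine ⟨a, Subtype.ext ?_⟩
    rw [hp, ← Finsupp.single_add]; simp [vert]
  · exact Or.inr ⟨a, b, hab, s, hs, hp⟩

theorem coord_mem_Icc (x y : T.V) (p : T.Point) : coord x y p ∈ Set.Icc (0 : ℝ) 1 := by
  obtain ⟨a, b, -, s, hs, hp⟩ := p.2
  rw [coord_of_eq hp]
  rcases sideInd_cases (Γ := T.graph) x y a with ⟨-, h1⟩ | ⟨-, h1⟩ <;>
  rcases sideInd_cases (Γ := T.graph) x y b with ⟨-, h2⟩ | ⟨-, h2⟩ <;>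
  rw [h1, h2] <;> constructor <;> linarith [hs.1, hs.2]

theorem coord_swap {x y : T.V} (h : T.graph.Adj x y) (p : T.Point) :
    coord y x p = 1 - coord x y p := by
  obtain ⟨a, b, -, s, hs, hp⟩ := p.2
  rw [coord_of_eq hp, coord_of_eq hp, sideInd_swap T.isTree h, sideInd_swap T.isTree h]; ring

/-- A point with a nontrivial coordinate lies in the interior of the edge. -/
theorem mem_edge_of_coord {x y : T.V} (h : T.graph.Adj x y) {p : T.Point}
    (h0 : coord x y p ≠ 0) (h1 : coord x y p ≠ 1) : p ∈ edge x y := by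
  rcases point_cases p with ⟨a, rfl⟩ | ⟨a, b, hab, hp⟩
  · rw [coord_vert] at h0 h1
    rcases sideInd_cases (Γ := T.graph) x y a with ⟨-, h1⟩ | ⟨-, h1⟩ <;> contradiction
  · obtain ⟨s, hs, hp'⟩ := id hp
    rw [coord_of_eq hp'] at h0 h1
    rcases sideInd_cases (Γ := T.graph) x y a with ⟨ha, h2⟩ | ⟨ha, h2⟩ <;>
    rcases sideInd_cases (Γ := T.graph) x y b with ⟨hb, h3⟩ | ⟨hb, h3⟩
    · rw [h2, h3] at h1; exact absurd (by ring) h1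
    · obtain ⟨rfl, rfl⟩ := eq_of_mem_side_of_notMem hab ha hb
      rwa [edge_swap]
    · obtain ⟨rfl, rfl⟩ := eq_of_mem_side_of_notMem hab.symm hb ha
      exact hp
    · rw [h2, h3] at h0; exact absurd (by ring) h0

/-- The edge from `a` to `b` points away from `o`. -/
def Away (o : T.V) (e : T.V × T.V) : Prop := T.graph.Adj e.1 e.2 ∧ o ∉ side T.graph e.1 e.2

/-- The indicator of a half-tree changes only across its own edge, and two orientations of one edge
cannot both point away from `o`. -/
theorem sideInd_eq_of_adj {o x y a b : T.V} (h : T.graph.Adj a b) (hne : (x, y) ≠ (a, b))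
    (ha : Away o (a, b)) (hx : Away o (x, y)) :
    sideInd T.graph x y a = sideInd T.graph x y b := by
  rcases sideInd_cases (Γ := T.graph) x y a with ⟨ha', h2⟩ | ⟨ha', h2⟩ <;>
  rcases sideInd_cases (Γ := T.graph) x y b with ⟨hb', h3⟩ | ⟨hb', h3⟩
  · rw [h2, h3]
  · obtain ⟨rfl, rfl⟩ := eq_of_mem_side_of_notMem h ha' hb'
    rcases mem_side_or T.isTree a b o with h4 | h4
    · exact absurd h4 ha.2
    · exact absurd h4 hx.2
  · obtain ⟨rfl, rfl⟩ := eq_of_mem_side_of_notMem h.symm hb' ha'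
    exact absurd rfl hne
  · rw [h2, h3]

theorem coord_eq_of_mem_edge {o a b : T.V} (ha : Away o (a, b)) {p q : T.Point}
    (hp : p ∈ edge a b) (hq : q ∈ edge a b) {e : T.V × T.V} (he : Away o e) (hne : e ≠ (a, b)) :
    coord e.1 e.2 p = coord e.1 e.2 q := by
  rw [coord_of_eq (edge_eq_of_apply ha.1 hp).2, coord_of_eq (edge_eq_of_apply ha.1 hq).2,
    sideInd_eq_of_adj (x := e.1) (y := e.2) ha.1 hne ha he]
  ring

theorem away_or {a b : T.V} (o : T.V) (h : T.graph.Adj a b) : Away o (a, b) ∨ Away o (b, a) := by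
  by_cases ho : o ∈ side T.graph a b
  · exact Or.inr ⟨h.symm, notMem_side_swap T.isTree h ho⟩
  · exact Or.inl ⟨h, ho⟩

/-- The distance seen by a finite set of edges. -/
def distOn (F : Finset (T.V × T.V)) (p q : T.Point) : ℝ :=
  ∑ e ∈ F, T.len e.1 e.2 * |coord e.1 e.2 p - coord e.1 e.2 q|

theorem distOn_self (F : Finset (T.V × T.V)) (p : T.Point) : distOn F p p = 0 := by
  simp [distOn]

theorem distOn_comm (F : Finset (T.V × T.V)) (p q : T.Point) : distOn F p q = distOn F q p := by
  simp only [distOn, abs_sub_comm]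

theorem distOn_triangle {o : T.V} {F : Finset (T.V × T.V)} (hF : ∀ e ∈ F, Away o e)
    (p q r : T.Point) : distOn F p r ≤ distOn F p q + distOn F q r := by
  rw [distOn, distOn, distOn, ← Finset.sum_add_distrib]
  refine Finset.sum_le_sum fun e he => ?_
  rw [← mul_add]
  exact mul_le_mul_of_nonneg_left (abs_sub_le _ _ _) (T.len_pos _ _ (hF e he).1).le

theorem distOn_mono {o : T.V} {F F' : Finset (T.V × T.V)} (hF : ∀ e ∈ F', Away o e)
    (hFF : F ⊆ F') (p q : T.Point) : distOn F p q ≤ distOn F' p q :=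
  Finset.sum_le_sum_of_subset_of_nonneg hFF fun e he _ =>
    mul_nonneg (T.len_pos _ _ (hF e he).1).le (abs_nonneg _)

theorem apply_swap {a b : T.V} (h : T.graph.Adj a b) {p : T.Point} (hp : p ∈ edge a b) :
    p.1 a = 1 - p.1 b := by
  have := (edge_eq_of_apply h hp).2
  rw [this]; simp [h.ne, h.ne']

theorem distOn_edge_le {o a b : T.V} (h : T.graph.Adj a b) {F : Finset (T.V × T.V)}
    (hF : ∀ e ∈ F, Away o e) {p q : T.Point} (hp : p ∈ edge a b) (hq : q ∈ edge a b) :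
    distOn F p q ≤ |p.1 b - q.1 b| * T.len a b := by
  have key : ∀ a b : T.V, Away o (a, b) → p ∈ edge a b → q ∈ edge a b →
      distOn F p q ≤ |p.1 b - q.1 b| * T.len a b := by
    intro a b ha hp hq
    have hnn : 0 ≤ |p.1 b - q.1 b| * T.len a b :=
      mul_nonneg (abs_nonneg _) (T.len_pos _ _ ha.1).le
    have hz : ∀ e ∈ F, e ≠ (a, b) → T.len e.1 e.2 * |coord e.1 e.2 p - coord e.1 e.2 q| = 0 := by
      intro e he hne
      rw [coord_eq_of_mem_edge ha hp hq (hF e he) hne]; simp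
    unfold distOn
    by_cases hmem : (a, b) ∈ F
    · rw [Finset.sum_eq_single_of_mem _ hmem hz, coord_edge ha.1 hp, coord_edge ha.1 hq, mul_comm]
    · rw [Finset.sum_eq_zero fun e he => hz e he fun h => hmem (h ▸ he)]
      exact hnn
  rcases away_or o h with ha | ha
  · exact key a b ha hp hq
  · have := key b a ha (by rwa [edge_swap]) (by rwa [edge_swap])
    rw [apply_swap h hp, apply_swap h hq, T.len_symm b a] at this
    rwa [show 1 - p.1 b - (1 - q.1 b) = -(p.1 b - q.1 b) by ring, abs_neg] at this

theorem IsPathLength.distOn_le {o : T.V} {F : Finset (T.V × T.V)} (hF : ∀ e ∈ F, Away o e)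
    {p q : T.Point} {L : ℝ} (h : IsPathLength p q L) : distOn F p q ≤ L := by
  induction h with
  | refl p => rw [distOn_self]
  | step a b p q r L hab hp hq h ih =>
    linarith [distOn_triangle hF p q r, distOn_edge_le hab hF hp hq]

theorem IsPathLength.trans {p q r : T.Point} {L L' : ℝ} (h : IsPathLength p q L)
    (h' : IsPathLength q r L') : IsPathLength p r (L + L') := by
  induction h with
  | refl p => simpa using h'
  | step a b p q _ L hab hp hq h ih =>
    rw [add_assoc]; exact IsPathLength.step a b p q r _ hab hp hq (ih h')

theorem IsPathLength.single {a b : T.V} (hab : T.graph.Adj a b) {p q : T.Point}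
    (hp : p ∈ edge a b) (hq : q ∈ edge a b) : IsPathLength p q (|p.1 b - q.1 b| * T.len a b) := by
  simpa using IsPathLength.step a b p q q 0 hab hp hq (IsPathLength.refl q)

/-- There is a path from `p` to `q` whose length is seen by finitely many edges. -/
def HasGeodesic (o : T.V) (p q : T.Point) : Prop :=
  ∃ (F : Finset (T.V × T.V)) (L : ℝ), (∀ e ∈ F, Away o e) ∧ IsPathLength p q L ∧ L ≤ distOn F p q

theorem HasGeodesic.refl (o : T.V) (p : T.Point) : HasGeodesic o p p :=
  ⟨∅, 0, by simp, IsPathLength.refl p, by simp [distOn]⟩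

-- Moving inside one edge changes only the coordinate of that edge. The hypothesis `hc` says that
-- this coordinate keeps moving away from its value at `p`, so the path length and the distance seen
-- by the edges grow by the same amount.
open Classical in
theorem HasGeodesic.extend {o a b : T.V} (h : T.graph.Adj a b) {p q r : T.Point}
    (hpq : HasGeodesic o p q) (hq : q ∈ edge a b) (hr : r ∈ edge a b)
    (hc : |coord a b p - coord a b q| + |coord a b q - coord a b r| =
      |coord a b p - coord a b r|) : HasGeodesic o p r := by
  have key : ∀ a b : T.V, Away o (a, b) → q ∈ edge a b → r ∈ edge a b →
      |coord a b p - coord a b q| + |coord a b q - coord a b r| = |coord a b p - coord a b r| →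
      HasGeodesic o p r := by
    intro a b ha hq hr hc
    obtain ⟨F, L, hF, hL, hLe⟩ := hpq
    have hF' : ∀ e ∈ insert (a, b) F, Away o e := by
      intro e he
      rcases Finset.mem_insert.1 he with rfl | he
      exacts [ha, hF e he]
    refine ⟨insert (a, b) F, _, hF', hL.trans (IsPathLength.single ha.1 hq hr), ?_⟩
    have h1 := distOn_mono hF' (Finset.subset_insert (a, b) F) p q
    have h2 : distOn (insert (a, b) F) p r = distOn (insert (a, b) F) p q +
        |r.1 b - q.1 b| * T.len a b := by
      have hm : (a, b) ∈ insert (a, b) F := Finset.mem_insert_self _ _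
      unfold distOn
      rw [← Finset.add_sum_erase _ _ hm, ← Finset.add_sum_erase _ _ hm]
      have : ∑ e ∈ (insert (a, b) F).erase (a, b),
          T.len e.1 e.2 * |coord e.1 e.2 p - coord e.1 e.2 r| =
          ∑ e ∈ (insert (a, b) F).erase (a, b),
          T.len e.1 e.2 * |coord e.1 e.2 p - coord e.1 e.2 q| := by
        refine Finset.sum_congr rfl fun e he => ?_
        rw [coord_eq_of_mem_edge ha hr hq (hF' e (Finset.mem_of_mem_erase he))
          (Finset.ne_of_mem_erase he)]
      rw [this]
      dsimp only
      rw [← hc, coord_edge ha.1 hq, coord_edge ha.1 hr, abs_sub_comm (r.1 b)]; ring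
    rw [h2, abs_sub_comm (q.1 b)]
    linarith
  rcases away_or o h with ha | ha
  · exact key a b ha hq hr hc
  · refine key b a ha (by rwa [edge_swap]) (by rwa [edge_swap]) ?_
    rw [coord_swap h, coord_swap h, coord_swap h]
    simp only [sub_sub_sub_cancel_left]
    rwa [abs_sub_comm, abs_sub_comm (coord a b r), abs_sub_comm (coord a b r)]

theorem HasGeodesic.walk {o : T.V} {p : T.Point} {c b : T.V} (W : T.graph.Walk c b)
    (hc : HasGeodesic o p (vert c)) (hW : ∀ d ∈ W.darts, coord d.fst d.snd p = 0) :
    HasGeodesic o p (vert b) := by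
  induction W with
  | nil => exact hc
  | @cons c c' b h W ih =>
    refine ih (hc.extend h (vert_mem_edge_left _ _) (vert_mem_edge_right _ _) ?_)
      fun d hd => hW d (by simp [hd])
    have := hW ⟨(c, c'), h⟩ (by simp)
    dsimp only at this
    rw [this, coord_vert, coord_vert, sideInd_of_mem (mem_side_self _ _),
      sideInd_of_notMem (notMem_side T.isTree h)]
    simp

theorem hasGeodesic_vert (o : T.V) (p : T.Point) (b : T.V) : HasGeodesic o p (vert b) := by
  rcases point_cases p with ⟨a, rfl⟩ | ⟨a, a', h, hp⟩
  · obtain ⟨W, hW, -⟩ := T.isTree.existsUnique_path a b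
    refine (HasGeodesic.refl o (vert a)).walk W fun d hd => ?_
    rw [coord_vert]
    exact sideInd_of_notMem (start_notMem_side T.isTree W hW d hd)
  · have key : ∀ a a' : T.V, T.graph.Adj a a' → p ∈ edge a a' → b ∉ side T.graph a a' →
        HasGeodesic o p (vert b) := by
      intro a a' h hp hb
      obtain ⟨W, hW, -⟩ := T.isTree.existsUnique_path a b
      refine ((HasGeodesic.refl o p).extend h hp (vert_mem_edge_left a a') (by simp)).walk W
        fun d hd => ?_
      have h0 := start_notMem_side T.isTree W hW d hd
      have h1 : a' ∉ side T.graph d.fst d.snd := by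
        intro h1
        obtain ⟨h2, h3⟩ := eq_of_mem_side_of_notMem h.symm h1 h0
        exact hb (by rw [h2, h3]; exact end_mem_side T.isTree W hW d hd)
      rw [coord_of_eq (edge_eq_of_apply h hp).2, sideInd_of_notMem h0, sideInd_of_notMem h1]
      simp
    by_cases hb : b ∈ side T.graph a a'
    · exact key a' a h.symm (by rwa [edge_swap]) (notMem_side_swap T.isTree h hb)
    · exact key a a' h hp hb

theorem hasGeodesic (o : T.V) (p r : T.Point) : HasGeodesic o p r := by
  rcases point_cases r with ⟨b, rfl⟩ | ⟨b, b', h, hr⟩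
  · exact hasGeodesic_vert o p b
  · by_cases h0 : coord b b' p = 0
    · refine (hasGeodesic_vert o p b).extend h (vert_mem_edge_left _ _) hr ?_
      rw [h0, coord_vert, sideInd_of_notMem (notMem_side T.isTree h)]; simp
    by_cases h1 : coord b b' p = 1
    · refine (hasGeodesic_vert o p b').extend h (vert_mem_edge_right _ _) hr ?_
      rw [h1, coord_vert, sideInd_of_mem (mem_side_self _ _)]; simp
    · exact (HasGeodesic.refl o p).extend h (mem_edge_of_coord h h0 h1) hr (by simp)

theorem IsPathLength.nonneg {p q : T.Point} {L : ℝ} (h : IsPathLength p q L) : 0 ≤ L := by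
  induction h with
  | refl p => exact le_rfl
  | step a b p q r L hab hp hq h ih =>
    exact add_nonneg (mul_nonneg (abs_nonneg _) (T.len_pos _ _ hab).le) ih

/-- Every path is at least as long as what any finite set of edges sees, and some path attains this.
Allowing all larger sets `F'` makes it possible to compute several distances with one set, so that
metric identities can be checked edge by edge. -/
theorem exists_dist_eq_distOn (o : T.V) (p q : T.Point) :
    ∃ F : Finset (T.V × T.V), (∀ e ∈ F, Away o e) ∧ IsPathLength p q (GTree.dist p q) ∧
      ∀ F' : Finset (T.V × T.V), (∀ e ∈ F', Away o e) → F ⊆ F' →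
        GTree.dist p q = distOn F' p q := by
  obtain ⟨F, L, hF, hL, hLe⟩ := hasGeodesic o p q
  have hd : GTree.dist p q = L := by
    refine le_antisymm (csInf_le ⟨0, fun L' h => h.nonneg⟩ hL) (le_csInf ⟨L, hL⟩ fun L' h => ?_)
    exact hLe.trans (h.distOn_le hF)
  refine ⟨F, hF, hd ▸ hL, fun F' hF' hs => ?_⟩
  rw [hd]
  exact le_antisymm (hLe.trans (distOn_mono hF' hs p q)) (hL.distOn_le hF')

theorem exists_root (p : T.Point) : ∃ _ : T.V, True := by
  obtain ⟨a, -⟩ := p.2; exact ⟨a, trivial⟩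

theorem IsPathLength.eq_of_zero {p q : T.Point} {L : ℝ} (h : IsPathLength p q L) (hL : L = 0) :
    p = q := by
  induction h with
  | refl p => rfl
  | step a b p q r L hab hp hq h ih =>
    have h1 : 0 ≤ |p.1 b - q.1 b| * T.len a b :=
      mul_nonneg (abs_nonneg _) (T.len_pos _ _ hab).le
    have h2 := h.nonneg
    rw [← ih (by linarith)]
    have h3 : |p.1 b - q.1 b| * T.len a b = 0 := by linarith
    rcases mul_eq_zero.1 h3 with h4 | h4
    · exact edge_ext hab hp hq (sub_eq_zero.1 (abs_eq_zero.1 h4))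
    · exact absurd h4 (T.len_pos _ _ hab).ne'

open Classical in
instance : MetricSpace T.Point where
  dist := GTree.dist
  dist_self p := by
    obtain ⟨o, -⟩ := exists_root p
    obtain ⟨F, hF, -, h⟩ := exists_dist_eq_distOn o p p
    rw [h F hF subset_rfl, distOn_self]
  dist_comm p q := by
    obtain ⟨o, -⟩ := exists_root p
    obtain ⟨F, hF, -, h⟩ := exists_dist_eq_distOn o p q
    obtain ⟨F', hF', -, h'⟩ := exists_dist_eq_distOn o q p
    have hU : ∀ e ∈ F ∪ F', Away o e := fun e he =>
      (Finset.mem_union.1 he).elim (hF e) (hF' e)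
    rw [h _ hU Finset.subset_union_left, h' _ hU Finset.subset_union_right, distOn_comm]
  dist_triangle p q r := by
    obtain ⟨o, -⟩ := exists_root p
    obtain ⟨F, hF, -, h⟩ := exists_dist_eq_distOn o p q
    obtain ⟨F', hF', -, h'⟩ := exists_dist_eq_distOn o q r
    obtain ⟨F'', hF'', -, h''⟩ := exists_dist_eq_distOn o p r
    have hU : ∀ e ∈ F ∪ F' ∪ F'', Away o e := by
      intro e he
      simp only [Finset.mem_union] at he
      rcases he with (he | he) | he
      exacts [hF e he, hF' e he, hF'' e he]
    rw [h _ hU (by intro; simp +contextual), h' _ hU (by intro; simp +contextual),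
      h'' _ hU (by intro; simp +contextual)]
    exact distOn_triangle hU p q r
  eq_of_dist_eq_zero {p q} hpq := by
    obtain ⟨o, -⟩ := exists_root p
    obtain ⟨F, hF, hL, -⟩ := exists_dist_eq_distOn o p q
    exact hL.eq_of_zero hpq

end GTree

end GBS

end

noncomputable section

namespace GBS

universe u v w

/-! ### Gromov products and the four point condition -/

namespace GTree

variable {G : Type u} [Group G] {T : GTree.{u, v} G}

/-- The Gromov product at `o` seen by a finite set of edges pointing away from `o`. -/
def prodOn (F : Finset (T.V × T.V)) (p q : T.Point) : ℝ :=
  ∑ e ∈ F, T.len e.1 e.2 * min (coord e.1 e.2 p) (coord e.1 e.2 q)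

theorem prodOn_comm (F : Finset (T.V × T.V)) (p q : T.Point) : prodOn F p q = prodOn F q p := by
  simp only [prodOn, min_comm]

theorem distOn_eq_prodOn (F : Finset (T.V × T.V)) (p q : T.Point) :
    distOn F p q = prodOn F p p + prodOn F q q - 2 * prodOn F p q := by
  simp only [distOn, prodOn, Finset.mul_sum, ← Finset.sum_add_distrib, ← Finset.sum_sub_distrib]
  refine Finset.sum_congr rfl fun e _ => ?_
  rcases le_total (coord e.1 e.2 p) (coord e.1 e.2 q) with h | h
  · rw [min_eq_left h, abs_of_nonpos (by linarith), min_self, min_self]; ring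
  · rw [min_eq_right h, abs_of_nonneg (by linarith), min_self, min_self]; ring

theorem exists_mem_support_of_coord_pos {a b : T.V} {p : T.Point} (h : 0 < coord a b p) :
    ∃ c, p.1 c ≠ 0 ∧ c ∈ side T.graph a b := by
  by_contra! hn
  refine h.ne' ?_
  rw [coord, Finsupp.linearCombination_apply, Finsupp.sum]
  refine Finset.sum_eq_zero fun c hc => ?_
  rw [sideInd_of_notMem (hn c (Finsupp.mem_support_iff.1 hc)), smul_zero]

theorem adj_of_mem_support {p : T.Point} {c c' : T.V} (h : p.1 c ≠ 0) (h' : p.1 c' ≠ 0)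
    (hne : c ≠ c') : T.graph.Adj c c' := by
  obtain ⟨a, b, hab, s, -, hp⟩ := p.2
  have key : ∀ c, p.1 c ≠ 0 → c = a ∨ c = b := by
    intro c hc
    by_contra! hn
    refine hc ?_
    rw [hp]; simp [hn.1.symm, hn.2.symm]
  rcases key c h with rfl | rfl <;> rcases key c' h' with rfl | rfl
  · exact absurd rfl hne
  · exact hab.resolve_left hne
  · exact (hab.resolve_left hne.symm).symm
  · exact absurd rfl hne

/-- The edges separating a point from `o` are linearly ordered, and a point that is beyond some
point of an edge is beyond all smaller edges. -/
theorem coord_eq_one_of_subset {e e' : T.V × T.V} (hne : e ≠ e')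
    (hs : side T.graph e'.1 e'.2 ⊆ side T.graph e.1 e.2) {p : T.Point}
    (hp : 0 < coord e'.1 e'.2 p) : coord e.1 e.2 p = 1 := by
  obtain ⟨c, hc, hc'⟩ := exists_mem_support_of_coord_pos hp
  have hce := hs hc'
  have key : ∀ d, p.1 d ≠ 0 → d ∈ side T.graph e.1 e.2 := by
    intro d hd
    by_contra hde
    have hcd : c ≠ d := fun h => hde (h ▸ hce)
    have hadj := adj_of_mem_support hc hd hcd
    obtain ⟨h1, h2⟩ := eq_of_mem_side_of_notMem hadj hce hde
    obtain ⟨h3, h4⟩ := eq_of_mem_side_of_notMem hadj hc' (fun h => hde (hs h))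
    exact hne (Prod.ext (h2.symm.trans h4) (h1.symm.trans h3))
  obtain ⟨a, b, -, s, hs', hp'⟩ := id p.2
  have hsum : coord e.1 e.2 p = Finsupp.linearCombination ℝ (fun _ => (1 : ℝ)) p.1 := by
    rw [coord, Finsupp.linearCombination_apply, Finsupp.linearCombination_apply, Finsupp.sum,
      Finsupp.sum]
    refine Finset.sum_congr rfl fun d hd => ?_
    rw [sideInd_of_mem (key d (Finsupp.mem_support_iff.1 hd))]
  rw [hsum, hp']
  simp [Finsupp.linearCombination_single]

/-- Otherwise the support of `p` has a vertex in each half-tree but none in both. These two vertices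
would be the ends of both edges, in opposite orders, and one of the orientations would point towards
`o`. -/
theorem exists_common_of_coord_pos {o : T.V} {e e' : T.V × T.V} (he : Away o e) (he' : Away o e')
    {p : T.Point} (h : 0 < coord e.1 e.2 p) (h' : 0 < coord e'.1 e'.2 p) :
    ∃ c, c ∈ side T.graph e.1 e.2 ∧ c ∈ side T.graph e'.1 e'.2 := by
  obtain ⟨c, hc, hce⟩ := exists_mem_support_of_coord_pos h
  obtain ⟨d, hd, hde⟩ := exists_mem_support_of_coord_pos h'
  by_contra! hn
  have hcd : c ≠ d := fun h => hn c hce (h ▸ hde)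
  have hadj := adj_of_mem_support hc hd hcd
  obtain ⟨h1, h2⟩ := eq_of_mem_side_of_notMem hadj hce (fun h => hn d h hde)
  obtain ⟨h3, h4⟩ := eq_of_mem_side_of_notMem hadj.symm hde (hn c hce)
  subst h1 h2
  rcases mem_side_or T.isTree e.1 e.2 o with ho | ho
  · exact he.2 ho
  · exact he'.2 (by rwa [← h3, ← h4])

/-- Edges between `o` and `q` have nested half-trees, and `p` and `r` each follow `q` along an
initial part of this chain. If both alternatives failed, there would be an edge where `p` goes
further than `r` and another one where `r` goes further than `p`; but on the outer of the two edges
all three coordinates involved would be saturated at `1`. -/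
theorem prodOn_ultrametric {o : T.V} {F : Finset (T.V × T.V)} (hF : ∀ e ∈ F, Away o e)
    (p q r : T.Point) : prodOn F p q ≤ prodOn F p r ∨ prodOn F q r ≤ prodOn F p r := by
  have hmono : ∀ p q r : T.Point, (∀ e ∈ F, min (coord e.1 e.2 p) (coord e.1 e.2 q) ≤
      min (coord e.1 e.2 q) (coord e.1 e.2 r)) → prodOn F p q ≤ prodOn F p r := by
    intro p q r h
    refine Finset.sum_le_sum fun e he =>
      mul_le_mul_of_nonneg_left ?_ (T.len_pos _ _ (hF e he).1).le
    exact le_min (min_le_left _ _) ((h e he).trans (min_le_right _ _))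
  by_cases h1 : ∀ e ∈ F, min (coord e.1 e.2 p) (coord e.1 e.2 q) ≤
      min (coord e.1 e.2 q) (coord e.1 e.2 r)
  · exact Or.inl (hmono p q r h1)
  by_cases h2 : ∀ e ∈ F, min (coord e.1 e.2 r) (coord e.1 e.2 q) ≤
      min (coord e.1 e.2 q) (coord e.1 e.2 p)
  · right
    rw [prodOn_comm F q r, prodOn_comm F p r]
    exact hmono r q p h2
  exfalso
  push Not at h1 h2
  obtain ⟨e, he, h1⟩ := h1
  obtain ⟨e', he', h2⟩ := h2
  have hnn : ∀ (e : T.V × T.V) (x : T.Point), 0 ≤ coord e.1 e.2 x := fun e x =>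
    (coord_mem_Icc _ _ x).1
  have hle : ∀ (e : T.V × T.V) (x : T.Point), coord e.1 e.2 x ≤ 1 := fun e x =>
    (coord_mem_Icc _ _ x).2
  have hpe := lt_of_le_of_lt (le_min (hnn e q) (hnn e r)) h1
  have hpe' := lt_of_le_of_lt (le_min (hnn e' q) (hnn e' p)) h2
  rw [lt_min_iff] at hpe hpe'
  have hne : e ≠ e' := by
    rintro rfl
    rw [min_comm (coord e.1 e.2 r), min_comm (coord e.1 e.2 q)] at h2
    exact lt_asymm h1 h2
  obtain ⟨c, hc, hc'⟩ := exists_common_of_coord_pos (hF e he) (hF e' he') hpe.2 hpe'.2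
  rcases side_nested T.isTree (hF e he).1 (hF e he).2 (hF e' he').2 hc hc' with hs | hs
  · have a1 := coord_eq_one_of_subset hne.symm hs hpe.1
    have a2 := coord_eq_one_of_subset hne.symm hs hpe.2
    rw [a1, a2, min_self] at h2
    exact absurd (min_le_right _ _) (not_le.2 h2)
  · have a1 := coord_eq_one_of_subset hne hs hpe'.1
    have a2 := coord_eq_one_of_subset hne hs hpe'.2
    rw [a1, a2, min_self] at h1
    exact absurd (min_le_right _ _) (not_le.2 h1)

/-- Written with Gromov products at `o`, the diagonal terms cancel. What remains is that the sum of
the products of `x, y` and of `z, w` is at least the smaller of the two other sums, which follows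
from the ultrametric inequality. -/
theorem distOn_four_point {o : T.V} {F : Finset (T.V × T.V)} (hF : ∀ e ∈ F, Away o e)
    (x y z w : T.Point) : distOn F x y + distOn F z w ≤
      max (distOn F x z + distOn F y w) (distOn F x w + distOn F y z) := by
  simp only [distOn_eq_prodOn]
  have h1 := prodOn_ultrametric hF x z y
  have h2 := prodOn_ultrametric hF x w y
  have h3 := prodOn_ultrametric hF z x w
  have h4 := prodOn_ultrametric hF z y w
  simp only [prodOn_comm F z y, prodOn_comm F z x, prodOn_comm F w y] at h1 h2 h3 h4
  rw [le_max_iff]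
  by_contra! hn
  rcases le_total (prodOn F x y) (prodOn F z w) with h5 | h5 <;>
  rcases h1 with h1 | h1 <;> rcases h2 with h2 | h2 <;>
  rcases h3 with h3 | h3 <;> rcases h4 with h4 | h4 <;> linarith [hn.1, hn.2]

open Classical in
/-- Finitely many edges see all distances between finitely many points. -/
theorem exists_dist_eq_distOn_finset (o : T.V) (P : Finset T.Point) (F₀ : Finset (T.V × T.V))
    (hF₀ : ∀ e ∈ F₀, Away o e) :
    ∃ F : Finset (T.V × T.V), (∀ e ∈ F, Away o e) ∧ F₀ ⊆ F ∧
      ∀ p ∈ P, ∀ q ∈ P, Dist.dist p q = distOn F p q := by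
  choose F hF _ hd using fun p q : T.Point => exists_dist_eq_distOn o p q
  have hU : ∀ e ∈ F₀ ∪ (P ×ˢ P).biUnion (fun x => F x.1 x.2), Away o e := by
    intro e he
    rcases Finset.mem_union.1 he with he | he
    · exact hF₀ e he
    · obtain ⟨x, -, hx⟩ := Finset.mem_biUnion.1 he
      exact hF _ _ e hx
  refine ⟨_, hU, Finset.subset_union_left, fun p hp q hq => hd p q _ hU ?_⟩
  intro e he
  exact Finset.mem_union_right _
    (Finset.mem_biUnion.2 ⟨(p, q), Finset.mk_mem_product hp hq, he⟩)

theorem IsPathLength.split {p q : T.Point} {L : ℝ} (h : IsPathLength p q L) {t : ℝ} (h0 : 0 ≤ t)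
    (h1 : t ≤ L) : ∃ z, IsPathLength p z t ∧ IsPathLength z q (L - t) := by
  induction h generalizing t with
  | refl p =>
    obtain rfl : t = 0 := le_antisymm h1 h0
    exact ⟨p, IsPathLength.refl p, by simpa using IsPathLength.refl p⟩
  | step a b p q r L hab hp hq h ih =>
    have hl := T.len_pos _ _ hab
    set c := |p.1 b - q.1 b| * T.len a b with hc
    by_cases ht : t ≤ c
    · rcases eq_or_ne c 0 with hc0 | hc0
      · obtain rfl : t = 0 := le_antisymm (ht.trans hc0.le) h0
        exact ⟨p, IsPathLength.refl p, by
          simpa using IsPathLength.step a b p q r L hab hp hq h⟩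
      · have hcpos : 0 < c := lt_of_le_of_ne (h0.trans ht) hc0.symm
        have hp' := (edge_eq_of_apply hab hp).1
        have hq' := (edge_eq_of_apply hab hq).1
        have hu0 : 0 ≤ t / c := div_nonneg h0 hcpos.le
        have hu1 : t / c ≤ 1 := (div_le_one hcpos).2 ht
        have hs : p.1 b + t / c * (q.1 b - p.1 b) ∈ Set.Icc (0 : ℝ) 1 := by
          have e : p.1 b + t / c * (q.1 b - p.1 b) = (1 - t / c) * p.1 b + t / c * q.1 b := by ring
          rw [e]
          have h1u : 0 ≤ 1 - t / c := by linarith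
          constructor
          · exact add_nonneg (mul_nonneg h1u hp'.1) (mul_nonneg hu0 hq'.1)
          · nlinarith [hp'.2, hq'.2]
        have hz := edgePoint_mem hab hs
        have hzb := edgePoint_apply hab hs
        refine ⟨edgePoint hab hs, ?_, ?_⟩
        · have := IsPathLength.single hab hp hz
          rw [hzb] at this
          convert this using 1
          rw [show p.1 b - (p.1 b + t / c * (q.1 b - p.1 b)) = t / c * (p.1 b - q.1 b) by ring,
            abs_mul, abs_of_nonneg hu0, mul_assoc, ← hc, div_mul_cancel₀ _ hc0]
        · have := IsPathLength.step a b _ q r L hab hz hq h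
          rw [hzb] at this
          convert this using 1
          rw [show p.1 b + t / c * (q.1 b - p.1 b) - q.1 b = (1 - t / c) * (p.1 b - q.1 b) by ring,
            abs_mul, abs_of_nonneg (by linarith), mul_assoc, ← hc]
          field_simp
          ring
    · obtain ⟨z, hz, hz'⟩ := ih (t := t - c) (by linarith) (by linarith)
      refine ⟨z, ?_, ?_⟩
      · have := IsPathLength.step a b p q z _ hab hp hq hz
        rwa [← hc, add_sub_cancel] at this
      · convert hz' using 1; ring

theorem dist_le_of_isPathLength {p q : T.Point} {L : ℝ} (h : IsPathLength p q L) :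
    Dist.dist p q ≤ L := csInf_le ⟨0, fun _ h => h.nonneg⟩ h

theorem isPathLength_dist (p q : T.Point) : IsPathLength p q (Dist.dist p q) := by
  obtain ⟨o, -⟩ := exists_root p
  obtain ⟨-, -, h, -⟩ := exists_dist_eq_distOn o p q
  exact h

open Classical in
instance : TreeMetric T.Point where
  exists_between x y t h0 h1 := by
    obtain ⟨z, hz, hz'⟩ := (isPathLength_dist x y).split h0 h1
    have h2 := dist_le_of_isPathLength hz
    have h3 := dist_le_of_isPathLength hz'
    have := dist_triangle x z y
    exact ⟨z, by linarith, by linarith⟩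
  four_point x y z w := by
    obtain ⟨o, -⟩ := exists_root x
    obtain ⟨F, hF, -, hd⟩ := exists_dist_eq_distOn_finset o {x, y, z, w} ∅ (by simp)
    rw [hd x (by simp) y (by simp), hd z (by simp) w (by simp), hd x (by simp) z (by simp),
      hd y (by simp) w (by simp), hd x (by simp) w (by simp), hd y (by simp) z (by simp)]
    exact distOn_four_point hF x y z w

-- The distance is a sum over edges and the triangle inequality holds for each term, so equality for
-- the sum forces equality for each edge.
open Classical in
theorem Between.coord {x z y : T.Point} (h : Between x z y) {a b : T.V} (hab : T.graph.Adj a b) :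
    |coord a b x - coord a b z| + |coord a b z - coord a b y| = |coord a b x - coord a b y| := by
  have key : ∀ a b : T.V, Away a (a, b) → |GTree.coord a b x - GTree.coord a b z| +
      |GTree.coord a b z - GTree.coord a b y| = |GTree.coord a b x - GTree.coord a b y| := by
    intro a b ha
    obtain ⟨F, hF, hs, hd⟩ := exists_dist_eq_distOn_finset a {x, y, z} {(a, b)} (by simpa using ha)
    unfold Between at h
    rw [hd x (by simp) z (by simp), hd x (by simp) y (by simp), hd z (by simp) y (by simp)] at h
    unfold distOn at h
    rw [← Finset.sum_add_distrib] at h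
    have := (Finset.sum_eq_sum_iff_of_le (s := F)
      (f := fun e : T.V × T.V => T.len e.1 e.2 * |GTree.coord e.1 e.2 x - GTree.coord e.1 e.2 y|)
      (g := fun e => T.len e.1 e.2 * |GTree.coord e.1 e.2 x - GTree.coord e.1 e.2 z| +
        T.len e.1 e.2 * |GTree.coord e.1 e.2 z - GTree.coord e.1 e.2 y|) (fun e he => by
          rw [← mul_add]
          exact mul_le_mul_of_nonneg_left (abs_sub_le _ _ _) (T.len_pos _ _ (hF e he).1).le)).1
      h.symm (a, b) (hs (by simp))
    dsimp only at this
    rw [← mul_add] at this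
    exact (mul_left_cancel₀ (T.len_pos _ _ ha.1).ne' this).symm
  exact key a b ⟨hab, notMem_side T.isTree hab⟩

/-! ### Edges as intervals, and branch points -/

theorem dist_edge {a b : T.V} (h : T.graph.Adj a b) {p q : T.Point} (hp : p ∈ edge a b)
    (hq : q ∈ edge a b) : Dist.dist p q = |p.1 b - q.1 b| * T.len a b := by
  refine le_antisymm (dist_le_of_isPathLength (IsPathLength.single h hp hq)) ?_
  have ha : Away a (a, b) := ⟨h, notMem_side T.isTree h⟩
  have := (isPathLength_dist p q).distOn_le (o := a) (F := {(a, b)}) (by simpa using ha)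
  rw [distOn, Finset.sum_singleton, coord_edge h hp, coord_edge h hq, mul_comm] at this
  exact this

theorem vert_apply_self (a : T.V) : (vert a : T.Point).1 a = 1 := by simp [vert]

theorem vert_apply_of_ne {a b : T.V} (h : a ≠ b) : (vert a : T.Point).1 b = 0 := by
  simp [vert, h]

theorem dist_vert_of_adj {a b : T.V} (h : T.graph.Adj a b) :
    Dist.dist (vert a : T.Point) (vert b) = T.len a b := by
  rw [dist_edge h (vert_mem_edge_left a b) (vert_mem_edge_right a b), vert_apply_self,
    vert_apply_of_ne h.ne]
  simp

theorem between_of_mem_edge {a b : T.V} (h : T.graph.Adj a b) {p : T.Point} (hp : p ∈ edge a b) :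
    Between (vert a) p (vert b) := by
  have hb := (edge_eq_of_apply h hp).1
  rw [Between, dist_vert_of_adj h, dist_edge h (vert_mem_edge_left a b) hp,
    dist_edge h hp (vert_mem_edge_right a b), vert_apply_self, vert_apply_of_ne h.ne,
    abs_of_nonpos (by linarith [hb.1]), abs_of_nonpos (by linarith [hb.2])]
  ring

theorem mem_edge_of_between {a b : T.V} (h : T.graph.Adj a b) {p : T.Point}
    (hp : Between (vert a) p (vert b)) : p ∈ edge a b := by
  have hl := T.len_pos _ _ h
  have hle := hp.dist_le_left
  rw [dist_vert_of_adj h] at hle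
  have hs : Dist.dist (vert a) p / T.len a b ∈ Set.Icc (0 : ℝ) 1 :=
    ⟨div_nonneg dist_nonneg hl.le, (div_le_one hl).2 hle⟩
  have hz := edgePoint_mem h hs
  have : p = edgePoint h hs := by
    refine hp.eq_of_dist_eq (between_of_mem_edge h hz) ?_
    rw [dist_edge h (vert_mem_edge_left a b) hz, edgePoint_apply, vert_apply_of_ne h.ne,
      zero_sub, abs_neg, abs_of_nonneg hs.1, div_mul_cancel₀ _ hl.ne']
  rw [this]; exact hz

/-- The point is a vertex. -/
def IsVert (p : T.Point) : Prop := ∃ a, p = vert a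

theorem eq_of_vert_mem_edge {a b c : T.V} (h : (vert c : T.Point) ∈ edge a b) : c = a ∨ c = b := by
  by_contra! hn
  obtain ⟨s, hs, hp⟩ := h
  have := DFunLike.congr_fun hp c
  simp [vert, hn.1.symm, hn.2.symm] at this

theorem isVert_of_coord {a b : T.V} (h : T.graph.Adj a b) {p : T.Point} (hp : p ∈ edge a b)
    (h01 : coord a b p = 0 ∨ coord a b p = 1) : IsVert p := by
  rw [coord_edge h hp] at h01
  rcases h01 with h0 | h1
  · exact ⟨a, edge_ext h hp (vert_mem_edge_left a b) (by rw [h0, vert_apply_of_ne h.ne])⟩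
  · exact ⟨b, edge_ext h hp (vert_mem_edge_right a b) (by rw [h1, vert_apply_self])⟩

/-- Branch points are vertices. -/
theorem isVert_med (p q r : T.Point) : IsVert (med p q r) ∨ med p q r = p ∨ med p q r = q ∨
    med p q r = r := by
  set m := med p q r with hm
  rcases point_cases m with h | ⟨a, b, hab, hmem⟩
  · exact Or.inl h
  by_cases h01 : coord a b m = 0 ∨ coord a b m = 1
  · exact Or.inl (isVert_of_coord hab hmem h01)
  push Not at h01
  right
  have h1 := Between.coord (med_between_left p q r) hab
  have h2 := Between.coord (med_between_right p q r) hab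
  have h3 := Between.coord (med_between p q r) hab
  rw [← hm] at h1 h2 h3
  have key : ∀ x, coord a b m = coord a b x → m = x := by
    intro x hx
    rw [hx] at h01
    have hxe := mem_edge_of_coord hab h01.1 h01.2
    refine edge_ext hab hmem hxe ?_
    rw [← coord_edge hab hmem, ← coord_edge hab hxe, hx]
  -- In the coordinate of this edge, `m` is between any two of the other three points. Among real
  -- numbers the median of three is one of the three.
  have : coord a b m = coord a b p ∨ coord a b m = coord a b q ∨ coord a b m = coord a b r := by
    generalize coord a b m = M at *
    generalize coord a b p = P at *
    generalize coord a b q = Q at *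
    generalize coord a b r = R at *
    clear key
    by_contra! hn
    obtain ⟨n1, n2, n3⟩ := hn
    rcases lt_or_gt_of_ne n1 with n1 | n1 <;> rcases lt_or_gt_of_ne n2 with n2 | n2 <;>
    rcases lt_or_gt_of_ne n3 with n3 | n3 <;>
    grind
  exact this.imp (key p) (Or.imp (key q) (key r))

theorem isVert_med_vert {p q r : T.Point} (hp : IsVert p) (hq : IsVert q) (hr : IsVert r) :
    IsVert (med p q r) := by
  rcases isVert_med p q r with h | h | h | h
  · exact h
  all_goals rw [h]; assumption

/-- An edge is traversed in one direction by the segments ending at a vertex. -/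
theorem between_vert_of_adj {a b : T.V} (h : T.graph.Adj a b) (c : T.V) :
    Between (vert c : T.Point) (vert a) (vert b) ∨ Between (vert c : T.Point) (vert b) (vert a) := by
  obtain ⟨d, hd⟩ := isVert_med_vert (p := (vert c : T.Point)) ⟨c, rfl⟩ ⟨a, rfl⟩ ⟨b, rfl⟩
  have h1 := med_between_left (vert c : T.Point) (vert a) (vert b)
  have h2 := med_between_right (vert c : T.Point) (vert a) (vert b)
  have h3 := med_between (vert c : T.Point) (vert a) (vert b)
  rw [hd] at h1 h2 h3
  rcases eq_of_vert_mem_edge (mem_edge_of_between h h2) with rfl | rfl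
  · exact Or.inl h3
  · exact Or.inr h1

theorem between_of_adj_of_adj {a b c : T.V} (h : T.graph.Adj a b) (h' : T.graph.Adj b c)
    (hne : a ≠ c) : Between (vert a : T.Point) (vert b) (vert c) := by
  rcases between_vert_of_adj h' a with h1 | h1
  · exact h1
  · rcases eq_of_vert_mem_edge (mem_edge_of_between h h1) with h2 | h2
    · exact absurd h2.symm hne
    · exact (h'.ne' h2).elim

/-! ### The action -/

theorem smul_val (g : G) (p : T.Point) : (g • p).1 = Finsupp.mapDomain (fun a => g • a) p.1 := rfl

instance : MulAction G T.Point where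
  one_smul p := by
    apply Subtype.ext
    rw [smul_val]
    simp only [one_smul]
    exact Finsupp.mapDomain_id
  mul_smul g h p := by
    apply Subtype.ext
    rw [smul_val, smul_val, smul_val, ← Finsupp.mapDomain_comp]
    congr 1
    funext a
    exact mul_smul g h a

theorem smul_vert (g : G) (a : T.V) : g • (vert a : T.Point) = vert (g • a) := by
  apply Subtype.ext
  rw [smul_val]
  simp [vert, Finsupp.mapDomain_single]

theorem smul_mem_edge (g : G) {a b : T.V} {p : T.Point} (hp : p ∈ edge a b) :
    g • p ∈ edge (g • a) (g • b) := by
  obtain ⟨s, hs, hp⟩ := hp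
  refine ⟨s, hs, ?_⟩
  rw [smul_val, hp, Finsupp.mapDomain_add, Finsupp.mapDomain_single, Finsupp.mapDomain_single]

theorem smul_apply_smul (g : G) (p : T.Point) (b : T.V) : (g • p).1 (g • b) = p.1 b := by
  rw [smul_val]
  exact Finsupp.mapDomain_apply (MulAction.injective g) p.1 b

theorem IsPathLength.smul (g : G) {p q : T.Point} {L : ℝ} (h : IsPathLength p q L) :
    IsPathLength (g • p) (g • q) L := by
  induction h with
  | refl p => exact IsPathLength.refl _
  | step a b p q r L hab hp hq h ih =>
    have := IsPathLength.step (g • a) (g • b) (g • p) (g • q) (g • r) L (T.adj_smul g a b hab)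
      (smul_mem_edge g hp) (smul_mem_edge g hq) ih
    rwa [smul_apply_smul, smul_apply_smul, T.len_smul g a b hab] at this

theorem dist_smul_smul (g : G) (p q : T.Point) : Dist.dist (g • p) (g • q) = Dist.dist p q := by
  refine le_antisymm (dist_le_of_isPathLength ((isPathLength_dist p q).smul g)) ?_
  have := dist_le_of_isPathLength ((isPathLength_dist (g • p) (g • q)).smul g⁻¹)
  rwa [inv_smul_smul, inv_smul_smul] at this

theorem Between.smul {x z y : T.Point} (h : Between x z y) (g : G) :
    Between (g • x) (g • z) (g • y) := h.map_isometry (dist_smul_smul g)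

theorem IsVert.smul {p : T.Point} (h : IsVert p) (g : G) : IsVert (g • p) := by
  obtain ⟨a, rfl⟩ := h
  exact ⟨g • a, smul_vert g a⟩

/-- An element that fixes a point fixes a vertex. -/
theorem exists_fixed_vertex {g : G} {p : T.Point} (h : g • p = p) : ∃ a : T.V, g • a = a := by
  rcases point_cases p with ⟨a, rfl⟩ | ⟨a, b, hab, hp⟩
  · exact ⟨a, vert_injective (by rw [← smul_vert]; exact h)⟩
  by_cases h0 : p.1 b = 0
  · obtain ⟨c, rfl⟩ := isVert_of_coord hab hp (by rw [coord_edge hab hp]; exact Or.inl h0)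
    exact ⟨c, vert_injective (by rw [← smul_vert]; exact h)⟩
  by_cases h1 : p.1 b = 1
  · obtain ⟨c, rfl⟩ := isVert_of_coord hab hp (by rw [coord_edge hab hp]; exact Or.inr h1)
    exact ⟨c, vert_injective (by rw [← smul_vert]; exact h)⟩
  have ha : p.1 a ≠ 0 := by
    rw [apply_swap hab hp]; exact fun h => h1 (by linarith)
  have key : ∀ c, p.1 c ≠ 0 → c = a ∨ c = b := by
    intro c hc
    by_contra! hn
    refine hc ?_
    rw [(edge_eq_of_apply hab hp).2]; simp [hn.1.symm, hn.2.symm]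
  have hga := smul_apply_smul g p a
  have hgb := smul_apply_smul g p b
  rw [h] at hga hgb
  rcases key (g • a) (by rw [hga]; exact ha) with e1 | e1
  · exact ⟨a, e1⟩
  · rcases key (g • b) (by rw [hgb]; exact h0) with e2 | e2
    · exact absurd ⟨e1, e2⟩ (T.no_inversion g a b hab)
    · exact ⟨b, e2⟩

end GTree

end GBS

end

noncomputable section

namespace GBS

universe u v w

/-! ### Finiteness properties of cyclic trees -/

open GTree hiding dist

theorem IsGBS.fg {G : Type u} [Group G] (hG : IsGBS G) : Group.FG G := by
  obtain ⟨Γ, τ, -, ⟨Ψ⟩⟩ := hG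
  have := Γ.finV
  have := Γ.finE
  have hfg : Group.FG (Γ.Pi1 τ) := by
    refine Group.fg_iff.2 ⟨Set.range (PresentedGroup.of (rels := Γ.rels τ)), ?_,
      Set.finite_range _⟩
    exact PresentedGroup.closure_range_of _
  exact Group.fg_of_surjective (f := Ψ.symm.toMonoidHom) Ψ.symm.surjective

/-- An orbit of a cyclic group is finite as soon as the action is not free on it. -/
theorem finite_orbit_of_isCyclic {G : Type*} [Group G] {α : Type*} [MulAction G α]
    {H : Subgroup G} (hH : IsCyclic H) {k : G} (hk : k ∈ H) (hk1 : k ≠ 1) {b : α}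
    (hb : k • b = b) : {y | ∃ x ∈ H, x • b = y}.Finite := by
  obtain ⟨⟨h, hh⟩, hgen⟩ := hH.exists_generator
  have hpow : ∀ x ∈ H, ∃ n : ℤ, h ^ n = x := by
    intro x hx
    obtain ⟨n, hn⟩ := Subgroup.mem_zpowers_iff.1 (hgen ⟨x, hx⟩)
    exact ⟨n, by simpa using congrArg Subtype.val hn⟩
  obtain ⟨n, rfl⟩ := hpow k hk
  have hn : n ≠ 0 := by rintro rfl; simp at hk1
  refine Set.Finite.subset ((Set.finite_Ico (0 : ℤ) |n|).image fun i => h ^ i • b) ?_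
  rintro y ⟨x, hx, rfl⟩
  obtain ⟨i, rfl⟩ := hpow x hx
  refine ⟨i % n, ⟨Int.emod_nonneg i hn, Int.emod_lt_abs i hn⟩, ?_⟩
  have hfix : ∀ j : ℤ, (h ^ n) ^ j • b = b := by
    intro j
    have : h ^ n ∈ MulAction.stabilizer G b := hb
    exact Subgroup.zpow_mem _ this j
  dsimp only
  conv_rhs => rw [← Int.emod_add_mul_ediv i n]
  rw [zpow_add, mul_smul, zpow_mul, hfix]

variable {G : Type u} [Group G] {T : GTree.{u, v} G}

theorem exists_ne_one_of_infinite {H : Subgroup G} (h : Infinite H) : ∃ k ∈ H, k ≠ 1 := by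
  obtain ⟨⟨k, hk⟩, hne⟩ := exists_ne (1 : H)
  exact ⟨k, hk, fun h => hne (Subtype.ext h)⟩

/-- The set `A` consists of the edges on paths from `a` to `s • a`, for `s` in a finite generating
set. Translates of `A` span an invariant graph in which `a` is joined to all its translates; by
minimality the component of `a` contains every vertex. -/
theorem exists_finite_edges (hT : T.IsMinimal) (hG : Group.FG G) :
    ∃ A : Set (T.V × T.V), A.Finite ∧ ∀ x y, T.graph.Adj x y → ∃ g : G, (g • x, g • y) ∈ A := by
  obtain ⟨S, hS, hSf⟩ := Group.fg_iff.1 hG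
  obtain ⟨a⟩ := T.isTree.connected.nonempty
  choose W _ using fun s : G => T.isTree.connected.preconnected.exists_isPath a (s • a)
  set B : Set (T.V × T.V) := ⋃ s ∈ S, {e | ∃ d ∈ (W s).darts, e = (d.fst, d.snd)} with hB
  have hBf : B.Finite := by
    refine hSf.biUnion fun s _ => ?_
    refine ((List.finite_toSet (W s).darts).image fun d => (d.fst, d.snd)).subset ?_
    rintro e ⟨d, hd, rfl⟩
    exact ⟨d, hd, rfl⟩
  set A : Set (T.V × T.V) := B ∪ Prod.swap '' B with hA
  have hAf : A.Finite := hBf.union (hBf.image _)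
  have hAsymm : ∀ x y, (x, y) ∈ A → (y, x) ∈ A := by
    rintro x y (h | ⟨⟨x', y'⟩, h, he⟩)
    · exact Or.inr ⟨(x, y), h, rfl⟩
    · cases he; exact Or.inl h
  let H : SimpleGraph T.V :=
    { Adj := fun x y => T.graph.Adj x y ∧ ∃ g : G, (g • x, g • y) ∈ A
      symm := ⟨fun x y h => ⟨h.1.symm, h.2.imp fun g hg => hAsymm _ _ hg⟩⟩
      loopless := ⟨fun x h => h.1.ne rfl⟩ }
  have hH : ∀ (g : G) x y, H.Adj x y → H.Adj (g • x) (g • y) := by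
    rintro g x y ⟨h, k, hk⟩
    refine ⟨T.adj_smul g x y h, k * g⁻¹, ?_⟩
    simpa [mul_smul] using hk
  have hHr : ∀ (g : G) x y, H.Reachable x y → H.Reachable (g • x) (g • y) := by
    rintro g x y ⟨w⟩
    induction w with
    | nil => exact SimpleGraph.Reachable.refl _
    | cons h w ih => exact (hH g _ _ h).reachable.trans ih
  have hgen : ∀ g : G, H.Reachable a (g • a) := by
    intro g
    have hg : g ∈ Subgroup.closure S := by rw [hS]; trivial
    induction hg using Subgroup.closure_induction with
    | mem s hs =>
      have key : ∀ {x y : T.V} (w : T.graph.Walk x y),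
          (∀ d ∈ w.darts, (d.fst, d.snd) ∈ B) → H.Reachable x y := by
        intro x y w
        induction w with
        | nil => intro _; exact SimpleGraph.Reachable.refl _
        | @cons x z y h w ih =>
          intro hw
          refine SimpleGraph.Reachable.trans (SimpleGraph.Adj.reachable ?_)
            (ih fun d hd => hw d (by simp [hd]))
          refine ⟨h, 1, ?_⟩
          have := hw ⟨(x, z), h⟩ (by simp)
          rw [one_smul, one_smul]
          exact Or.inl this
      refine key (W s) fun d hd => ?_
      exact Set.mem_biUnion hs ⟨d, hd, rfl⟩
    | one => rw [one_smul]
    | mul g h _ _ ihg ihh =>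
      rw [mul_smul]
      exact ihg.trans (hHr g _ _ ihh)
    | inv g _ ih =>
      have := hHr g⁻¹ _ _ ih
      rw [inv_smul_smul] at this
      exact this.symm
  have huniv : {x | H.Reachable a x} = Set.univ := by
    refine hT _ ?_ ?_
    · intro g x hx
      exact (hgen g).trans (hHr g _ _ hx)
    · have key : ∀ {x y : T.V} (w : H.Walk x y) (hx : H.Reachable a x) (hy : H.Reachable a y),
          (T.graph.induce {x | H.Reachable a x}).Reachable ⟨x, hx⟩ ⟨y, hy⟩ := by
        intro x y w
        induction w with
        | nil => intro _ _; exact SimpleGraph.Reachable.refl _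
        | @cons x z y h w ih =>
          intro hx hy
          have hz : H.Reachable a z := hx.trans h.reachable
          refine SimpleGraph.Reachable.trans (SimpleGraph.Adj.reachable ?_) (ih hz hy)
          exact h.1
      rw [SimpleGraph.connected_iff]
      refine ⟨?_, ⟨⟨a, SimpleGraph.Reachable.refl _⟩⟩⟩
      rintro ⟨x, hx⟩ ⟨y, hy⟩
      obtain ⟨w⟩ := SimpleGraph.Reachable.trans (SimpleGraph.Reachable.symm hx) hy
      exact key w hx hy
  refine ⟨A, hAf, fun x y hxy => ?_⟩
  by_contra hn
  -- An edge with no translate in `A` could be deleted without separating its ends, but every edge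
  -- of a tree is a bridge.
  have hle : H ≤ T.graph.deleteEdges {s(x, y)} := by
    intro p q hpq
    rw [SimpleGraph.deleteEdges_adj]
    refine ⟨hpq.1, fun he => ?_⟩
    rcases Sym2.eq_iff.1 he with ⟨rfl, rfl⟩ | ⟨rfl, rfl⟩
    · exact hn hpq.2
    · exact hn (hpq.2.imp fun g hg => hAsymm _ _ hg)
  have hr : ∀ z, H.Reachable a z := fun z => by
    have : z ∈ {x | H.Reachable a x} := by rw [huniv]; trivial
    exact this
  refine notMem_side T.isTree hxy ?_
  exact (((hr y).symm.trans (hr x)).mono hle)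

theorem exists_finite_vertices (hT : T.IsMinimal) (hG : Group.FG G) :
    ∃ A : Set T.V, A.Finite ∧ ∀ x, ∃ g : G, g • x ∈ A := by
  obtain ⟨A, hA, hA'⟩ := exists_finite_edges hT hG
  obtain ⟨a⟩ := T.isTree.connected.nonempty
  -- The vertex `a` is added for the case of a tree without edges.
  refine ⟨insert a (Prod.fst '' A), (hA.image _).insert a, fun x => ?_⟩
  by_cases hx : x = a
  · exact ⟨1, by simp [hx]⟩
  · obtain ⟨W⟩ := T.isTree.connected.preconnected x a
    cases W with
    | nil => exact absurd rfl hx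
    | @cons _ y _ h _ =>
      obtain ⟨g, hg⟩ := hA' x y h
      exact ⟨g, Or.inr ⟨_, hg, rfl⟩⟩

theorem exists_len_bounds (hT : T.IsMinimal) (hG : Group.FG G) :
    ∃ ℓ M : ℝ, 0 < ℓ ∧ 0 < M ∧ ∀ x y, T.graph.Adj x y → ℓ ≤ T.len x y ∧ T.len x y ≤ M := by
  obtain ⟨A, hA, hA'⟩ := exists_finite_edges hT hG
  have hB : {e ∈ A | T.graph.Adj e.1 e.2}.Finite := hA.subset fun e he => he.1
  set B := hB.toFinset with hBdef
  obtain ⟨M, hM⟩ := (hB.image fun e => T.len e.1 e.2).bddAbove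
  obtain ⟨M', hM'⟩ := (hB.image fun e => (T.len e.1 e.2)⁻¹).bddAbove
  -- The maxima with `1` keep the bounds positive even if there is no edge at all.
  refine ⟨(max M' 1)⁻¹, max M 1, by positivity, by positivity, fun x y h => ?_⟩
  obtain ⟨g, hg⟩ := hA' x y h
  have hadj := T.adj_smul g x y h
  have h1 := hM ⟨(g • x, g • y), ⟨hg, hadj⟩, rfl⟩
  have h2 := hM' ⟨(g • x, g • y), ⟨hg, hadj⟩, rfl⟩
  dsimp only at h1 h2
  rw [T.len_smul g x y h] at h1 h2
  refine ⟨?_, h1.trans (le_max_left _ _)⟩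
  rw [inv_le_comm₀ (by positivity) (T.len_pos _ _ h)]
  exact h2.trans (le_max_left _ _)

/-- The stabilizer of `a` is cyclic and each edge stabilizer is a nontrivial subgroup of it, hence
of finite index. So each of the finitely many orbits of edges contributes finitely many neighbors.
-/
theorem finite_neighbors (hT : T.IsCyclicTree) (hG : Group.FG G) (a : T.V) :
    {b | T.graph.Adj a b}.Finite := by
  obtain ⟨A, hA, hA'⟩ := exists_finite_edges hT.minimal hG
  have : ∀ e ∈ A, {b | T.graph.Adj a b ∧ ∃ g : G, (g • a, g • b) = e}.Finite := by
    rintro ⟨x, y⟩ -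
    by_cases hn : ∃ b₀, T.graph.Adj a b₀ ∧ ∃ g : G, (g • a, g • b₀) = (x, y)
    · obtain ⟨b₀, h₀, g₀, hg₀⟩ := hn
      obtain ⟨k, hk, hk1⟩ := exists_ne_one_of_infinite (hT.edge a b₀ h₀).2
      refine (finite_orbit_of_isCyclic (hT.vertex a).1 hk.1 hk1 (b := b₀) hk.2).subset ?_
      rintro b ⟨hb, g, hg⟩
      simp only [Prod.mk.injEq] at hg₀ hg
      refine ⟨g⁻¹ * g₀, ?_, ?_⟩
      · rw [MulAction.mem_stabilizer_iff, mul_smul, hg₀.1, ← hg.1, inv_smul_smul]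
      · rw [mul_smul, hg₀.2, ← hg.2, inv_smul_smul]
    · refine Set.finite_empty.subset ?_
      rintro b ⟨hb, h⟩
      exact hn ⟨b, hb, h⟩
  refine (hA.biUnion this).subset ?_
  intro b hb
  obtain ⟨g, hg⟩ := hA' a b hb
  exact Set.mem_biUnion hg ⟨hb, g, rfl⟩

/-! ### Vertex paths, balls and local pictures -/

theorem exists_vertex_path (a b : T.V) : ∃ (n : ℕ) (u : ℕ → T.V), u 0 = a ∧ u n = b ∧
    (∀ i < n, T.graph.Adj (u i) (u (i + 1))) ∧ ∀ i, i + 2 ≤ n → u i ≠ u (i + 2) := by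
  obtain ⟨W, hW, -⟩ := T.isTree.existsUnique_path a b
  refine ⟨W.length, W.getVert, W.getVert_zero, W.getVert_length,
    fun i hi => W.adj_getVert_succ hi, fun i hi he => ?_⟩
  have := hW.getVert_injOn (show i ∈ {i | i ≤ W.length} by simp; omega)
    (show i + 2 ∈ {i | i ≤ W.length} from hi) he
  omega

theorem vertex_path_dist {n : ℕ} {u : ℕ → T.V} (h : ∀ i < n, T.graph.Adj (u i) (u (i + 1)))
    (h' : ∀ i, i + 2 ≤ n → u i ≠ u (i + 2)) :
    dist (vert (u 0) : T.Point) (vert (u n)) = ∑ i ∈ Finset.range n, T.len (u i) (u (i + 1)) := by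
  rw [dist_eq_sum_of_local (m := fun i => (vert (u i) : T.Point))]
  · exact Finset.sum_congr rfl fun i hi => dist_vert_of_adj (h i (Finset.mem_range.1 hi))
  · intro i hi
    exact between_of_adj_of_adj (h i (by omega)) (h (i + 1) (by omega)) (h' i hi)
  · intro i hi he
    exact (h i (by omega)).ne (vert_injective he)

theorem exists_adj_between {a b : T.V} (h : a ≠ b) :
    ∃ c, T.graph.Adj c b ∧ Between (vert a : T.Point) (vert c) (vert b) := by
  obtain ⟨n, u, rfl, rfl, h1, h2⟩ := exists_vertex_path a b
  obtain ⟨n, rfl⟩ : ∃ k, n = k + 1 := ⟨n - 1, by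
    have : n ≠ 0 := by rintro rfl; exact h rfl
    omega⟩
  refine ⟨u n, h1 n (by omega), ?_⟩
  rw [Between, vertex_path_dist h1 h2, Finset.sum_range_succ,
    vertex_path_dist (fun i hi => h1 i (by omega)) (fun i hi => h2 i (by omega)),
    dist_vert_of_adj (h1 n (by omega))]

/-- Edges have length at least `ℓ`, so the ball of radius `(n + 1) * ℓ` consists of its center and
of neighbors of vertices in the ball of radius `n * ℓ`. -/
theorem finite_ball (hT : T.IsCyclicTree) (hG : Group.FG G) (a : T.V) (R : ℝ) :
    {b | dist (vert a : T.Point) (vert b) ≤ R}.Finite := by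
  obtain ⟨ℓ, M, hℓ, -, hlen⟩ := exists_len_bounds hT.minimal hG
  have key : ∀ n : ℕ, {b | dist (vert a : T.Point) (vert b) ≤ n * ℓ}.Finite := by
    intro n
    induction n with
    | zero =>
      refine (Set.finite_singleton a).subset fun b hb => ?_
      have : dist (vert a : T.Point) (vert b) ≤ 0 := by simpa using hb
      exact (vert_injective (dist_le_zero.1 this)).symm
    | succ n ih =>
      refine ((ih.biUnion fun c _ => finite_neighbors hT hG c).insert a).subset fun b hb => ?_
      by_cases hab : a = b
      · exact Or.inl hab.symm
      · obtain ⟨c, hc, hbt⟩ := exists_adj_between hab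
        refine Or.inr (Set.mem_biUnion (x := c) ?_ hc)
        have h1 := (hlen c b hc).1
        unfold Between at hbt
        rw [dist_vert_of_adj hc] at hbt
        have hb' : dist (vert a : T.Point) (vert b) ≤ (n + 1 : ℕ) * ℓ := hb
        push_cast at hb'
        show dist (vert a : T.Point) (vert c) ≤ n * ℓ
        linarith
  obtain ⟨n, hn⟩ := exists_nat_ge (R / ℓ)
  refine (key n).subset fun b hb => ?_
  exact le_trans hb ((div_le_iff₀ hℓ).1 hn)

/-- Triples of vertices of bounded diameter are finite in number up to the action. -/
theorem exists_finite_triples (hT : T.IsCyclicTree) (hG : Group.FG G) (R : ℝ) :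
    ∃ A : Set (T.V × T.V × T.V), A.Finite ∧ ∀ a b c : T.V,
      dist (vert a : T.Point) (vert b) ≤ R → dist (vert a : T.Point) (vert c) ≤ R →
      ∃ g : G, (g • a, g • b, g • c) ∈ A := by
  obtain ⟨B, hB, hB'⟩ := exists_finite_vertices hT.minimal hG
  refine ⟨⋃ a ∈ B, {a} ×ˢ ({b | dist (vert a : T.Point) (vert b) ≤ R} ×ˢ
    {b | dist (vert a : T.Point) (vert b) ≤ R}), ?_, ?_⟩
  · exact hB.biUnion fun a _ => (Set.finite_singleton a).prod
      ((finite_ball hT hG a R).prod (finite_ball hT hG a R))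
  · intro a b c hb hc
    obtain ⟨g, hg⟩ := hB' a
    refine ⟨g, Set.mem_biUnion hg ⟨rfl, ?_, ?_⟩⟩
    · show dist (vert (g • a) : T.Point) (vert (g • b)) ≤ R
      rwa [← smul_vert, ← smul_vert, dist_smul_smul]
    · show dist (vert (g • a) : T.Point) (vert (g • c)) ≤ R
      rwa [← smul_vert, ← smul_vert, dist_smul_smul]

theorem exists_vert_near {M : ℝ} (hM : ∀ x y, T.graph.Adj x y → T.len x y ≤ M) (hM0 : 0 ≤ M)
    (p : T.Point) : ∃ a : T.V, dist p (vert a) ≤ M := by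
  rcases point_cases p with ⟨a, rfl⟩ | ⟨a, b, h, hp⟩
  · exact ⟨a, by simpa using hM0⟩
  · refine ⟨a, ?_⟩
    have := (between_of_mem_edge h hp).dist_le_left
    rw [dist_vert_of_adj h] at this
    rw [dist_comm]
    exact this.trans (hM a b h)

/-- A point is on the segment from a nearby vertex to a given vertex. -/
theorem exists_vert_between {M : ℝ} (hM : ∀ x y, T.graph.Adj x y → T.len x y ≤ M) (hM0 : 0 ≤ M)
    (p : T.Point) (c : T.V) : ∃ a : T.V, dist (vert a) p ≤ M ∧ Between (vert a) p (vert c) := by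
  rcases point_cases p with ⟨a, rfl⟩ | ⟨a, b, h, hp⟩
  · exact ⟨a, by simpa using hM0, Between.left _ _⟩
  · have hb := between_of_mem_edge h hp
    have hd := hM a b h
    rw [← dist_vert_of_adj h] at hd
    rcases between_vert_of_adj h c with h1 | h1
    · exact ⟨b, by rw [dist_comm]; exact hb.dist_le_right.trans hd,
        (h1.trans_left_symm hb).symm⟩
    · exact ⟨a, hb.dist_le_left.trans hd, (h1.trans_left_symm hb.symm).symm⟩

end GBS

end

noncomputable section

namespace GBS

universe u v w

open GTree hiding dist

/-! ### Translation lengths -/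

section TranslationLength

variable {G : Type u} [Group G] {T : GTree.{u, v} G}

instance : Nonempty T.Point := T.isTree.connected.nonempty.map vert

theorem translationLength_le (g : G) (p : T.Point) : T.translationLength g ≤ dist p (g • p) :=
  ciInf_le ⟨0, by rintro _ ⟨q, rfl⟩; exact dist_nonneg (x := q) (y := g • q)⟩ p

theorem le_translationLength {g : G} {c : ℝ} (h : ∀ p : T.Point, c ≤ dist p (g • p)) :
    c ≤ T.translationLength g := le_ciInf h

theorem translationLength_nonneg (g : G) : 0 ≤ T.translationLength g :=
  le_translationLength fun _ => dist_nonneg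

theorem exists_dist_lt_of_translationLength {g : G} {c : ℝ} (h : T.translationLength g < c) :
    ∃ p : T.Point, dist p (g • p) < c := by
  by_contra! hn
  exact absurd (le_translationLength hn) (not_le.2 h)

theorem translationLength_conj (c g : G) :
    T.translationLength (c * g * c⁻¹) = T.translationLength g := by
  have key : ∀ c g : G, T.translationLength (c * g * c⁻¹) ≤ T.translationLength g := by
    intro c g
    refine le_translationLength fun p => ?_
    have := translationLength_le (c * g * c⁻¹) (c • p)
    rwa [mul_smul, mul_smul, inv_smul_smul, dist_smul_smul] at this
  refine (key c g).antisymm ?_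
  have := key c⁻¹ (c * g * c⁻¹)
  rwa [show c⁻¹ * (c * g * c⁻¹) * c⁻¹⁻¹ = g by group] at this

theorem dist_pow_smul_le (g : G) (p : T.Point) (n : ℕ) :
    dist p (g ^ n • p) ≤ n * dist p (g • p) := by
  induction n with
  | zero => simp
  | succ n ih =>
    have h1 := dist_triangle p (g ^ n • p) (g ^ (n + 1) • p)
    rw [pow_succ, mul_smul, dist_smul_smul] at h1
    rw [pow_succ, mul_smul]
    push_cast
    linarith

/-- Translation lengths are bounded below by the growth of orbits. -/
theorem le_translationLength_of_pow {g : G} {S : ℝ} {p : T.Point}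
    (h : ∀ n : ℕ, n * S ≤ dist p (g ^ n • p)) : S ≤ T.translationLength g := by
  refine le_translationLength fun x => ?_
  by_contra! hlt
  obtain ⟨n, hn⟩ := exists_nat_gt (2 * dist p x / (S - dist x (g • x)))
  rw [div_lt_iff₀ (by linarith)] at hn
  have h1 := h n
  have h2 := dist_triangle4 p x (g ^ n • x) (g ^ n • p)
  rw [dist_smul_smul, dist_comm x p] at h2
  have h3 := dist_pow_smul_le g x n
  nlinarith

theorem dist_pow_smul_of_axis {g : G} {p : T.Point} (hne : g • p ≠ p)
    (h : Between p (g • p) (g • g • p)) (n : ℕ) : dist p (g ^ n • p) = n * dist p (g • p) := by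
  have := dist_eq_sum_of_local (m := fun i => g ^ i • p) n
    (fun i _ => by
      have := Between.smul h (g ^ i)
      rwa [← mul_smul, ← mul_smul, ← mul_smul, ← pow_succ, ← pow_succ] at this)
    (fun i _ he => hne (by
      rw [pow_succ, mul_smul] at he
      exact (smul_left_cancel _ he).symm))
  simp only [pow_zero, one_smul] at this
  rw [this, Finset.sum_congr rfl (fun i _ => show _ = dist p (g • p) by
    rw [pow_succ, mul_smul, dist_smul_smul])]
  simp

theorem exists_axis {g : G} (hg : T.IsLoxodromic g) :
    ∃ p : T.Point, dist p (g • p) = T.translationLength g ∧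
      ∀ n : ℕ, dist p (g ^ n • p) = n * T.translationLength g := by
  obtain ⟨p, hp⟩ := exists_axis_point (g := fun p : T.Point => g • p) (dist_smul_smul g) hg
  have h1 := dist_pow_smul_of_axis (hg p) hp
  have h2 : dist p (g • p) = T.translationLength g :=
    (le_translationLength_of_pow fun n => (h1 n).ge).antisymm (translationLength_le g p)
  exact ⟨p, h2, by rwa [h2] at h1⟩

theorem translationLength_of_fixed {g : G} {p : T.Point} (h : g • p = p) :
    T.translationLength g = 0 := by
  refine le_antisymm ?_ (translationLength_nonneg g)
  have := translationLength_le g p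
  rwa [h, dist_self] at this

theorem isLoxodromic_iff {g : G} : T.IsLoxodromic g ↔ 0 < T.translationLength g := by
  constructor
  · intro hg
    obtain ⟨p, hp, -⟩ := exists_axis hg
    rw [← hp]
    exact dist_pos.2 (hg p).symm
  · intro h p hp
    exact h.ne' (translationLength_of_fixed hp)

theorem exists_fixed_of_translationLength {g : G} (h : T.translationLength g = 0) :
    ∃ a : T.V, g • a = a := by
  have : ¬ T.IsLoxodromic g := by rw [isLoxodromic_iff, h]; exact lt_irrefl _
  unfold IsLoxodromic at this
  push Not at this
  obtain ⟨p, hp⟩ := this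
  exact exists_fixed_vertex hp

theorem translationLength_of_fixed_vertex {g : G} {a : T.V} (h : g • a = a) :
    T.translationLength g = 0 :=
  translationLength_of_fixed (p := vert a) (by rw [smul_vert, h])

theorem translationLength_pow (g : G) (n : ℕ) :
    T.translationLength (g ^ n) = n * T.translationLength g := by
  by_cases hg : T.IsLoxodromic g
  · obtain ⟨p, -, hp⟩ := exists_axis hg
    refine le_antisymm ?_ ?_
    · have := translationLength_le (g ^ n) p
      rwa [hp n] at this
    · refine le_translationLength_of_pow (p := p) fun m => ?_
      rw [← pow_mul, hp]; push_cast; linarith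
  · have h0 : T.translationLength g = 0 := by
      rw [isLoxodromic_iff] at hg
      exact le_antisymm (not_lt.1 hg) (translationLength_nonneg g)
    obtain ⟨a, ha⟩ := exists_fixed_of_translationLength h0
    have : g ^ n ∈ MulAction.stabilizer G a := Subgroup.pow_mem _ ha n
    rw [h0, mul_zero, translationLength_of_fixed_vertex this]

theorem translationLength_inv (g : G) : T.translationLength g⁻¹ = T.translationLength g := by
  have key : ∀ g : G, T.translationLength g⁻¹ ≤ T.translationLength g := fun g =>
    le_translationLength fun p => by
      have := translationLength_le g⁻¹ (g • p)
      rwa [inv_smul_smul, dist_comm] at this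
  refine (key g).antisymm ?_
  have := key g⁻¹
  rwa [inv_inv] at this

theorem translationLength_zpow (g : G) (k : ℤ) :
    T.translationLength (g ^ k) = |(k : ℝ)| * T.translationLength g := by
  obtain ⟨n, rfl | rfl⟩ := k.eq_nat_or_neg
  · rw [zpow_natCast, translationLength_pow]; simp
  · rw [zpow_neg, translationLength_inv, zpow_natCast, translationLength_pow]; simp

theorem exists_conj_of_mk_eq {ψ ψ' : MulAut G} (h : (ψ : Out G) = (ψ' : Out G)) :
    ∃ c : G, ∀ g, ψ' g = ψ (c * g * c⁻¹) := by
  obtain ⟨c, hc⟩ := QuotientGroup.eq.1 h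
  refine ⟨c, fun g => ?_⟩
  have : ψ' = ψ * MulAut.conj c := by rw [hc, mul_inv_cancel_left]
  rw [this]; rfl

/-- Pseudo-periodicity can be tested on one automorphism of the class. -/
theorem isPseudoPeriodic_of {φ : Out G} {ψ : MulAut G} (hψ : (ψ : Out G) = φ) {g : G} {B : ℝ}
    (h : ∀ n : ℕ, T.translationLength ((ψ ^ n) g) ≤ B) : T.IsPseudoPeriodic φ g := by
  intro ψ' hψ'
  refine ⟨B, ?_⟩
  rintro _ ⟨n, rfl⟩
  have : ((ψ ^ n : MulAut G) : Out G) = ((ψ' ^ n : MulAut G) : Out G) := by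
    rw [QuotientGroup.mk_pow, QuotientGroup.mk_pow, hψ, hψ']
  obtain ⟨c, hc⟩ := exists_conj_of_mk_eq this
  dsimp only
  rw [hc, map_mul, map_mul, map_inv, translationLength_conj]
  exact h n

end TranslationLength

/-! ### Legal pairs -/

section Legal

variable {X : Type*} [MetricSpace X]

/-- A pair of points is legal if all iterates of `f` stretch the segment between them by the
maximal factor. -/
def Legal (f : X → X) (lam : ℝ) (p q : X) : Prop :=
  ∀ n : ℕ, dist (f^[n] p) (f^[n] q) = lam ^ n * dist p q

/-- The map `f` stretches distances by at most `lam`. -/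
def Stretch (f : X → X) (lam : ℝ) : Prop := ∀ p q, dist (f p) (f q) ≤ lam * dist p q

variable {f : X → X} {lam : ℝ}

theorem Stretch.iterate (h : Stretch f lam) (hl : 0 ≤ lam) (n : ℕ) :
    Stretch f^[n] (lam ^ n) := by
  induction n with
  | zero => intro p q; simp
  | succ n ih =>
    intro p q
    rw [Function.iterate_succ_apply', Function.iterate_succ_apply', pow_succ']
    calc _ ≤ lam * dist (f^[n] p) (f^[n] q) := h _ _
      _ ≤ lam * (lam ^ n * dist p q) := mul_le_mul_of_nonneg_left (ih p q) hl
      _ = _ := by ring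

/-- If the whole segment is stretched by the maximal factor, neither part can be stretched by less,
and the images of the parts cannot overlap. -/
theorem Stretch.eq_of_between {μ : ℝ} (h : Stretch f μ) {p z q : X} (hz : Between p z q)
    (he : dist (f p) (f q) = μ * dist p q) : dist (f p) (f z) = μ * dist p z ∧
      dist (f z) (f q) = μ * dist z q ∧ Between (f p) (f z) (f q) := by
  have h1 := h p z
  have h2 := h z q
  have h3 := dist_triangle (f p) (f z) (f q)
  unfold Between at *
  rw [← hz, mul_add] at he
  refine ⟨?_, ?_, ?_⟩ <;> linarith

/-- The image of a maximally stretched segment is the segment between the images. -/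
theorem Stretch.exists_preimage [TreeMetric X] {μ : ℝ} (hμ : 0 < μ) (h : Stretch f μ) {p q z : X}
    (he : dist (f p) (f q) = μ * dist p q) (hz : Between (f p) z (f q)) :
    ∃ y, Between p y q ∧ f y = z := by
  have hle := hz.dist_le_left
  rw [he] at hle
  obtain ⟨y, hy, hd⟩ := exists_between_dist p q (t := dist (f p) z / μ)
    (div_nonneg dist_nonneg hμ.le) ((div_le_iff₀ hμ).2 (by linarith))
  obtain ⟨h1, -, h2⟩ := h.eq_of_between hy he
  refine ⟨y, hy, h2.eq_of_dist_eq hz ?_⟩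
  rw [h1, hd, mul_div_cancel₀ _ hμ.ne']

theorem Legal.symm {p q : X} (h : Legal f lam p q) : Legal f lam q p := fun n => by
  rw [dist_comm, h n, dist_comm]

theorem Legal.refl (p : X) : Legal f lam p p := fun n => by simp

theorem Legal.map {p q : X} (h : Legal f lam p q) : Legal f lam (f p) (f q) := fun n => by
  have h1 := h 1
  simp only [Function.iterate_one, pow_one] at h1
  rw [← Function.iterate_succ_apply, ← Function.iterate_succ_apply, h, h1, pow_succ, mul_assoc]

theorem Legal.iterate {p q : X} (h : Legal f lam p q) (n : ℕ) :
    Legal f lam (f^[n] p) (f^[n] q) := by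
  induction n with
  | zero => exact h
  | succ n ih => rw [Function.iterate_succ_apply', Function.iterate_succ_apply']; exact ih.map

theorem Legal.sub_left (hf : Stretch f lam) (hl : 0 ≤ lam) {p z q : X} (h : Legal f lam p q)
    (hz : Between p z q) : Legal f lam p z := fun n =>
  ((hf.iterate hl n).eq_of_between hz (h n)).1

theorem Legal.sub_right (hf : Stretch f lam) (hl : 0 ≤ lam) {p z q : X} (h : Legal f lam p q)
    (hz : Between p z q) : Legal f lam z q := fun n =>
  ((hf.iterate hl n).eq_of_between hz (h n)).2.1

theorem Legal.sub [TreeMetric X] (hf : Stretch f lam) (hl : 0 ≤ lam) {p y z q : X}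
    (h : Legal f lam p q) (hy : Between p y q) (hz : Between p z q) : Legal f lam y z := by
  rcases hy.total hz with h1 | h1
  · exact (h.sub_left hf hl hz).sub_right hf hl h1
  · exact ((h.sub_left hf hl hy).sub_right hf hl h1).symm

/-- The overlap is legal, so its images stay nondegenerate and the images of the two segments again
concatenate to a geodesic. -/
theorem Legal.glue [TreeMetric X] (hf : Stretch f lam) (hl : 0 < lam) {p q q' r : X}
    (h : Legal f lam p q') (h' : Legal f lam q r) (hq : Between p q q') (hq' : Between q q' r)
    (hne : q ≠ q') : Legal f lam p r := fun n => by
  obtain ⟨a1, a2, a3⟩ := (hf.iterate hl.le n).eq_of_between hq (h n)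
  obtain ⟨b1, b2, b3⟩ := (hf.iterate hl.le n).eq_of_between hq' (h' n)
  have hne' : f^[n] q ≠ f^[n] q' := by
    rw [← dist_pos, a2]
    exact mul_pos (pow_pos hl n) (dist_pos.2 hne)
  have h1 := (a3.glue b3 hne').1
  have h2 := (hq.glue hq' hne).1
  unfold Between at h1 h2
  rw [← h1, ← h2, a1, h' n]; ring

end Legal

/-! ### Train track maps -/

variable {G : Type u} [Group G] {T : GTree.{u, v} G}

/-- The properties of a train track map that are used below. -/
structure LegalMap (ψ : MulAut G) (f : T.Point → T.Point) (lam : ℝ) : Prop where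
  pos : 0 < lam
  map_smul : ∀ (g : G) (p : T.Point), f (g • p) = ψ g • f p
  isVert : ∀ p, IsVert p → IsVert (f p)
  stretch : Stretch f lam
  legal : ∀ a b, T.graph.Adj a b → Legal f lam (vert a) (vert b)

theorem stretch_of_edges {f : T.Point → T.Point} {lam : ℝ}
    (h : ∀ a b : T.V, T.graph.Adj a b → ∀ p ∈ edge a b, ∀ q ∈ edge a b,
      dist (f p) (f q) = lam * dist p q) : Stretch f lam := by
  intro p q
  have key : ∀ {p q : T.Point} {L : ℝ}, IsPathLength p q L → dist (f p) (f q) ≤ lam * L := by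
    intro p q L hL
    induction hL with
    | refl p => simp
    | step a b p q r L hab hp hq _ ih =>
      have := dist_triangle (f p) (f q) (f r)
      rw [h a b hab p hp q hq, dist_edge hab hp hq] at this
      linarith
  exact key (isPathLength_dist p q)

theorem vertex_path_between {n : ℕ} {u : ℕ → T.V} (h : ∀ i < n, T.graph.Adj (u i) (u (i + 1)))
    (h' : ∀ i, i + 2 ≤ n → u i ≠ u (i + 2)) {i : ℕ} (hi : i ≤ n) :
    Between (vert (u 0) : T.Point) (vert (u i)) (vert (u n)) := by
  obtain ⟨j, rfl⟩ := Nat.exists_eq_add_of_le hi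
  have h1 := vertex_path_dist (u := u) (n := i) (fun k hk => h k (by omega))
    (fun k hk => h' k (by omega))
  have h2 := vertex_path_dist (u := fun k => u (i + k)) (n := j)
    (fun k hk => h (i + k) (by omega)) (fun k hk => h' (i + k) (by omega))
  have h3 := vertex_path_dist h h'
  rw [Finset.sum_range_add] at h3
  rw [Between, h1, h3]
  simp only [add_zero] at h2
  rw [h2]
  rfl

/-- Inductively `f^k` of an edge is a geodesic made of edges. Its turns join distinct gates, so `f`
maps consecutive edges to segments meeting in one point. The image is then a local geodesic, hence a
geodesic, of length multiplied by `lam`. -/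
theorem IsTrainTrack.exists_legalMap {φ : Out G} {f : T.Point → T.Point}
    (hf : GTree.IsTrainTrack φ f) : ∃ (ψ : MulAut G) (lam : ℝ), (ψ : Out G) = φ ∧
      LegalMap ψ f lam := by
  obtain ⟨ψ, hψ, hequiv⟩ := hf.representative
  obtain ⟨lam, hlam, hst⟩ := hf.stretch
  have hS : Stretch f lam := stretch_of_edges hst
  refine ⟨ψ, lam, hψ, hlam, hequiv, ?_, hS, ?_⟩
  · rintro _ ⟨a, rfl⟩
    exact hf.vertices a
  intro a b hab k
  induction k with
  | zero => simp
  | succ k ih =>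
    have hv : ∀ (k : ℕ) (a : T.V), ∃ c, f^[k] (vert a) = vert c := by
      intro k a
      induction k with
      | zero => exact ⟨a, rfl⟩
      | succ k ihk =>
        obtain ⟨c, hc⟩ := ihk
        rw [Function.iterate_succ_apply', hc]
        exact hf.vertices c
    obtain ⟨c, hc⟩ := hv k a
    obtain ⟨d, hd⟩ := hv k b
    obtain ⟨n, u, hu0, hun, h1, h2⟩ := exists_vertex_path c d
    have hsub : ∀ i < n, (edge (u i) (u (i + 1)) : Set T.Point) ⊆ f^[k] '' edge a b := by
      intro i hi z hz
      have hz1 := between_of_mem_edge (h1 i hi) hz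
      have hb1 : Between (vert (u 0) : T.Point) (vert (u i)) (vert (u (i + 1))) :=
        vertex_path_between (fun j hj => h1 j (by omega)) (fun j hj => h2 j (by omega))
          (Nat.le_succ i)
      have hb2 := vertex_path_between h1 h2 (i := i + 1) (by omega)
      have hz2 := hb2.trans_left (hb1.trans_left_symm hz1)
      rw [hu0, hun, ← hc, ← hd] at hz2
      obtain ⟨y, hy, hy'⟩ := (hS.iterate hlam.le k).exists_preimage (pow_pos hlam k) ih hz2
      exact ⟨y, mem_edge_of_between hab hy, hy'⟩
    have hedge : ∀ {x y : T.V}, T.graph.Adj x y → ∀ {m}, Between (f (vert x)) m (f (vert y)) →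
        m ∈ f '' edge x y := by
      intro x y hxy m hm
      obtain ⟨y', hy, hy'⟩ := hS.exists_preimage hlam
        (hst x y hxy _ (vert_mem_edge_left x y) _ (vert_mem_edge_right x y)) hm
      exact ⟨y', mem_edge_of_between hxy hy, hy'⟩
    have hsum := dist_eq_sum_of_local (m := fun i => f (vert (u i))) n (by
      intro i hi
      have hadj := h1 i (by omega)
      have hadj' := h1 (i + 1) (by omega)
      have hng := hf.legal a b hab k (u (i + 1)) (u i) (u (i + 2)) hadj.symm hadj' (h2 i hi)
        (by rw [edge_swap]; exact hsub i (by omega)) (hsub (i + 1) (by omega))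
      have hnt : ¬ (f '' edge (u (i + 1)) (u i) ∩ f '' edge (u (i + 1)) (u (i + 2))).Nontrivial :=
        fun hnt => hng (Relation.EqvGen.rel _ _ ⟨hadj.symm, hadj', hnt⟩)
      rw [Set.not_nontrivial_iff] at hnt
      have m1 := med_between_left (f (vert (u i))) (f (vert (u (i + 1)))) (f (vert (u (i + 2))))
      have m2 := med_between_right (f (vert (u i))) (f (vert (u (i + 1)))) (f (vert (u (i + 2))))
      have m3 := med_between (f (vert (u i))) (f (vert (u (i + 1)))) (f (vert (u (i + 2))))
      -- The branch point of the three images lies in the images of both edges, so it is the image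
      -- of the middle vertex.
      have := hnt ⟨hedge hadj.symm m1.symm, hedge hadj' m2⟩
        ⟨hedge hadj.symm (Between.left _ _), hedge hadj' (Between.left _ _)⟩
      rw [this] at m3
      exact m3) (by
      intro i hi he
      have := hst _ _ (h1 i (by omega)) _ (vert_mem_edge_left _ _) _ (vert_mem_edge_right _ _)
      change dist (f (vert (u i))) (f (vert (u (i + 1)))) =
        lam * dist (vert (u i)) (vert (u (i + 1))) at this
      rw [he, dist_self, dist_vert_of_adj (h1 i (by omega))] at this
      exact (mul_pos hlam (T.len_pos _ _ (h1 i (by omega)))).ne this)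
    rw [Function.iterate_succ_apply', Function.iterate_succ_apply', hc, hd, pow_succ', mul_assoc,
      ← ih, hc, hd]
    rw [← hu0, ← hun, hsum, vertex_path_dist h1 h2, Finset.mul_sum]
    refine Finset.sum_congr rfl fun i hi => ?_
    have hadj := h1 i (Finset.mem_range.1 hi)
    rw [← dist_vert_of_adj hadj]
    exact hst _ _ hadj _ (vert_mem_edge_left _ _) _ (vert_mem_edge_right _ _)

namespace LegalMap

variable {ψ : MulAut G} {f : T.Point → T.Point} {lam : ℝ}

theorem iterate_smul (hf : LegalMap ψ f lam) (n : ℕ) (g : G) (p : T.Point) :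
    f^[n] (g • p) = (ψ ^ n) g • f^[n] p := by
  induction n generalizing g p with
  | zero => simp
  | succ n ih =>
    rw [Function.iterate_succ_apply, hf.map_smul, ih, ← Function.iterate_succ_apply, pow_succ]
    rfl

theorem isVert_iterate (hf : LegalMap ψ f lam) (n : ℕ) {p : T.Point} (hp : IsVert p) :
    IsVert (f^[n] p) := by
  induction n with
  | zero => exact hp
  | succ n ih => rw [Function.iterate_succ_apply']; exact hf.isVert _ ih

theorem legal_smul (hf : LegalMap ψ f lam) (g : G) {p q : T.Point} (h : Legal f lam p q) :
    Legal f lam (g • p) (g • q) := fun n => by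
  rw [hf.iterate_smul, hf.iterate_smul, dist_smul_smul, h n, dist_smul_smul]

theorem legal_edge (hf : LegalMap ψ f lam) {a b : T.V} (h : T.graph.Adj a b) {p q : T.Point}
    (hp : p ∈ edge a b) (hq : q ∈ edge a b) : Legal f lam p q :=
  (hf.legal a b h).sub hf.stretch hf.pos.le (between_of_mem_edge h hp) (between_of_mem_edge h hq)

end LegalMap

end GBS

end

noncomputable section

namespace GBS

universe u v w

open GTree hiding dist

/-! ### Bounded cancellation -/

section TreeMetric

variable {X : Type*} [MetricSpace X] [TreeMetric X]

/-- The median is the nearest point projection of `y` to `[x, z]`. -/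
theorem dist_med_le {x y z y' : X} (h : Between x y' z) : dist y (med x y z) ≤ dist y y' := by
  rw [dist_med_middle]
  have h1 := dist_triangle x y' y
  have h2 := dist_triangle y y' z
  have h3 := dist_triangle y y' x
  have h4 := dist_triangle z y' y
  unfold Between at h
  rw [dist_comm y' y] at h1
  have := dist_triangle x y' y
  linarith

/-- Two points with projections to `[a, b]` on different sides of `m` are separated by `m`. -/
theorem between_of_dist_med {a b m x y : X} (hm : Between a m b)
    (hx : dist a (med a x b) ≤ dist a m) (hy : dist a m < dist a (med a y b)) :
    Between x m y := by
  have x1 := med_between_right a x b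
  have x2 := med_between a x b
  have y1 := med_between_left a y b
  have y2 := med_between a y b
  have hxm := x2.order hm hx
  have hym := hm.order y2 hy.le
  have h1 : Between x m b := x1.trans_left_symm hxm.2
  have h2 : Between x m (med a y b) := h1.trans_right_symm hym.2
  have h3 : Between m (med a y b) y := y1.trans_right hym.1
  exact (h2.glue h3 (by rintro h; rw [← h] at hy; exact lt_irrefl _ hy)).1

/-- Lipschitz images of segments contain the segments between the images of the endpoints. -/
theorem Stretch.exists_between_map_eq {f : X → X} {lam : ℝ} (hf : Stretch f lam) (hl : 0 < lam)
    {p z m : X} (hm : Between (f p) m (f z)) : ∃ p', Between p p' z ∧ f p' = m := by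
  by_cases hmz : m = f z
  · exact ⟨z, Between.right _ _, hmz.symm⟩
  have hlt : dist (f p) m < dist (f p) (f z) := by
    unfold Between at hm
    linarith [dist_pos.2 hmz]
  have : Nonempty X := ⟨p⟩
  choose! γ hγ hγd using fun (t : ℝ) (ht : t ∈ Set.Icc 0 (dist p z)) =>
    exists_between_dist p z ht.1 ht.2
  have hγle : ∀ s ∈ Set.Icc 0 (dist p z), ∀ t ∈ Set.Icc 0 (dist p z), s ≤ t →
      dist (γ s) (γ t) = t - s := by
    intro s hs t ht hst
    have := ((hγ s hs).order (hγ t ht) (by rw [hγd s hs, hγd t ht]; exact hst)).1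
    unfold Between at this
    rw [hγd s hs, hγd t ht] at this
    linarith
  have hℓ : (0 : ℝ) ≤ dist p z := dist_nonneg
  have hγ0 : γ 0 = p := by
    have := hγd 0 ⟨le_rfl, hℓ⟩
    exact (dist_eq_zero.1 this).symm
  have hγℓ : γ (dist p z) = z := by
    have h1 := hγ _ (Set.right_mem_Icc.2 hℓ)
    exact h1.eq_of_dist_eq (Between.right _ _) (hγd _ (Set.right_mem_Icc.2 hℓ))
  -- `S` collects the times at which the image projects to `[f p, f z]` no further than `m`. Just
  -- before and just after its supremum the projections are on different sides of `m`, so `m` lies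
  -- between the two images.
  set S : Set ℝ := {t | t ∈ Set.Icc 0 (dist p z) ∧
    dist (f p) (med (f p) (f (γ t)) (f z)) ≤ dist (f p) m} with hS
  have h0S : (0 : ℝ) ∈ S := by
    refine ⟨⟨le_rfl, hℓ⟩, ?_⟩
    rw [hγ0, (med_between_left (f p) (f p) (f z)).eq_of_self, dist_self]
    exact dist_nonneg
  have hℓS : dist p z ∉ S := by
    rintro ⟨-, h⟩
    rw [hγℓ, dist_med, dist_self] at h
    linarith
  have hbdd : BddAbove S := ⟨dist p z, fun t ht => ht.1.2⟩
  set τ := sSup S with hτ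
  have hτ0 : 0 ≤ τ := le_csSup hbdd h0S
  have hτℓ : τ ≤ dist p z := csSup_le ⟨0, h0S⟩ fun t ht => ht.1.2
  refine ⟨γ τ, hγ τ ⟨hτ0, hτℓ⟩, ?_⟩
  refine dist_le_zero.1 (le_of_forall_pos_le_add fun ε hε => ?_)
  -- The times `s` and `t` are at most `2 * δ` apart and `s` is within `δ` of `τ`, which gives the
  -- total error `3 * lam * δ`.
  set δ := ε / (3 * lam) with hδ
  have hδ0 : 0 < δ := by positivity
  obtain ⟨s, hs, hsτ⟩ := exists_lt_of_lt_csSup ⟨0, h0S⟩ (show τ - δ < sSup S by linarith)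
  have hsle : s ≤ τ := le_csSup hbdd hs
  set t := min (τ + δ) (dist p z) with ht
  have htτ : τ ≤ t := le_min (by linarith) hτℓ
  have htI : t ∈ Set.Icc 0 (dist p z) := ⟨hτ0.trans htτ, min_le_right _ _⟩
  have htle : t ≤ τ + δ := min_le_left _ _
  have htS : t ∉ S := by
    rcases min_choice (τ + δ) (dist p z) with h | h
    · intro hmem
      have := le_csSup hbdd hmem
      rw [ht, h] at this
      linarith
    · rw [ht, h]; exact hℓS
  have hlt' : dist (f p) m < dist (f p) (med (f p) (f (γ t)) (f z)) := by
    by_contra! hle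
    exact htS ⟨htI, hle⟩
  have hb := between_of_dist_med hm hs.2 hlt'
  have h1 := hb.dist_le_left
  have h2 := hf (γ s) (γ t)
  have h3 := hf (γ s) (γ τ)
  rw [hγle s hs.1 t htI (hsle.trans htτ)] at h2
  rw [hγle s hs.1 τ ⟨hτ0, hτℓ⟩ hsle] at h3
  have h4 := dist_triangle_left (f (γ τ)) m (f (γ s))
  have h5 : lam * (t - s) ≤ lam * (2 * δ) := mul_le_mul_of_nonneg_left (by linarith) hl.le
  have h6 : lam * (τ - s) ≤ lam * δ := mul_le_mul_of_nonneg_left (by linarith) hl.le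
  have h7 : lam * (3 * δ) = ε := by rw [hδ]; field_simp
  linarith

/-- An isometry that translates a segment along itself in a coherent way has no fixed point. -/
theorem ne_of_shift {g : X → X} (hg : ∀ x y, dist (g x) (g y) = dist x y) {x v : X} (hne : x ≠ v)
    (h : dist x (g v) = dist x v + dist v (g x) + dist (g x) (g v)) (p : X) : g p ≠ p := by
  intro hp
  have hs := dist_pos.2 hne
  have hvn := dist_nonneg (x := v) (y := g x)
  have e1 := hg p x
  have e2 := hg p v
  have e3 := hg x v
  rw [hp] at e1 e2
  have t1 := dist_triangle x v (g x)
  have t2 := dist_triangle x (g x) (g v)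
  have t3 := dist_triangle v (g x) (g v)
  have t4 := dist_triangle x v (g v)
  have bv : Between x v (g v) := by unfold Between; linarith
  have bx : Between x (g x) (g v) := by unfold Between; linarith
  -- The distance from `p` to a point of the segment is a constant plus the distance to the
  -- projection of `p`. A fixed point would be as far from `x` as from `g x` and as far from `v` as
  -- from `g v`, so its projection would be the midpoint of both pairs; these midpoints are `dist x
  -- v` apart.
  have key : ∀ z, Between x z (g v) → dist p z = dist p (med x p (g v)) +
      |dist x (med x p (g v)) - dist x z| := by
    intro z hz
    have m1 := med_between_left x p (g v)
    have m2 := med_between_right x p (g v)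
    have m3 := med_between x p (g v)
    rcases le_total (dist x z) (dist x (med x p (g v))) with hle | hle
    · have h1 := (hz.order m3 hle).1
      have h2 := m1.symm.trans_right_symm h1.symm
      unfold Between at h1 h2
      rw [abs_of_nonneg (by linarith), ← h2, dist_comm (med x p (g v)) z]; linarith
    · have h1 := m3.order hz hle
      have h2 := m2.trans_right_symm h1.2
      have h3 := h1.1
      unfold Between at h2 h3
      rw [abs_of_nonpos (by linarith), ← h2]; linarith
  have k1 := key x (Between.left _ _)
  have k2 := key v bv
  have k3 := key (g x) bx
  have k4 := key (g v) (Between.right _ _)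
  rw [dist_self] at k1
  rw [e1, k1] at k3
  rw [e2, k2] at k4
  have hxg : dist x (g x) = dist x v + dist v (g x) := by linarith
  generalize dist x (med x p (g v)) = t at *
  generalize dist p (med x p (g v)) = c at *
  have k3' : |t - 0| = |t - dist x (g x)| := by linarith
  have k4' : |t - dist x v| = |t - dist x (g v)| := by linarith
  rcases abs_eq_abs.1 k3' with h1 | h1 <;> rcases abs_eq_abs.1 k4' with h2 | h2 <;> linarith

end TreeMetric

variable {G : Type u} [Group G] {T : GTree.{u, v} G}
variable {ψ : MulAut G} {f : T.Point → T.Point} {lam : ℝ}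

namespace LegalMap

/-- Two vertices of one orbit with the same image differ by an element that `ψ` sends into a vertex
stabilizer. Such elements form a cyclic group, so `f` is finite-to-one on each orbit of vertices;
finiteness of balls and of the set of orbits of vertices gives a uniform bound. -/
theorem proper (hf : LegalMap ψ f lam) (hT : T.IsCyclicTree) (hG : Group.FG G) (D : ℝ) :
    ∃ R, ∀ a b : T.V, dist (f (vert a)) (f (vert b)) ≤ D →
      dist (vert a : T.Point) (vert b) ≤ R := by
  obtain ⟨A, hA, hA'⟩ := exists_finite_vertices hT.minimal hG
  have hfib : ∀ a' u : T.V, {b | (∃ g : G, g • a' = b) ∧ f (vert b) = vert u}.Finite := by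
    intro a' u
    by_cases hn : ∃ g₀ : G, f (vert (g₀ • a')) = vert u
    · obtain ⟨g₀, hg₀⟩ := hn
      obtain ⟨c, hc⟩ := hf.isVert _ ⟨a', rfl⟩
      let H : Subgroup G := (MulAction.stabilizer G c).comap ψ.toMonoidHom
      have hH : IsCyclic H := by
        have := (hT.vertex c).1
        let F : H →* MulAction.stabilizer G c :=
          (ψ.toMonoidHom.comp H.subtype).codRestrict _ fun x => x.2
        refine isCyclic_of_injective F fun x y hxy => ?_
        have := congrArg Subtype.val hxy
        exact Subtype.ext (ψ.injective this)
      have hmem : ∀ x : G, f (x • vert a') = f (vert a') → x ∈ H := by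
        intro x hx
        rw [hf.map_smul, hc, smul_vert] at hx
        exact vert_injective hx
      obtain ⟨k, hk, hk1⟩ := exists_ne_one_of_infinite (hT.vertex a').2
      have hk' : k ∈ H := hmem k (by rw [smul_vert]; exact congrArg (fun b => f (vert b)) hk)
      refine ((finite_orbit_of_isCyclic hH hk' hk1 (b := a') hk).image (g₀ • ·)).subset ?_
      rintro b ⟨⟨g, rfl⟩, hg⟩
      refine ⟨(g₀⁻¹ * g) • a', ⟨g₀⁻¹ * g, hmem _ ?_, rfl⟩, ?_⟩
      · rw [mul_smul, hf.map_smul, smul_vert, hg, ← hg₀, ← smul_vert, ← hf.map_smul,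
          inv_smul_smul]
      · dsimp only
        rw [← mul_smul, mul_inv_cancel_left]
    · refine Set.finite_empty.subset ?_
      rintro b ⟨⟨g, rfl⟩, hg⟩
      exact hn ⟨g, hg⟩
  have hS : ∀ a, {b | dist (f (vert a)) (f (vert b)) ≤ D}.Finite := by
    intro a
    obtain ⟨c, hc⟩ := hf.isVert _ ⟨a, rfl⟩
    refine (hA.biUnion fun a' _ => (finite_ball hT hG c D).biUnion fun u _ => hfib a' u).subset ?_
    intro b hb
    obtain ⟨g, hg⟩ := hA' b
    obtain ⟨u, hu⟩ := hf.isVert _ ⟨b, rfl⟩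
    refine Set.mem_biUnion hg (Set.mem_biUnion (x := u) ?_ ⟨⟨g⁻¹, inv_smul_smul g b⟩, hu⟩)
    show dist (vert c : T.Point) (vert u) ≤ D
    rw [← hc, ← hu]; exact hb
  obtain ⟨R, hR⟩ := (hA.biUnion fun a _ =>
    (hS a).image fun b => dist (vert a : T.Point) (vert b)).bddAbove
  refine ⟨R, fun a b hab => ?_⟩
  obtain ⟨g, hg⟩ := hA' a
  have := hR (Set.mem_biUnion hg ⟨g • b, ?_, rfl⟩)
  · dsimp only at this
    rwa [← smul_vert, ← smul_vert, dist_smul_smul] at this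
  · show dist (f (vert (g • a))) (f (vert (g • b))) ≤ D
    rwa [← smul_vert, ← smul_vert, hf.map_smul, hf.map_smul, dist_smul_smul]

/-- The branch point of the images is hit by some `p'` in `[p, z]` and some `q'` in `[z, q]`. These
have the same image, so they are close to each other by `proper`, and `z` lies between them. -/
theorem bounded_cancellation (hf : LegalMap ψ f lam) (hT : T.IsCyclicTree) (hG : Group.FG G) :
    ∃ C, 0 ≤ C ∧ ∀ p z q : T.Point, Between p z q →
      dist (f z) (med (f p) (f z) (f q)) ≤ C := by
  obtain ⟨ℓ, M, -, hM, hlen⟩ := exists_len_bounds hT.minimal hG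
  obtain ⟨R, hR⟩ := hf.proper hT hG (lam * M + lam * M)
  have hfib : ∀ p q : T.Point, f p = f q → dist p q ≤ R + 2 * M := by
    intro p q hpq
    obtain ⟨a, ha⟩ := exists_vert_near (fun x y h => (hlen x y h).2) hM.le p
    obtain ⟨b, hb⟩ := exists_vert_near (fun x y h => (hlen x y h).2) hM.le q
    have h1 := hf.stretch p (vert a)
    have h2 := hf.stretch q (vert b)
    have h3 := dist_triangle_left (f (vert a)) (f (vert b)) (f p)
    rw [hpq] at h3 h1
    have h4 : lam * dist p (vert a) ≤ lam * M := mul_le_mul_of_nonneg_left ha hf.pos.le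
    have h5 : lam * dist q (vert b) ≤ lam * M := mul_le_mul_of_nonneg_left hb hf.pos.le
    have h6 := hR a b (by linarith)
    have h7 := dist_triangle4 p (vert a) (vert b) q
    rw [dist_comm (vert b) q] at h7
    linarith
  refine ⟨lam * max (R + 2 * M) 0, mul_nonneg hf.pos.le (le_max_right _ _), fun p z q hz => ?_⟩
  obtain ⟨p', hp', hpe⟩ := hf.stretch.exists_between_map_eq hf.pos
    (med_between_left (f p) (f z) (f q))
  obtain ⟨q', hq', hqe⟩ := hf.stretch.exists_between_map_eq hf.pos
    (med_between_right (f p) (f z) (f q))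
  have h1 := hfib p' q' (hpe.trans hqe.symm)
  have h2 : Between p' z q' := (hz.trans_right hp').trans_right_symm hq'
  have h3 := h2.dist_le_left
  have h4 := hf.stretch z p'
  rw [hpe] at h4
  refine h4.trans (mul_le_mul_of_nonneg_left ?_ hf.pos.le)
  rw [dist_comm]
  exact h3.trans (h1.trans (le_max_left _ _))

/-- One more iteration multiplies the previous error by `lam` and adds `C`, hence the geometric sum.
-/
theorem bounded_cancellation_iterate (hf : LegalMap ψ f lam) (hl : 1 < lam) {C : ℝ}
    (hC : ∀ p z q : T.Point, Between p z q → dist (f z) (med (f p) (f z) (f q)) ≤ C)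
    {p z q : T.Point} (h : Between p z q) (n : ℕ) :
    dist (f^[n] z) (med (f^[n] p) (f^[n] z) (f^[n] q)) ≤ C * ((lam ^ n - 1) / (lam - 1)) := by
  induction n with
  | zero =>
    have := dist_med_le (y := z) h
    simpa using this
  | succ n ih =>
    simp only [Function.iterate_succ_apply']
    set m := med (f^[n] p) (f^[n] z) (f^[n] q)
    have hm : Between (f^[n] p) m (f^[n] q) := med_between _ _ _
    have h1 := hC _ _ _ hm
    have h2 := dist_med_le (y := f (f^[n] z)) (med_between (f (f^[n] p)) (f m) (f (f^[n] q)))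
    have h3 := dist_triangle (f (f^[n] z)) (f m) (med (f (f^[n] p)) (f m) (f (f^[n] q)))
    have h4 := hf.stretch (f^[n] z) m
    have h5 := mul_le_mul_of_nonneg_left ih hf.pos.le
    have h6 : C * ((lam ^ (n + 1) - 1) / (lam - 1)) =
        lam * (C * ((lam ^ n - 1) / (lam - 1))) + C := by
      have : lam - 1 ≠ 0 := by linarith
      field_simp
      ring
    linarith

theorem nonpos_of_pow_mul_le (hl : 1 < lam) {a B : ℝ} (h : ∀ n : ℕ, lam ^ n * a ≤ B) : a ≤ 0 := by
  by_contra! ha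
  obtain ⟨n, hn⟩ := pow_unbounded_of_one_lt (B / a) hl
  rw [div_lt_iff₀ ha] at hn
  exact absurd (h n) (not_le.2 hn)

/-- Legal segments inside a segment whose images have bounded size are of bounded length. -/
theorem exists_legal_bound (hf : LegalMap ψ f lam) (hT : T.IsCyclicTree) (hG : Group.FG G)
    (hl : 1 < lam) : ∃ C, ∀ (x y : T.Point) (B : ℝ), (∀ n : ℕ, dist (f^[n] x) (f^[n] y) ≤ B) →
      ∀ z w, Between x z y → Between x w y → Legal f lam z w → dist z w ≤ C := by
  obtain ⟨C, hC0, hC⟩ := hf.bounded_cancellation hT hG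
  refine ⟨2 * C / (lam - 1), fun x y B hB z w hz hw hzw => ?_⟩
  refine sub_nonpos.1 (nonpos_of_pow_mul_le hl (B := B) fun n => ?_)
  -- Cancellation at the two ends removes at most `2 * C * (lam ^ n - 1) / (lam - 1)` from the
  -- length `lam ^ n * dist z w`. If `dist z w` exceeded `2 * C / (lam - 1)`, what is left would be
  -- unbounded.
  have h1 := hf.bounded_cancellation_iterate hl hC hz n
  have h2 := hf.bounded_cancellation_iterate hl hC hw n
  have m1 := med_between (f^[n] x) (f^[n] z) (f^[n] y)
  have m2 := med_between (f^[n] x) (f^[n] w) (f^[n] y)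
  set m := med (f^[n] x) (f^[n] z) (f^[n] y)
  set m' := med (f^[n] x) (f^[n] w) (f^[n] y)
  have h3 : dist m m' ≤ dist (f^[n] x) (f^[n] y) := by
    rcases m1.total m2 with h | h
    · exact h.dist_le_right.trans m2.dist_le_left
    · rw [dist_comm]; exact h.dist_le_right.trans m1.dist_le_left
  have h4 := dist_triangle4 (f^[n] z) m m' (f^[n] w)
  rw [hzw n, dist_comm m' (f^[n] w)] at h4
  have h5 : lam ^ n * (2 * C / (lam - 1)) - 2 * (C * ((lam ^ n - 1) / (lam - 1))) =
      2 * C / (lam - 1) := by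
    have : lam - 1 ≠ 0 := by linarith
    field_simp
    ring
  have h6 : 0 ≤ 2 * C / (lam - 1) := div_nonneg (by linarith) (by linarith)
  have := hB n
  rw [mul_sub]
  linarith

end LegalMap

/-! ### Existence of loxodromic elements -/

/-- No vertex has valence less than two, so there is an infinite ray without backtracking. Two of
its oriented edges are in the same orbit, and an element taking one to the other translates along
the ray. -/
theorem exists_isLoxodromic (hT : T.IsMinimal) (hG : Group.FG G)
    (h2 : ∀ a : T.V, ∃ b c : T.V, T.graph.Adj a b ∧ T.graph.Adj a c ∧ b ≠ c) :
    ∃ g : G, T.IsLoxodromic g := by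
  have hnext : ∀ e : {e : T.V × T.V // T.graph.Adj e.1 e.2},
      ∃ z, T.graph.Adj e.1.2 z ∧ z ≠ e.1.1 := by
    rintro ⟨⟨x, y⟩, h⟩
    obtain ⟨b, c, hb, hc, hbc⟩ := h2 y
    by_cases hbx : b = x
    · exact ⟨c, hc, fun h => hbc (hbx.trans h.symm)⟩
    · exact ⟨b, hb, hbx⟩
  choose nx hnx hnx' using hnext
  obtain ⟨a⟩ := T.isTree.connected.nonempty
  obtain ⟨b, _, hb, -, -⟩ := h2 a
  let step : {e : T.V × T.V // T.graph.Adj e.1 e.2} → {e : T.V × T.V // T.graph.Adj e.1 e.2} :=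
    fun e => ⟨(e.1.2, nx e), hnx e⟩
  let e : ℕ → {e : T.V × T.V // T.graph.Adj e.1 e.2} := fun n => step^[n] ⟨(a, b), hb⟩
  have he : ∀ n, e (n + 1) = step (e n) := fun n => Function.iterate_succ_apply' _ _ _
  let u : ℕ → T.V := fun n => (e n).1.1
  have hu : ∀ n, u (n + 1) = (e n).1.2 := fun n => by
    show (e (n + 1)).1.1 = _
    rw [he]
  have hadj : ∀ n, T.graph.Adj (u n) (u (n + 1)) := fun n => by
    rw [hu]; exact (e n).2
  have hnb : ∀ n, u n ≠ u (n + 2) := fun n => by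
    rw [hu (n + 1), he]
    exact (hnx' (e n)).symm
  obtain ⟨A, hA, hA'⟩ := exists_finite_edges hT hG
  choose k hk using fun n => hA' _ _ (hadj n)
  have : Finite A := hA
  obtain ⟨i, j, hij, heq⟩ := Finite.exists_ne_map_eq_of_infinite
    (fun n => (⟨_, hk n⟩ : A))
  have main : ∀ i j, i < j → (k i • u i, k i • u (i + 1)) = (k j • u j, k j • u (j + 1)) →
      ∃ g : G, T.IsLoxodromic g := by
    intro i j hij heq
    rw [Prod.mk.injEq] at heq
    refine ⟨(k j)⁻¹ * k i, ?_⟩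
    have e1 : ((k j)⁻¹ * k i) • (vert (u i) : T.Point) = vert (u j) := by
      rw [smul_vert, mul_smul, heq.1, inv_smul_smul]
    have e2 : ((k j)⁻¹ * k i) • (vert (u (i + 1)) : T.Point) = vert (u (j + 1)) := by
      rw [smul_vert, mul_smul, heq.2, inv_smul_smul]
    intro p
    refine ne_of_shift (g := fun p : T.Point => ((k j)⁻¹ * k i) • p) (dist_smul_smul _)
      (x := vert (u i)) (v := vert (u (i + 1))) (fun h => (hadj i).ne (vert_injective h)) ?_ p
    rw [e1, e2]
    obtain ⟨d, rfl⟩ := Nat.exists_eq_add_of_lt hij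
    have b1 := vertex_path_between (n := d + 1 + 1) (u := fun l => u (i + l))
      (fun l _ => hadj (i + l)) (fun l _ => hnb (i + l)) (i := d + 1) (by omega)
    have b2 := vertex_path_between (n := d + 1) (u := fun l => u (i + l))
      (fun l _ => hadj (i + l)) (fun l _ => hnb (i + l)) (i := 1) (by omega)
    unfold Between at b1 b2
    simp only [add_zero, ← add_assoc] at b1 b2 ⊢
    linarith
  rcases lt_or_gt_of_ne hij with h | h
  · exact main i j h (congrArg Subtype.val heq)
  · exact main j i h (congrArg Subtype.val heq).symm

theorem GTree.IsTrainTrack.exists_two {φ : Out G} (hf : GTree.IsTrainTrack φ f) (a : T.V) :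
    ∃ b c : T.V, T.graph.Adj a b ∧ T.graph.Adj a c ∧ b ≠ c := by
  obtain ⟨b, c, hb, hc, hbc⟩ := hf.two_gates a
  refine ⟨b, c, hb, hc, ?_⟩
  rintro rfl
  exact hbc (Relation.EqvGen.refl _)

/-- Without expansion the displacement of `f^[n] p` by `(ψ ^ n) g` would never exceed that of `p` by
`g`. -/
theorem LegalMap.one_lt (hf : LegalMap ψ f lam) {φ : Out G} (hψ : (ψ : Out G) = φ)
    (hator : T.IsPseudoAtoroidal φ) {g : G} (hg : T.IsLoxodromic g) : 1 < lam := by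
  by_contra! hle
  obtain ⟨p⟩ : Nonempty T.Point := inferInstance
  refine hator g hg (isPseudoPeriodic_of hψ (B := dist p (g • p)) fun n => ?_)
  have h1 := translationLength_le ((ψ ^ n) g) (f^[n] p)
  rw [← hf.iterate_smul] at h1
  have h2 := hf.stretch.iterate hf.pos.le n p (g • p)
  have h3 : lam ^ n ≤ 1 := pow_le_one₀ hf.pos.le hle
  have h4 := mul_le_mul_of_nonneg_right h3 (dist_nonneg (x := p) (y := g • p))
  linarith

end GBS

end

noncomputable section

namespace GBS

universe u v w

open GTree hiding dist

/-! ### Chains of legal segments -/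

section LegalChain

variable {X : Type*} [MetricSpace X]

/-- There is a path from `x` to `y` made of `k` legal segments. -/
inductive LegalChain (f : X → X) (lam : ℝ) : ℕ → X → X → Prop
  | nil (x : X) : LegalChain f lam 0 x x
  | cons {k : ℕ} {x y z : X} (h : Legal f lam x y) (h' : LegalChain f lam k y z) :
      LegalChain f lam (k + 1) x z

variable {f : X → X} {lam : ℝ}

theorem LegalChain.succ {k : ℕ} {x y : X} (h : LegalChain f lam k x y) :
    LegalChain f lam (k + 1) x y := LegalChain.cons (Legal.refl x) h

theorem LegalChain.append {k l : ℕ} {x y z : X} (h : LegalChain f lam k x y)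
    (h' : LegalChain f lam l y z) : LegalChain f lam (k + l) x z := by
  induction h with
  | nil x => simpa using h'
  | @cons k _ _ _ h _ ih => rw [Nat.add_right_comm]; exact LegalChain.cons h (ih h')

theorem LegalChain.iterate {k : ℕ} {x y : X} (h : LegalChain f lam k x y) (n : ℕ) :
    LegalChain f lam k (f^[n] x) (f^[n] y) := by
  induction h with
  | nil x => exact LegalChain.nil _
  | cons h _ ih => exact LegalChain.cons (h.iterate n) ih

variable [TreeMetric X]

theorem LegalChain.truncate (hf : Stretch f lam) (hl : 0 ≤ lam) {k : ℕ} {x y m : X}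
    (h : LegalChain f lam k x y) (hm : Between x m y) : LegalChain f lam k m y := by
  induction h with
  | nil x => rw [hm.eq_of_self]; exact LegalChain.nil _
  | @cons k x z y h h' ih =>
    rcases hm.or_between z with h1 | h1
    · exact LegalChain.cons (h.sub_right hf hl h1) h'
    · exact (ih h1).succ

/-- In a shortest chain of legal segments the first corner is on the geodesic. -/
theorem between_of_not_legalChain (hf : Stretch f lam) (hl : 0 ≤ lam) {j : ℕ} {x v w y : X}
    (hxv : Legal f lam x v) (hwy : LegalChain f lam j w y) (hn : ¬ LegalChain f lam (j + 1) x y)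
    (hb : Between x v w) : Between x v y := by
  have m1 := med_between_left x v y
  have m2 := med_between_right x v y
  have m3 := med_between x v y
  by_cases he : med x v y = v
  · rwa [he] at m3
  -- The geodesic to `y` would leave `[x, v]` before `v`. The chain from `w` to `y` passes through
  -- that point, so cutting there saves one legal segment.
  · exfalso
    have h1 : Between (med x v y) v w := hb.trans_right m1
    have h2 := (h1.symm.glue m2 (Ne.symm he)).2
    exact hn (LegalChain.cons (hxv.sub_left hf hl m1) (hwy.truncate hf hl h2))

theorem med_eq_of_between_left {b x x' w : X} (h : Between b x x') (hne : med x b w ≠ x) :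
    med x' b w = med x b w := by
  have m1 := med_between_left x b w
  have m2 := med_between_right x b w
  have m3 := med_between x b w
  have h1 : Between (med x b w) x x' := h.trans_right m1.symm
  exact (eq_med (h.symm.trans_left_symm m1) m2 (h1.symm.glue m3 hne.symm).2).symm

theorem med_comm (x b w : X) : med x b w = med w b x :=
  eq_med (med_between_right x b w).symm (med_between_left x b w).symm (med_between x b w).symm

theorem med_eq_of_between_right {b x w w' : X} (h : Between b w w') (hne : med x b w ≠ w) :
    med x b w' = med x b w := by
  rw [med_comm x b w', med_comm x b w]
  rw [med_comm x b w] at hne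
  exact med_eq_of_between_left h hne

/-- The branch point of two segments issued from `b` does not change when they are prolonged
or shortened beyond it. -/
theorem med_eq_of_nested {b x x' w w' : X} (hx : Between b x x' ∨ Between b x' x)
    (hw : Between b w w' ∨ Between b w' w) (h1 : med x b w ≠ x) (h2 : med x b w ≠ w)
    (h1' : med x' b w' ≠ x') (h2' : med x' b w' ≠ w') : med x b w = med x' b w' := by
  rcases hx with hx | hx <;> rcases hw with hw | hw
  · have e1 := med_eq_of_between_left hx h1
    rw [← e1] at h2 ⊢
    exact (med_eq_of_between_right hw h2).symm
  · rw [← med_eq_of_between_left hx h1, ← med_eq_of_between_right hw h2']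
  · rw [← med_eq_of_between_left hx h1', ← med_eq_of_between_right hw h2]
  · have e1 := med_eq_of_between_left hx h1'
    rw [← e1] at h2' ⊢
    refine med_eq_of_between_right hw ?_
    assumption

/-- The vertex `v` is the first illegal corner of a segment starting at `x` that shrinks to
a bounded segment under the iterates of `f` without losing this corner. -/
structure NielsenCorner (f : X → X) (lam : ℝ) (x v w : X) : Prop where
  legal_left : Legal f lam x v
  legal_right : Legal f lam v w
  between : Between x v w
  ne : x ≠ v
  exists_bound : ∃ B, ∀ n : ℕ, dist (f^[n] x) (med (f^[n] x) (f^[n] v) (f^[n] w)) ≤ B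
  ne_left : ∀ n : ℕ, med (f^[n] x) (f^[n] v) (f^[n] w) ≠ f^[n] x
  ne_right : ∀ n : ℕ, med (f^[n] x) (f^[n] v) (f^[n] w) ≠ f^[n] w

/-- Prolonging both sides to `a` and `d` shows that the two corners have the same branch point in
every iterate. The distance of `f^[n] v` to it is both `lam ^ n * dist x v` and `lam ^ n * dist x'
v` up to a bounded error, and `lam > 1`. -/
theorem NielsenCorner.eq (hf : Stretch f lam) (hl : 1 < lam) {a v d x x' w w' : X}
    (h : NielsenCorner f lam x v w) (h' : NielsenCorner f lam x' v w') (hx : Between a x v)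
    (hx' : Between a x' v) (hw : Between v w d) (hw' : Between v w' d) : x = x' := by
  have hl0 : 0 ≤ lam := by linarith
  have hnest : ∀ {p q : X}, Legal f lam v q → Between v p q → ∀ n : ℕ,
      Between (f^[n] v) (f^[n] p) (f^[n] q) := fun hq hb n =>
    ((hf.iterate hl0 n).eq_of_between hb (hq n)).2.2
  have hmed : ∀ n : ℕ, med (f^[n] x) (f^[n] v) (f^[n] w) = med (f^[n] x') (f^[n] v) (f^[n] w') := by
    intro n
    refine med_eq_of_nested ?_ ?_ (h.ne_left n) (h.ne_right n) (h'.ne_left n) (h'.ne_right n)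
    · exact (hx.symm.total hx'.symm).imp (fun hb => hnest h'.legal_left.symm hb n)
        fun hb => hnest h.legal_left.symm hb n
    · exact (hw.total hw').imp (fun hb => hnest h'.legal_right hb n)
        fun hb => hnest h.legal_right hb n
  have key : ∀ {x x' w w' : X}, NielsenCorner f lam x v w → NielsenCorner f lam x' v w' →
      (∀ n : ℕ, med (f^[n] x) (f^[n] v) (f^[n] w) = med (f^[n] x') (f^[n] v) (f^[n] w')) →
      dist x v ≤ dist x' v := by
    intro x x' w w' h h' hm
    obtain ⟨B, hB⟩ := h.exists_bound
    refine sub_nonpos.1 (LegalMap.nonpos_of_pow_mul_le hl (B := B) fun n => ?_)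
    have m1 := med_between_left (f^[n] x) (f^[n] v) (f^[n] w)
    have m2 := med_between_left (f^[n] x') (f^[n] v) (f^[n] w')
    rw [← hm n] at m2
    have h3 := hB n
    have h4 := m2.dist_le_right
    rw [h'.legal_left n] at h4
    unfold Between at m1
    rw [h.legal_left n] at m1
    rw [mul_sub]
    linarith
  refine hx.symm.eq_of_dist_eq hx'.symm ?_
  rw [dist_comm v x, dist_comm v x']
  exact (key h h' hmed).antisymm (key h' h fun n => (hmed n).symm)

end LegalChain

/-! ### Periodic Nielsen paths -/

variable {G : Type u} [Group G] {T : GTree.{u, v} G}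
variable {ψ : MulAut G} {f : T.Point → T.Point} {lam : ℝ}

namespace LegalMap

theorem legalChain_smul (hf : LegalMap ψ f lam) (g : G) {k : ℕ} {x y : T.Point}
    (h : LegalChain f lam k x y) : LegalChain f lam k (g • x) (g • y) := by
  induction h with
  | nil x => exact LegalChain.nil _
  | cons h _ ih => exact LegalChain.cons (hf.legal_smul g h) ih

theorem exists_legal_vert (hf : LegalMap ψ f lam) (x : T.Point) :
    ∃ a : T.V, Legal f lam x (vert a) := by
  rcases point_cases x with ⟨a, rfl⟩ | ⟨a, b, h, hp⟩
  · exact ⟨a, Legal.refl _⟩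
  · exact ⟨a, hf.legal_edge h hp (vert_mem_edge_left a b)⟩

theorem exists_legalChain (hf : LegalMap ψ f lam) (x y : T.Point) :
    ∃ k, LegalChain f lam k x y := by
  obtain ⟨a, ha⟩ := hf.exists_legal_vert x
  obtain ⟨b, hb⟩ := hf.exists_legal_vert y
  have key : ∀ {a b : T.V} (_ : T.graph.Walk a b), ∃ k, LegalChain f lam k (vert a) (vert b) := by
    intro a b W
    induction W with
    | nil => exact ⟨0, LegalChain.nil _⟩
    | cons h _ ih =>
      obtain ⟨k, hk⟩ := ih
      exact ⟨k + 1, LegalChain.cons (hf.legal _ _ h) hk⟩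
  obtain ⟨W⟩ := T.isTree.connected.preconnected a b
  obtain ⟨k, hk⟩ := key W
  exact ⟨k + 1 + 1, LegalChain.cons ha (hk.append (LegalChain.cons hb.symm (LegalChain.nil _)))⟩

theorem iterate_mul_eq_smul (hf : LegalMap ψ f lam) {g : G} {N : ℕ} {x y : T.Point}
    (hx : g • f^[N] x = x) (hy : g • f^[N] y = y) (j : ℕ) :
    ∃ h : G, f^[j * N] x = h • x ∧ f^[j * N] y = h • y := by
  have hx' : f^[N] x = g⁻¹ • x := by rw [eq_inv_smul_iff]; exact hx
  have hy' : f^[N] y = g⁻¹ • y := by rw [eq_inv_smul_iff]; exact hy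
  induction j with
  | zero => exact ⟨1, by simp, by simp⟩
  | succ j ih =>
    obtain ⟨h, h1, h2⟩ := ih
    refine ⟨(ψ ^ (j * N)) g⁻¹ * h, ?_, ?_⟩
    · rw [Nat.succ_mul, Function.iterate_add_apply, hx', hf.iterate_smul, h1, mul_smul]
    · rw [Nat.succ_mul, Function.iterate_add_apply, hy', hf.iterate_smul, h2, mul_smul]

theorem exists_nielsen_bound (hf : LegalMap ψ f lam) {x y : T.Point}
    (h : IsPeriodicNielsenPath f x y) : ∃ B, ∀ n : ℕ, dist (f^[n] x) (f^[n] y) ≤ B := by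
  obtain ⟨-, g, N, hN, hx, hy⟩ := h
  have hx' : f^[N] x = g⁻¹ • x := by rw [eq_inv_smul_iff]; exact hx
  have hy' : f^[N] y = g⁻¹ • y := by rw [eq_inv_smul_iff]; exact hy
  have hper : Function.Periodic (fun n => dist (f^[n] x) (f^[n] y)) N := by
    intro n
    dsimp only
    rw [Function.iterate_add_apply, Function.iterate_add_apply, hx', hy', hf.iterate_smul,
      hf.iterate_smul, dist_smul_smul]
  refine ⟨∑ n ∈ Finset.range N, dist (f^[n] x) (f^[n] y), fun n => ?_⟩
  have := hper.map_mod_nat n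
  rw [← this]
  exact Finset.single_le_sum (f := fun n => dist (f^[n] x) (f^[n] y)) (fun _ _ => dist_nonneg)
    (Finset.mem_range.2 (Nat.mod_lt n hN))

/-- A later iterate of the path is a translate of the path itself, so a chain for `f^[n]` would be
carried forward to a chain for the original endpoints. -/
theorem not_legalChain_iterate (hf : LegalMap ψ f lam) {x y : T.Point}
    (h : IsPeriodicNielsenPath f x y) {k : ℕ} (hk : ¬ LegalChain f lam k x y) (n : ℕ) :
    ¬ LegalChain f lam k (f^[n] x) (f^[n] y) := by
  obtain ⟨-, g, N, hN, hx, hy⟩ := h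
  intro hc
  obtain ⟨h, h1, h2⟩ := hf.iterate_mul_eq_smul hx hy n
  have hle : n ≤ n * N := Nat.le_mul_of_pos_right n hN
  have h3 := hc.iterate (n * N - n)
  rw [← Function.iterate_add_apply, ← Function.iterate_add_apply, Nat.sub_add_cancel hle, h1,
    h2] at h3
  have h4 := hf.legalChain_smul h⁻¹ h3
  rw [inv_smul_smul, inv_smul_smul] at h4
  exact hk h4

/-- If a point on a segment is not a vertex, then near it the segment is legal. -/
theorem isVert_of_not_legal (hf : LegalMap ψ f lam) {x v w : T.Point} (hb : Between x v w)
    (hxv : Legal f lam x v) (hvw : Legal f lam v w) (hn : ¬ Legal f lam x w) : IsVert v := by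
  rcases point_cases v with h | ⟨a, b, hab, hv⟩
  · exact h
  by_contra hnv
  have hx : x ≠ v := by rintro rfl; exact hn hvw
  have hw : w ≠ v := by rintro rfl; exact hn hxv
  have key : ∀ x : T.Point, x ≠ v → ∃ x' ∈ edge a b, x' ≠ v ∧ Between x x' v := by
    intro x hx
    have m1 := med_between_left (vert a) x (vert b)
    have m2 := med_between_right (vert a) x (vert b)
    have m3 := med_between (vert a) x (vert b)
    have hvb := between_of_mem_edge hab hv
    refine ⟨_, mem_edge_of_between hab m3, ?_, ?_⟩
    · intro he
      rcases isVert_med (vert a) x (vert b) with h | h | h | h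
      · exact hnv (he ▸ h)
      · exact hnv ⟨a, he.symm.trans h⟩
      · exact hx (h.symm.trans he)
      · exact hnv ⟨b, he.symm.trans h⟩
    · rcases le_total (dist (vert a) v) (dist (vert a) (med (vert a) x (vert b))) with hle | hle
      · exact m1.symm.trans_right_symm (hvb.order m3 hle).1.symm
      · exact m2.trans_right_symm (m3.order hvb hle).2
  obtain ⟨x', hx'e, hx'v, hx'b⟩ := key x hx
  obtain ⟨w', hw'e, hw'v, hw'b⟩ := key w hw
  have hleg := hf.legal_edge hab hx'e hw'e
  have b1 : Between x' v w := hb.trans_right hx'b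
  have b2 : Between x' v w' := b1.trans_right_symm hw'b.symm
  have g1 : Legal f lam x w' := hxv.glue hf.stretch hf.pos hleg hx'b b2 hx'v
  have b3 : Between x v w' := hb.trans_right_symm hw'b.symm
  exact hn (g1.glue hf.stretch hf.pos hvw b3 hw'b.symm hw'v.symm)

/-- The beginning of a periodic Nielsen path. -/
theorem exists_nielsenCorner (hf : LegalMap ψ f lam) (hl : 1 < lam) {x y : T.Point}
    (h : IsPeriodicNielsenPath f x y) : ∃ (v : T.V) (w : T.Point),
      NielsenCorner f lam x (vert v) w ∧ Between x (vert v) y ∧ Between x w y := by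
  classical
  have hS := hf.stretch
  have hl0 := hf.pos.le
  obtain ⟨B, hB⟩ := hf.exists_nielsen_bound h
  have hex := hf.exists_legalChain x y
  have hmin : ∀ j < Nat.find hex, ¬ LegalChain f lam j x y := fun j hj => Nat.find_min hex hj
  have hchain := Nat.find_spec hex
  -- A shortest chain of legal segments has at least two pieces: with none the endpoints coincide,
  -- and a single legal segment with bounded iterates is degenerate.
  generalize Nat.find hex = k at hmin hchain
  match k, hchain, hmin with
  | 0, hc, _ => cases hc; exact absurd rfl h.1
  | 1, hc, _ =>
    exfalso
    cases hc with
    | cons h1 h2 =>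
      cases h2
      have := LegalMap.nonpos_of_pow_mul_le hl (a := dist x y) (B := B) fun n => by
        rw [← h1 n]; exact hB n
      exact h.1 (dist_le_zero.1 this)
  | j + 2, hc, hmin =>
    have hn : ∀ n, ¬ LegalChain f lam (j + 1) (f^[n] x) (f^[n] y) :=
      hf.not_legalChain_iterate h (hmin (j + 1) (by omega))
    cases hc with
    | @cons _ _ v₀ _ hxv₀ hc =>
    cases hc with
    | @cons _ _ w₀ _ hvw₀ hc =>
    -- The second piece may run back over the first one, so the corner is moved to their branch
    -- point; similarly `w` cuts the second piece where the geodesic to `y` leaves it.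
    set v := med x v₀ w₀
    have hxv : Legal f lam x v := hxv₀.sub_left hS hl0 (med_between_left x v₀ w₀)
    have hvw' : Legal f lam v w₀ := hvw₀.sub_right hS hl0 (med_between_right x v₀ w₀)
    have hvy : Between x v y :=
      between_of_not_legalChain hS hl0 hxv hc (hn 0) (med_between x v₀ w₀)
    set w := med v w₀ y
    have hvw : Legal f lam v w := hvw'.sub_left hS hl0 (med_between_left v w₀ y)
    have hwc : LegalChain f lam j w y := hc.truncate hS hl0 (med_between_right v w₀ y)
    have hwy : Between v w y := med_between v w₀ y
    have hxw : Between x v w := hvy.trans_right_symm hwy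
    -- If the two pieces merged into a legal one in some iterate, the chain there would be too
    -- short.
    have hnl : ∀ n, ¬ Legal f lam (f^[n] x) (f^[n] w) := fun n hleg =>
      hn n (LegalChain.cons hleg (hwc.iterate n))
    obtain ⟨v', hv'⟩ := hf.isVert_of_not_legal hxw hxv hvw (hnl 0)
    refine ⟨v', w, ?_, hv' ▸ hvy, hvy.trans_left_symm hwy⟩
    rw [← hv']
    have hml : ∀ n, Legal f lam (f^[n] x) (med (f^[n] x) (f^[n] v) (f^[n] w)) := fun n =>
      (hxv.iterate n).sub_left hS hl0 (med_between_left _ _ _)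
    have hmr : ∀ n, Legal f lam (med (f^[n] x) (f^[n] v) (f^[n] w)) (f^[n] w) := fun n =>
      (hvw.iterate n).sub_right hS hl0 (med_between_right _ _ _)
    refine ⟨hxv, hvw, hxw, ?_, ⟨B, fun n => ?_⟩, fun n he => ?_, fun n he => ?_⟩
    · intro he
      exact hnl 0 (by rw [he]; exact hvw)
    -- Since the chain is shortest in every iterate, the branch point is on the geodesic from `f^[n]
    -- x` to `f^[n] y`, whose length is bounded.
    · have := between_of_not_legalChain hS hl0 (hml n) (hwc.iterate n) (hn n)
        (med_between (f^[n] x) (f^[n] v) (f^[n] w))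
      exact this.dist_le_left.trans (hB n)
    · have := hmr n
      rw [he] at this
      exact hnl n this
    · have := hml n
      rw [he] at this
      exact hnl n this

theorem nielsenCorner_smul (hf : LegalMap ψ f lam) (g : G) {x v w : T.Point}
    (h : NielsenCorner f lam x v w) : NielsenCorner f lam (g • x) (g • v) (g • w) := by
  have hm : ∀ n : ℕ, med (f^[n] (g • x)) (f^[n] (g • v)) (f^[n] (g • w)) =
      (ψ ^ n) g • med (f^[n] x) (f^[n] v) (f^[n] w) := by
    intro n
    rw [hf.iterate_smul, hf.iterate_smul, hf.iterate_smul]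
    exact (med_map (g := fun p : T.Point => (ψ ^ n) g • p) (dist_smul_smul _) _ _ _).symm
  obtain ⟨B, hB⟩ := h.exists_bound
  refine ⟨hf.legal_smul g h.legal_left, hf.legal_smul g h.legal_right, Between.smul h.between g,
    fun he => h.ne (smul_left_cancel g he), ⟨B, fun n => ?_⟩, fun n he => ?_, fun n he => ?_⟩
  · rw [hm, hf.iterate_smul, dist_smul_smul]; exact hB n
  · rw [hm, hf.iterate_smul] at he
    exact h.ne_left n (smul_left_cancel _ he)
  · rw [hm, hf.iterate_smul] at he
    exact h.ne_right n (smul_left_cancel _ he)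

end LegalMap

theorem dist_eq_of_dist_eq_sum {X : Type*} [MetricSpace X] {k : ℕ} {x : ℕ → X}
    (h : dist (x 0) (x k) = ∑ i ∈ Finset.range k, dist (x i) (x (i + 1))) {i j : ℕ} (hij : i < j)
    (hj : j < k) : dist (x i) (x (j + 1)) =
      dist (x i) (x (i + 1)) + dist (x (i + 1)) (x j) + dist (x j) (x (j + 1)) := by
  have hsum := Finset.sum_range_add_sum_Ico (fun i => dist (x i) (x (i + 1)))
    (show j + 1 ≤ k by omega)
  have hsum' := Finset.sum_range_add_sum_Ico (fun i => dist (x i) (x (i + 1)))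
    (show i ≤ j + 1 by omega)
  have h1 := dist_le_range_sum_dist x i
  have h2 := dist_le_Ico_sum_dist x (show j + 1 ≤ k by omega)
  have h3 : ∑ l ∈ Finset.Ico i (j + 1), dist (x l) (x (l + 1)) = dist (x i) (x (i + 1)) +
      (∑ l ∈ Finset.Ico (i + 1) j, dist (x l) (x (l + 1)) + dist (x j) (x (j + 1))) := by
    rw [Finset.sum_eq_sum_Ico_succ_bot (by omega), Finset.sum_Ico_succ_top (by omega)]
  have h4 := dist_le_Ico_sum_dist x (show i + 1 ≤ j by omega)
  have h5 := dist_triangle4 (x 0) (x i) (x (j + 1)) (x k)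
  have h6 := dist_triangle4 (x i) (x (i + 1)) (x j) (x (j + 1))
  linarith

/-- The bound on concatenations of periodic Nielsen paths for one train track map. -/
theorem LegalMap.exists_nielsenConcatenationBound (hf : LegalMap ψ f lam) (hT : T.IsCyclicTree)
    (hG : Group.FG G) {φ : Out G} (hψ : (ψ : Out G) = φ) (hator : T.IsPseudoAtoroidal φ)
    (hl : 1 < lam) : ∃ m : ℕ, NielsenConcatenationBound f m := by
  obtain ⟨ℓ, M, -, hM, hlen⟩ := exists_len_bounds hT.minimal hG
  obtain ⟨C, hC⟩ := hf.exists_legal_bound hT hG hl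
  -- The legal sides of a corner have length at most `C`, and prolonging them to vertices costs at
  -- most `M`.
  obtain ⟨A, hA, hA'⟩ := exists_finite_triples hT hG (C + M)
  refine ⟨hA.toFinset.card, fun k x ⟨hx, hsum⟩ => ?_⟩
  change dist (x 0) (x k) = ∑ i ∈ Finset.range k, dist (x i) (x (i + 1)) at hsum
  by_contra! hk
  have hcorner : ∀ i : Fin k, ∃ (v a d : T.V) (w : T.Point) (g : G),
      NielsenCorner f lam (x i) (vert v) w ∧ Between (x i) (vert v) (x (i + 1)) ∧
      Between (vert a) (x i) (vert v) ∧ Between (vert v) w (vert d) ∧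
      (g • v, g • a, g • d) ∈ A := by
    intro i
    have hN := hx i i.2
    obtain ⟨v, w, hc, hv, hw⟩ := hf.exists_nielsenCorner hl hN
    obtain ⟨B, hB⟩ := hf.exists_nielsen_bound hN
    have h1 := hC _ _ B hB _ _ (Between.left _ _) hv hc.legal_left
    have h2 := hC _ _ B hB _ _ hv hw hc.legal_right
    obtain ⟨a, ha, ha'⟩ := exists_vert_between (fun x y h => (hlen x y h).2) hM.le (x i) v
    obtain ⟨d, hd, hd'⟩ := exists_vert_between (fun x y h => (hlen x y h).2) hM.le w v
    have h3 : dist (vert v : T.Point) (vert a) ≤ C + M := by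
      have := dist_triangle (vert v) (x i) (vert a)
      rw [dist_comm (vert v) (x i), dist_comm (x i) (vert a)] at this
      linarith
    have h4 : dist (vert v : T.Point) (vert d) ≤ C + M := by
      have := dist_triangle (vert v) w (vert d)
      rw [dist_comm w (vert d)] at this
      linarith
    obtain ⟨g, hg⟩ := hA' v a d h3 h4
    exact ⟨v, a, d, w, g, hc, hv, ha', hd'.symm, hg⟩
  choose v a d w g hc hv ha hd hg using hcorner
  choose B hB using fun i : Fin k => hf.exists_nielsen_bound (hx i i.2)
  have main : ∀ i j : Fin k, i < j → (g i • v i, g i • a i, g i • d i) =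
      (g j • v j, g j • a j, g j • d j) → False := by
    intro i j hij heq
    simp only [Prod.mk.injEq] at heq
    set h := (g j)⁻¹ * g i with hh
    have ev : h • (vert (v i) : T.Point) = vert (v j) := by
      rw [smul_vert, hh, mul_smul, heq.1, inv_smul_smul]
    have ea : h • (vert (a i) : T.Point) = vert (a j) := by
      rw [smul_vert, hh, mul_smul, heq.2.1, inv_smul_smul]
    have ed : h • (vert (d i) : T.Point) = vert (d j) := by
      rw [smul_vert, hh, mul_smul, heq.2.2, inv_smul_smul]
    have ex : h • x i = x j := by
      have c1 := hf.nielsenCorner_smul h (hc i)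
      have b1 := Between.smul (ha i) h
      have b2 := Between.smul (hd i) h
      rw [ev] at c1
      rw [ea, ev] at b1
      rw [ev, ed] at b2
      exact c1.eq hf.stretch hl (hc j) b1 (ha j) b2 (hd j)
    -- The points `x i`, `v i`, `h • x i = x j`, `h • v i = v j` occur in this order on a geodesic.
    have hlox : T.IsLoxodromic h := by
      intro p
      refine ne_of_shift (g := fun p : T.Point => h • p) (dist_smul_smul h) (hc i).ne ?_ p
      have e1 := dist_eq_of_dist_eq_sum hsum hij j.2
      have e2 := hv i
      have e3 := hv j
      unfold Between at e2 e3
      rw [ex, ev]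
      have t1 := dist_triangle (x i) (vert (v j)) (x (j + 1))
      have t2 := dist_triangle4 (x i) (vert (v i)) (x j) (vert (v j))
      have t3 := dist_triangle (vert (v i)) (x (i + 1)) (x j)
      linarith
    -- The class of `h` is bounded along the orbit because `[x i, h • x i]` is a concatenation of
    -- periodic Nielsen paths, each with bounded iterates.
    refine hator h hlox (isPseudoPeriodic_of hψ
      (B := ∑ l ∈ Finset.Ico (i : ℕ) j, if hl : l < k then B ⟨l, hl⟩ else 0) fun n => ?_)
    refine (translationLength_le _ (f^[n] (x i))).trans ?_
    rw [← hf.iterate_smul, ex]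
    refine (dist_le_Ico_sum_dist (fun l => f^[n] (x l)) hij.le).trans
      (Finset.sum_le_sum fun l hl => ?_)
    have hlk : l < k := (Finset.mem_Ico.1 hl).2.trans j.2
    rw [dif_pos hlk]
    exact hB ⟨l, hlk⟩ n
  obtain ⟨i, -, j, -, hij, heq⟩ := Finset.exists_ne_map_eq_of_card_lt_of_maps_to
    (s := (Finset.univ : Finset (Fin k))) (t := hA.toFinset)
    (f := fun i => (g i • v i, g i • a i, g i • d i)) (by simpa using hk)
    (fun i _ => by simpa using hg i)
  rcases lt_or_gt_of_ne hij with h | h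
  · exact main i j h heq
  · exact main j i h heq.symm

end GBS

end

noncomputable section

namespace GBS

universe u v w

open GTree hiding dist

/-! ### Comparison of elliptic elements in two cyclic trees -/

theorem exists_pow_smul_eq_of_isCyclic {G : Type*} [Group G] {α : Type*} [MulAction G α]
    {H : Subgroup G} (hH : IsCyclic H) {k : G} (hk : k ∈ H) (hk1 : k ≠ 1) {b : α}
    (hb : k • b = b) {a : G} (ha : a ∈ H) : ∃ r : ℕ, 1 ≤ r ∧ a ^ r • b = b := by
  have hfin : Finite {y | ∃ x ∈ H, x • b = y} := finite_orbit_of_isCyclic hH hk hk1 hb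
  obtain ⟨i, j, hij, heq⟩ := Finite.exists_ne_map_eq_of_infinite
    (fun n : ℕ => (⟨a ^ n • b, a ^ n, Subgroup.pow_mem _ ha n, rfl⟩ : {y | ∃ x ∈ H, x • b = y}))
  have heq' : a ^ i • b = a ^ j • b := congrArg Subtype.val heq
  have main : ∀ i j : ℕ, i < j → a ^ i • b = a ^ j • b → ∃ r : ℕ, 1 ≤ r ∧ a ^ r • b = b := by
    intro i j hij h
    refine ⟨j - i, by omega, ?_⟩
    rw [show j = i + (j - i) by omega, pow_add, mul_smul] at h
    exact (smul_left_cancel _ h).symm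
  rcases lt_or_gt_of_ne hij with h | h
  · exact main i j h heq'
  · exact main j i h heq'.symm

variable {G : Type u} [Group G]

/-- Vertex groups are commensurable: at each edge of a walk from `u` to `v`, the edge group has
finite index in the cyclic vertex group, so some power passes to the next vertex. -/
theorem exists_pow_smul_eq {T : GTree.{u, v} G} (hT : T.IsCyclicTree) {u v : T.V} {a : G}
    (ha : a • u = u) : ∃ r : ℕ, 1 ≤ r ∧ a ^ r • v = v := by
  obtain ⟨W⟩ := T.isTree.connected.preconnected u v
  induction W generalizing a with
  | nil => exact ⟨1, le_rfl, by rwa [pow_one]⟩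
  | @cons u u' v h W ih =>
    obtain ⟨k, hk, hk1⟩ := exists_ne_one_of_infinite (hT.edge u u' h).2
    obtain ⟨r, hr, hr'⟩ := exists_pow_smul_eq_of_isCyclic (hT.vertex u).1 hk.1 hk1 (b := u') hk.2 ha
    obtain ⟨s, hs, hs'⟩ := ih hr'
    exact ⟨r * s, Nat.mul_pos hr hs, by rwa [pow_mul]⟩

theorem exists_generator_stabilizer {T : GTree.{u, v} G} (hT : T.IsCyclicTree) (u : T.V) :
    ∃ c : G, c • u = u ∧ ∀ a : G, a • u = u → ∃ k : ℤ, a = c ^ k := by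
  obtain ⟨⟨c, hc⟩, hgen⟩ := (hT.vertex u).1.exists_generator
  refine ⟨c, hc, fun a ha => ?_⟩
  obtain ⟨n, hn⟩ := Subgroup.mem_zpowers_iff.1 (hgen ⟨a, ha⟩)
  exact ⟨n, by simpa using (congrArg Subtype.val hn).symm⟩

variable {T : GTree.{u, v} G} {T' : GTree.{u, w} G}

/-- Formally `θ` multiplies `a` by the rational number `R / S`, and `θ ^ n` by its power. -/
theorem zpow_pow_eq (θ : MulAut G) {a : G} {R S : ℤ} (h : θ a ^ S = a ^ R) (n : ℕ) :
    (θ ^ n) a ^ (S ^ n) = a ^ (R ^ n) := by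
  induction n with
  | zero => simp
  | succ n ih =>
    have e : (θ ^ (n + 1)) a = (θ ^ n) (θ a) := by rw [pow_succ]; rfl
    rw [e, pow_succ', zpow_mul, ← map_zpow, h, map_zpow, ← zpow_mul, mul_comm, zpow_mul, ih,
      ← zpow_mul, pow_succ]

/-- Vertex groups of a tree carrying a representative of `φ⁻¹` are elliptic in a tree in which
`φ` is pseudo-atoroidal. -/
theorem LegalMap.translationLength_eq_zero {ψ' : MulAut G} {f' : T'.Point → T'.Point} {lam : ℝ}
    (hf' : LegalMap ψ' f' lam) (hT' : T'.IsCyclicTree) (hG : Group.FG G) {φ : Out G}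
    (hψ' : (ψ' : Out G) = φ⁻¹) (hator : T.IsPseudoAtoroidal φ) {v : T'.V} {a : G}
    (ha : a • v = v) : T.translationLength a = 0 := by
  by_contra hne
  have hpos : 0 < T.translationLength a :=
    lt_of_le_of_ne (translationLength_nonneg a) (Ne.symm hne)
  obtain ⟨v₁, hv₁⟩ := hf'.isVert _ ⟨v, rfl⟩
  have ha₁ : ψ' a • v₁ = v₁ := by
    apply vert_injective (T := T')
    rw [← smul_vert, ← hv₁, ← hf'.map_smul, smul_vert, ha]
  -- By commensurability a power of `ψ' a` lies in the cyclic stabilizer of `v`, as `a` does, which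
  -- yields the relation `hRS` between powers of `ψ' a` and `a`.
  obtain ⟨r, hr, hr'⟩ := exists_pow_smul_eq hT' (v := v) ha₁
  obtain ⟨c, -, hc⟩ := exists_generator_stabilizer hT' v
  obtain ⟨i, hi⟩ := hc a ha
  obtain ⟨j, hj⟩ := hc _ hr'
  have hRS : ψ' a ^ ((r : ℤ) * i) = a ^ j := by
    rw [zpow_mul, zpow_natCast, hj, hi, ← zpow_mul, ← zpow_mul, mul_comm]
  have hi0 : i ≠ 0 := by
    rintro rfl
    rw [hi, translationLength_zpow] at hpos
    simp at hpos
  have hj0 : j ≠ 0 := by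
    rintro rfl
    rw [zpow_zero, ← map_pow, map_eq_one_iff ψ' ψ'.injective] at hj
    have := translationLength_pow (T := T) a r
    rw [hj, translationLength_of_fixed (p := Classical.arbitrary T.Point) (one_smul G _)] at this
    have h1 : (0 : ℝ) < r := by exact_mod_cast hr
    exact (mul_pos h1 hpos).ne this
  generalize hR : (r : ℤ) * i = R at hRS
  have hR0 : R ≠ 0 := by
    rw [← hR]; exact mul_ne_zero (by exact_mod_cast (by omega : r ≠ 0)) hi0
  have hRp : 0 < |(R : ℝ)| := abs_pos.2 (by exact_mod_cast hR0)
  have hjp : 0 < |(j : ℝ)| := abs_pos.2 (by exact_mod_cast hj0)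
  -- In `T`, `ψ'` multiplies the translation length of `a` by `|j| / |R|`. If this is at least `1`,
  -- the inverse, which represents φ, has a bounded orbit. If not, the lengths along `ψ'` are
  -- positive and tend to `0`, against `hlow`.
  by_cases hle : |(R : ℝ)| ≤ |(j : ℝ)|
  · have hθ : ((ψ'⁻¹ : MulAut G) : Out G) = φ := by
      rw [QuotientGroup.mk_inv, hψ', inv_inv]
    have hrel : ψ'⁻¹ a ^ j = a ^ R := by
      apply ψ'.injective
      rw [map_zpow, map_zpow, MulAut.apply_inv_self, hRS]
    refine hator a (isLoxodromic_iff.2 hpos) (isPseudoPeriodic_of hθ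
      (B := T.translationLength a) fun n => ?_)
    have h1 := congrArg T.translationLength (zpow_pow_eq ψ'⁻¹ hrel n)
    rw [translationLength_zpow, translationLength_zpow] at h1
    push_cast at h1
    rw [abs_pow, abs_pow] at h1
    have h2 : |(R : ℝ)| ^ n ≤ |(j : ℝ)| ^ n := pow_le_pow_left₀ hRp.le hle n
    have h3 := mul_le_mul_of_nonneg_right h2 hpos.le
    rw [← h1] at h3
    exact le_of_mul_le_mul_left h3 (pow_pos hjp n)
  · push Not at hle
    obtain ⟨A, hA, hA'⟩ := exists_finite_vertices hT'.minimal hG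
    choose c hc hcg using exists_generator_stabilizer hT'
    obtain ⟨ε, hε, hεle⟩ : ∃ ε : ℝ, 0 < ε ∧ ∀ x ∈ A, 0 < T.translationLength (c x) →
        ε ≤ T.translationLength (c x) := by
      obtain ⟨M, hM⟩ := (hA.image fun x => (T.translationLength (c x))⁻¹).bddAbove
      refine ⟨(max M 1)⁻¹, by positivity, fun x hx hpos => ?_⟩
      rw [inv_le_comm₀ (by positivity) hpos]
      exact (hM ⟨x, hx, rfl⟩).trans (le_max_left _ _)
    -- The element `(ψ' ^ n) a` fixes a vertex of `T'`, so it is conjugate to a power of one of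
    -- finitely many generators of stabilizers.
    have hlow : ∀ n : ℕ, ε ≤ T.translationLength ((ψ' ^ n) a) ∨
        T.translationLength ((ψ' ^ n) a) = 0 := by
      intro n
      obtain ⟨x, hx⟩ := hf'.isVert_iterate n ⟨v, rfl⟩
      have hfix : (ψ' ^ n) a • x = x := by
        apply vert_injective (T := T')
        rw [← smul_vert, ← hx, ← hf'.iterate_smul, smul_vert, ha]
      obtain ⟨g, hg⟩ := hA' x
      obtain ⟨q, hq⟩ := hcg (g • x) (g * (ψ' ^ n) a * g⁻¹) (by
        rw [mul_smul, mul_smul, inv_smul_smul, hfix])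
      have h1 := translationLength_conj (T := T) g ((ψ' ^ n) a)
      rw [hq, translationLength_zpow] at h1
      rw [← h1]
      by_cases hq0 : q = 0
      · right; simp [hq0]
      · rcases (translationLength_nonneg (T := T) (c (g • x))).eq_or_lt with h0 | h0
        · right; rw [← h0, mul_zero]
        · left
          refine (hεle _ hg h0).trans (le_mul_of_one_le_left h0.le ?_)
          exact_mod_cast Int.one_le_abs hq0
    obtain ⟨n, hn⟩ := exists_pow_lt_of_lt_one (show 0 < ε / T.translationLength a by positivity)
      ((div_lt_one hRp).2 hle)
    have h1 := congrArg T.translationLength (zpow_pow_eq ψ' hRS n)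
    rw [translationLength_zpow, translationLength_zpow] at h1
    push_cast at h1
    rw [abs_pow, abs_pow] at h1
    have hRn := pow_pos hRp n
    have hjn := pow_pos hjp n
    rw [lt_div_iff₀ hpos, div_pow, div_mul_eq_mul_div, div_lt_iff₀ hRn, ← h1] at hn
    rcases hlow n with h2 | h2
    · nlinarith
    · rw [h2, mul_zero] at h1
      exact (mul_pos hjn hpos).ne h1

/-- If vertex groups of `T'` are elliptic in `T`, then elements with bounded translation length in
`T'` have bounded translation length in `T`. -/
theorem exists_translationLength_bound (hT' : T'.IsCyclicTree) (hG : Group.FG G)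
    (hell : ∀ (v : T'.V), ∀ a : G, a • v = v → T.translationLength a = 0) (B : ℝ) :
    ∃ C, ∀ g : G, T'.translationLength g ≤ B → T.translationLength g ≤ C := by
  obtain ⟨ℓ, M, -, hM, hlen⟩ := exists_len_bounds hT'.minimal hG
  obtain ⟨A, hA, hA'⟩ := exists_finite_triples hT' hG (B + 1 + 2 * M)
  have hfix : ∀ v : T'.V, ∃ w : T.V, ∀ a : G, a • v = v → a • w = w := by
    intro v
    obtain ⟨c, hc, hgen⟩ := exists_generator_stabilizer hT' v
    obtain ⟨w, hw⟩ := exists_fixed_of_translationLength (hell v c hc)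
    refine ⟨w, fun a ha => ?_⟩
    obtain ⟨k, rfl⟩ := hgen a ha
    have : c ∈ MulAction.stabilizer G w := hw
    exact Subgroup.zpow_mem _ this k
  -- Elements taking `x` to `y` differ by the stabilizer of `x`, which fixes `w`. So they all move
  -- `w` to the same point.
  have hpair : ∀ e : T'.V × T'.V × T'.V, ∃ C, ∀ g : G, g • e.1 = e.2.1 →
      T.translationLength g ≤ C := by
    rintro ⟨x, y, -⟩
    obtain ⟨w, hw⟩ := hfix x
    by_cases hn : ∃ g₀ : G, g₀ • x = y
    · obtain ⟨g₀, hg₀⟩ := hn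
      refine ⟨dist (vert w : T.Point) (g₀ • vert w), fun g hg => ?_⟩
      refine (translationLength_le g (vert w)).trans (le_of_eq ?_)
      have h1 : (g₀⁻¹ * g) • w = w := hw _ (by
        dsimp only at hg
        rw [mul_smul, hg, ← hg₀, inv_smul_smul])
      rw [smul_vert, smul_vert]
      rw [mul_smul, inv_smul_eq_iff] at h1
      rw [h1]
    · exact ⟨0, fun g hg => absurd ⟨g, hg⟩ hn⟩
  choose C hC using hpair
  obtain ⟨K, hK⟩ := (hA.image C).bddAbove
  refine ⟨K, fun g hg => ?_⟩
  obtain ⟨p, hp⟩ := exists_dist_lt_of_translationLength (show T'.translationLength g < B + 1 by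
    linarith)
  obtain ⟨a, ha⟩ := exists_vert_near (fun x y h => (hlen x y h).2) hM.le p
  have hd : dist (vert a : T'.Point) (vert (g • a)) ≤ B + 1 + 2 * M := by
    have := dist_triangle4 (vert a) p (g • p) (g • vert a)
    rw [dist_smul_smul, dist_comm (vert a) p] at this
    rw [← smul_vert]
    linarith
  -- Only a pair of vertices is needed; the third entry is a repetition.
  obtain ⟨k, hk⟩ := hA' a (g • a) (g • a) hd hd
  have h1 := hC (k • a, k • g • a, k • g • a) (k * g * k⁻¹) (by
    change (k * g * k⁻¹) • (k • a) = k • g • a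
    rw [mul_smul, mul_smul, inv_smul_smul])
  rw [translationLength_conj] at h1
  exact h1.trans (hK ⟨_, hk, rfl⟩)

/-- If vertex groups of `T'` are elliptic in `T`, then the loxodromic elements are the same. -/
theorem isLoxodromic_of_elliptic (hT : T.IsCyclicTree) (hT' : T'.IsCyclicTree)
    (hell : ∀ (v : T'.V), ∀ a : G, a • v = v → T.translationLength a = 0) {h : G}
    (hh : T'.IsLoxodromic h) : T.IsLoxodromic h := by
  rw [isLoxodromic_iff]
  by_contra hn
  obtain ⟨w, hw⟩ := exists_fixed_of_translationLength
    (le_antisymm (not_lt.1 hn) (translationLength_nonneg h))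
  obtain ⟨v⟩ := T'.isTree.connected.nonempty
  -- The cyclic stabilizer of `u` contains `b` and a power of `h`. As `b` fixes `v`, a further power
  -- of `h` fixes `v` too, so `h` is not loxodromic in `T'`.
  obtain ⟨b, hb, hb1⟩ := exists_ne_one_of_infinite (hT'.vertex v).2
  obtain ⟨u, hu⟩ := exists_fixed_of_translationLength (hell v b hb)
  obtain ⟨r, hr, hr'⟩ := exists_pow_smul_eq hT (v := u) hw
  obtain ⟨s, hs, hs'⟩ := exists_pow_smul_eq_of_isCyclic (hT.vertex u).1
    (k := b) hu hb1 (b := v) hb (a := h ^ r) hr'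
  have h1 := translationLength_of_fixed_vertex (T := T') hs'
  rw [translationLength_pow, translationLength_pow] at h1
  have h2 := isLoxodromic_iff.1 hh
  have h3 : (0 : ℝ) < r := by exact_mod_cast hr
  have h4 : (0 : ℝ) < s := by exact_mod_cast hs
  exact (mul_pos h4 (mul_pos h3 h2)).ne' h1

end GBS

end

noncomputable section

namespace GBS

universe u v w

open GTree hiding dist

/-! ### Periodic sequences with legal steps -/

section PeriodicSeq

variable {G : Type u} [Group G] {T : GTree.{u, v} G}

/-- A sequence of vertices with legal steps, equivariant with respect to the shift by `N` and the
action of `h`. -/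
structure PeriodicSeq (f : T.Point → T.Point) (lam : ℝ) (N : ℕ) (h : G) (p : ℕ → T.Point) :
    Prop where
  isVert : ∀ i, IsVert (p i)
  legal : ∀ i, Legal f lam (p i) (p (i + 1))
  shift : ∀ i, p (i + N) = h • p i

/-- The sequence obtained by applying `f` and tightening at every corner. -/
def tighten (f : T.Point → T.Point) (p : ℕ → T.Point) (i : ℕ) : T.Point :=
  med (f (p i)) (f (p (i + 1))) (f (p (i + 2)))

/-- Two sequences are locally the same up to translation. -/
def LocallyEquivalent (p q : ℕ → T.Point) : Prop :=
  ∀ i, ∃ g : G, g • p i = q i ∧ g • p (i + 1) = q (i + 1) ∧ g • p (i + 2) = q (i + 2)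

variable {θ : MulAut G} {f : T.Point → T.Point} {lam : ℝ} {N : ℕ} {h : G} {p q : ℕ → T.Point}

theorem PeriodicSeq.shift_mul (hp : PeriodicSeq f lam N h p) (n i : ℕ) :
    p (i + n * N) = h ^ n • p i := by
  induction n with
  | zero => simp
  | succ n ih => rw [Nat.succ_mul, ← add_assoc, hp.shift, ih, pow_succ', mul_smul]

theorem LegalMap.exists_periodicSeq_of_chain (hf : LegalMap θ f lam) {k : ℕ} (hk : 1 ≤ k)
    (hv : ∀ i < k, IsVert (q i)) (hl : ∀ i < k, Legal f lam (q i) (q (i + 1)))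
    (hq : q k = h • q 0) : ∃ p, PeriodicSeq f lam k h p := by
  refine ⟨fun i => h ^ (i / k) • q (i % k), fun i => ?_, fun i => ?_, fun i => ?_⟩
  · exact IsVert.smul (hv _ (Nat.mod_lt _ hk)) _
  · have hlt := Nat.mod_lt i hk
    have hdm := Nat.div_add_mod i k
    have h1 := hf.legal_smul (h ^ (i / k)) (hl _ hlt)
    by_cases hc : i % k + 1 < k
    · have e : (i + 1) / k = i / k ∧ (i + 1) % k = i % k + 1 :=
        (Nat.div_mod_unique hk).2 ⟨by omega, hc⟩
      simp only [e.1, e.2]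
      exact h1
    · have e : (i + 1) / k = i / k + 1 ∧ (i + 1) % k = 0 :=
        (Nat.div_mod_unique hk).2 ⟨by rw [mul_add, mul_one]; omega, hk⟩
      simp only [e.1, e.2]
      rw [show i % k + 1 = k by omega, hq] at h1
      rwa [pow_succ, mul_smul]
  · rw [Nat.add_div_right _ hk, Nat.add_mod_right, pow_succ', mul_smul]

theorem PeriodicSeq.smul (hf : LegalMap θ f lam) (hp : PeriodicSeq f lam N h p) (g : G) :
    PeriodicSeq f lam N (g * h * g⁻¹) fun i => g • p i where
  isVert i := IsVert.smul (hp.isVert i) g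
  legal i := hf.legal_smul g (hp.legal i)
  shift i := by rw [hp.shift, mul_smul, mul_smul, inv_smul_smul]

theorem PeriodicSeq.map (hf : LegalMap θ f lam) (hp : PeriodicSeq f lam N h p) :
    PeriodicSeq f lam N (θ h) fun i => f (p i) where
  isVert i := hf.isVert _ (hp.isVert i)
  legal i := (hp.legal i).map
  shift i := by rw [hp.shift, hf.map_smul]

/-- Consecutive tightened points lie on the image of one legal step, so the step between them is
legal. -/
theorem PeriodicSeq.tighten (hf : LegalMap θ f lam) (hp : PeriodicSeq f lam N h p) :
    PeriodicSeq f lam N (θ h) (GBS.tighten f p) where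
  isVert i := isVert_med_vert (hf.isVert _ (hp.isVert _)) (hf.isVert _ (hp.isVert _))
    (hf.isVert _ (hp.isVert _))
  legal i := (hp.legal (i + 1)).map.sub hf.stretch hf.pos.le (med_between_right _ _ _)
    (med_between_left _ _ _)
  shift i := by
    unfold GBS.tighten
    rw [add_right_comm i N 1, add_right_comm i N 2, hp.shift, hp.shift, hp.shift, hf.map_smul,
      hf.map_smul, hf.map_smul]
    exact (med_map (dist_smul_smul (θ h)) _ _ _).symm

theorem PeriodicSeq.iterate_tighten (hf : LegalMap θ f lam) (hp : PeriodicSeq f lam N h p)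
    (n : ℕ) : PeriodicSeq f lam N ((θ ^ n) h) ((GBS.tighten f)^[n] p) := by
  induction n with
  | zero => simpa using hp
  | succ n ih =>
    rw [Function.iterate_succ_apply', pow_succ']
    exact PeriodicSeq.tighten (h := (θ ^ n) h) hf ih

/-- Minimality of the period forces the tightened sequence to advance. -/
theorem PeriodicSeq.dist_lt (hf : LegalMap θ f lam) (hp : PeriodicSeq f lam N h p) (hN : 1 ≤ N)
    (hlox : T.IsLoxodromic (θ h))
    (hmin : ∀ k, 1 ≤ k → (∃ q, PeriodicSeq f lam k (θ h) q) → N ≤ k) (i : ℕ) :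
    dist (f (p (i + 1))) (GBS.tighten f p i) <
      dist (f (p (i + 1))) (GBS.tighten f p (i + 1)) := by
  by_contra! hle
  have hP := hp.map hf
  have hQ := hp.tighten hf
  have a1 : Between (f (p i)) (GBS.tighten f p i) (f (p (i + 1))) := med_between_left _ _ _
  have a2 : Between (f (p (i + 1))) (GBS.tighten f p i) (f (p (i + 2))) := med_between_right _ _ _
  have a3 : Between (f (p (i + 1))) (GBS.tighten f p (i + 1)) (f (p (i + 2))) :=
    med_between_left _ _ _
  have a4 : Between (f (p (i + 2))) (GBS.tighten f p (i + 1)) (f (p (i + 3))) :=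
    med_between_right _ _ _
  -- If the conclusion fails, `GBS.tighten f p (i + 1)` lies on the images of the steps before and
  -- after the middle one. The middle step can be skipped, which shortens the period. For period `1`
  -- this is instead a fold of at least half of a segment, which produces a fixed point; for period
  -- `2` the two remaining parts lie on one legal segment.
  have b1 : Between (f (p i)) (GBS.tighten f p (i + 1)) (f (p (i + 1))) :=
    (a1.symm.trans_left (a3.order a2 hle).1).symm
  obtain rfl | rfl | hN3 : N = 1 ∨ N = 2 ∨ 3 ≤ N := by omega
  · have e1 : f (p (i + 1)) = θ h • f (p i) := hP.shift i
    have e2 : f (p (i + 2)) = θ h • f (p (i + 1)) := hP.shift (i + 1)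
    have e3 : GBS.tighten f p (i + 1) = θ h • GBS.tighten f p i := hQ.shift i
    rw [e3, e1, dist_smul_smul, ← e1] at hle
    obtain ⟨x, hx⟩ := exists_fixed_of_backtrack (dist_smul_smul (θ h)) (x := f (p i)) (by
      rw [← e1, ← e2]
      have h1 : dist (f (p i)) (GBS.tighten f p i) + dist (GBS.tighten f p i) (f (p (i + 1))) =
        dist (f (p i)) (f (p (i + 1))) := a1
      rw [dist_comm (GBS.tighten f p i)] at h1
      change _ ≤ 2 * dist _ (GBS.tighten f p i)
      linarith)
    exact hlox x hx
  · have e1 : f (p (i + 2)) = θ h • f (p i) := hP.shift i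
    have e2 : f (p (i + 3)) = θ h • f (p (i + 1)) := hP.shift (i + 1)
    have b2 : Between (f (p (i + 2))) (θ h • GBS.tighten f p (i + 1)) (f (p (i + 3))) := by
      rw [e1, e2]; exact b1.map_isometry (dist_smul_smul _)
    have hleg : Legal f lam (GBS.tighten f p (i + 1)) (θ h • GBS.tighten f p (i + 1)) :=
      (hP.legal (i + 2)).sub hf.stretch hf.pos.le a4 b2
    have := hmin 1 le_rfl (hf.exists_periodicSeq_of_chain le_rfl
      (q := fun j => if j = 0 then GBS.tighten f p (i + 1) else θ h • GBS.tighten f p (i + 1))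
      (fun j hj => by
        obtain rfl : j = 0 := by omega
        simpa using hQ.isVert (i + 1))
      (fun j hj => by
        obtain rfl : j = 0 := by omega
        simpa using hleg) (by simp))
    omega
  · have := hmin (N - 1) (by omega) (hf.exists_periodicSeq_of_chain (by omega)
      (q := fun j => if j = 0 then GBS.tighten f p (i + 1) else if j = N - 1 then
        θ h • GBS.tighten f p (i + 1) else f (p (i + 2 + j)))
      (fun j hj => by
        split_ifs with h1 h2
        · exact hQ.isVert _
        · omega
        · exact hP.isVert _)
      (fun j hj => by
        rcases Nat.eq_zero_or_pos j with rfl | hj0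
        · rw [if_pos rfl, if_neg (by omega), if_neg (by omega)]
          exact (hP.legal (i + 2)).sub_right hf.stretch hf.pos.le a4
        · rw [if_neg (by omega), if_neg (by omega), if_neg (by omega)]
          by_cases hj1 : j + 1 = N - 1
          · rw [if_pos hj1, show i + 2 + j = i + N by omega, hP.shift i]
            exact hf.legal_smul _ ((hP.legal i).sub_left hf.stretch hf.pos.le b1)
          · rw [if_neg hj1]
            exact hP.legal (i + 2 + j))
      (by rw [if_neg (by omega), if_pos rfl, if_pos rfl]))
    omega

/-- If the period is minimal, the tightened sequence runs along the axis. -/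
theorem PeriodicSeq.dist_tighten_le (hf : LegalMap θ f lam) (hp : PeriodicSeq f lam N h p)
    (hN : 1 ≤ N) (hlox : T.IsLoxodromic (θ h))
    (hmin : ∀ k, 1 ≤ k → (∃ q, PeriodicSeq f lam k (θ h) q) → N ≤ k) (i : ℕ) :
    dist (GBS.tighten f p i) (GBS.tighten f p (i + 1)) ≤ T.translationLength (θ h) := by
  have hQ := hp.tighten hf
  have hlt := hp.dist_lt hf hN hlox hmin
  -- The order of the tightened points on each image segment makes them a local geodesic, so they
  -- run along the axis of `θ h`.
  have hord : ∀ i, Between (f (p (i + 1))) (GBS.tighten f p i) (GBS.tighten f p (i + 1)) ∧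
      Between (GBS.tighten f p i) (GBS.tighten f p (i + 1)) (f (p (i + 2))) := fun i =>
    Between.order (med_between_right (f (p i)) (f (p (i + 1))) (f (p (i + 2))))
      (med_between_left (f (p (i + 1))) (f (p (i + 2))) (f (p (i + 3)))) (hlt i).le
  have hb : ∀ i, Between (GBS.tighten f p i) (GBS.tighten f p (i + 1))
      (GBS.tighten f p (i + 2)) := fun i =>
    Between.trans_right_symm
      (Between.trans_right (med_between (f (p (i + 1))) (f (p (i + 2))) (f (p (i + 3)))) (hord i).1)
      (hord (i + 1)).2
  have hne : ∀ i, GBS.tighten f p i ≠ GBS.tighten f p (i + 1) := fun i he => by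
    have := hlt i
    rw [he] at this
    exact lt_irrefl _ this
  refine le_translationLength_of_pow (p := GBS.tighten f p i) fun n => ?_
  rw [← hQ.shift_mul]
  have hsum := dist_eq_sum_of_local (m := fun j => GBS.tighten f p (i + j)) (n * N)
    (fun j _ => hb (i + j)) (fun j _ => hne (i + j))
  rw [add_zero] at hsum
  rw [hsum]
  clear hsum
  induction n with
  | zero => simp
  | succ n ih =>
    rw [Nat.succ_mul, Finset.sum_range_add]
    push_cast
    rw [add_mul, one_mul]
    refine add_le_add ih ?_
    -- Of each period, only the first step is kept; it is a translate of the given one.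
    refine le_trans (le_of_eq ?_) (Finset.single_le_sum (fun _ _ => dist_nonneg)
      (Finset.mem_range.2 hN))
    have h1 := hQ.shift_mul n i
    have h2 := hQ.shift_mul n (i + 1)
    rw [add_right_comm] at h2
    rw [add_zero, ← add_assoc, h1, h2, dist_smul_smul]

/-- Three consecutive tightened points depend on five points, for which the translating elements may
differ. The elements for neighboring triples agree on two consecutive points, so their images under
`θ` agree on the segment between the images of these, which contains the tightened point. -/
theorem LocallyEquivalent.tighten (hf : LegalMap θ f lam) (h : LocallyEquivalent p q) :
    LocallyEquivalent (GBS.tighten f p) (GBS.tighten f q) := by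
  intro i
  obtain ⟨a, a0, a1, a2⟩ := h i
  obtain ⟨b, b0, b1, b2⟩ := h (i + 1)
  obtain ⟨c, c0, c1, c2⟩ := h (i + 2)
  have key : ∀ {g x y}, g • x = y → θ g • f x = f y := fun {g x y} h => by
    rw [← hf.map_smul, h]
  have e : ∀ {g : G} {j}, g • p j = q j → g • p (j + 1) = q (j + 1) → g • p (j + 2) = q (j + 2) →
      θ g • GBS.tighten f p j = GBS.tighten f q j := fun {g j} h0 h1 h2 => by
    unfold GBS.tighten
    rw [← key h0, ← key h1, ← key h2]
    exact med_map (dist_smul_smul (θ g)) _ _ _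
  refine ⟨θ b, ?_, e b0 b1 b2, ?_⟩
  · rw [← e a0 a1 a2]
    exact Between.map_eq_map (dist_smul_smul _) (dist_smul_smul _)
      (med_between_right (f (p i)) (f (p (i + 1))) (f (p (i + 2))))
      ((key b0).trans (key a1).symm) ((key b1).trans (key a2).symm)
  · rw [← e c0 c1 c2]
    exact Between.map_eq_map (dist_smul_smul _) (dist_smul_smul _)
      (med_between_left (f (p (i + 2))) (f (p (i + 3))) (f (p (i + 4))))
      ((key b1).trans (key c0).symm) ((key b2).trans (key c1).symm)

theorem LocallyEquivalent.iterate_tighten (hf : LegalMap θ f lam) (h : LocallyEquivalent p q)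
    (n : ℕ) : LocallyEquivalent ((GBS.tighten f)^[n] p) ((GBS.tighten f)^[n] q) := by
  induction n with
  | zero => exact h
  | succ n ih =>
    rw [Function.iterate_succ_apply', Function.iterate_succ_apply']
    exact ih.tighten hf

theorem LocallyEquivalent.dist_eq (h : LocallyEquivalent p q) (i : ℕ) :
    dist (p i) (p (i + 1)) = dist (q i) (q (i + 1)) := by
  obtain ⟨g, h0, h1, -⟩ := h i
  rw [← h0, ← h1, dist_smul_smul]

/-- Local equivalence of periodic sequences can be tested on one period. -/
theorem PeriodicSeq.locallyEquivalent {h' : G} (hp : PeriodicSeq f lam N h p)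
    (hq : PeriodicSeq f lam N h' q) (hN : 1 ≤ N)
    (H : ∀ i < N, ∃ g : G, g • p i = q i ∧ g • p (i + 1) = q (i + 1) ∧
      g • p (i + 2) = q (i + 2)) : LocallyEquivalent p q := by
  intro i
  obtain ⟨g, h0, h1, h2⟩ := H (i % N) (Nat.mod_lt _ hN)
  have hi : ∀ j, i + j = i % N + j + i / N * N := fun j => by
    have := Nat.mod_add_div i N
    rw [mul_comm] at this
    omega
  have key : ∀ j, g • p (i % N + j) = q (i % N + j) →
      (h' ^ (i / N) * g * (h ^ (i / N))⁻¹) • p (i + j) = q (i + j) := fun j hj => by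
    rw [hi j, hp.shift_mul, hq.shift_mul, mul_smul, mul_smul, inv_smul_smul, hj]
  exact ⟨_, key 0 h0, key 1 h1, key 2 h2⟩

/-- Elements of bounded translation length have periodic sequences of bounded period. -/
theorem LegalMap.exists_period_bound (hf : LegalMap θ f lam) (hT : T.IsCyclicTree)
    (hG : Group.FG G) (B : ℝ) : ∃ K : ℕ, ∀ g : G, T.translationLength g ≤ B →
      ∃ k, 1 ≤ k ∧ k ≤ K ∧ ∃ p, PeriodicSeq f lam k g p := by
  obtain ⟨ℓ, M, -, hM, hlen⟩ := exists_len_bounds hT.minimal hG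
  obtain ⟨A, hA, hA'⟩ := exists_finite_triples hT hG (B + 1 + 2 * M)
  have hchain : ∀ e : T.V × T.V × T.V, ∃ k, 1 ≤ k ∧ ∃ q : ℕ → T.Point, (∀ i, IsVert (q i)) ∧
      (∀ i < k, Legal f lam (q i) (q (i + 1))) ∧ q 0 = vert e.1 ∧ q k = vert e.2.1 := by
    rintro ⟨x, y, -⟩
    obtain ⟨n, u, hu0, hun, hadj, -⟩ := exists_vertex_path x y
    rcases Nat.eq_zero_or_pos n with rfl | hn
    -- When the endpoints coincide a constant step is used, since the period must be positive.
    · refine ⟨1, le_rfl, fun _ => vert x, fun _ => ⟨x, rfl⟩, fun _ _ => Legal.refl _, rfl, ?_⟩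
      dsimp only
      rw [← hu0, hun]
    · exact ⟨n, hn, fun i => vert (u i), fun i => ⟨u i, rfl⟩,
        fun i hi => hf.legal _ _ (hadj i hi), congrArg vert hu0, congrArg vert hun⟩
  choose k hk q hqv hql hq0 hqk using hchain
  obtain ⟨K, hK⟩ := (hA.image k).bddAbove
  refine ⟨K, fun g hg => ?_⟩
  obtain ⟨x, hx⟩ := exists_dist_lt_of_translationLength (show T.translationLength g < B + 1 by
    linarith)
  obtain ⟨a, ha⟩ := exists_vert_near (fun x y h => (hlen x y h).2) hM.le x
  have hd : dist (vert a : T.Point) (vert (g • a)) ≤ B + 1 + 2 * M := by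
    have := dist_triangle4 (vert a) x (g • x) (g • vert a)
    rw [dist_smul_smul, dist_comm (vert a) x] at this
    rw [← smul_vert]
    linarith
  obtain ⟨c, hc⟩ := hA' a (g • a) (g • a) hd hd
  set e := (c • a, c • g • a, c • g • a) with he
  obtain ⟨p, hp⟩ := hf.exists_periodicSeq_of_chain (h := c * g * c⁻¹) (hk e) (fun i _ => hqv e i)
    (hql e) (by rw [hqk, hq0, smul_vert, mul_smul, mul_smul, inv_smul_smul])
  have hp' := hp.smul hf c⁻¹
  rw [show c⁻¹ * (c * g * c⁻¹) * c⁻¹⁻¹ = g by group] at hp'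
  exact ⟨k e, hk e, hK ⟨e, hc, rfl⟩, _, hp'⟩

/-- Two of the first tightenings of a periodic sequence with bounded steps are locally
equivalent. -/
theorem PeriodicSeq.exists_locallyEquivalent (hf : LegalMap θ f lam) (hT : T.IsCyclicTree)
    (hG : Group.FG G) (N : ℕ) (hN : 1 ≤ N) (B : ℝ) : ∃ J : ℕ, ∀ (h : G) (p : ℕ → T.Point),
      PeriodicSeq f lam N h p →
      (∀ j < J, ∀ i, dist ((GBS.tighten f)^[j + 1] p i) ((GBS.tighten f)^[j + 1] p (i + 1)) ≤ B) →
      ∃ j j', j < j' ∧ LocallyEquivalent ((GBS.tighten f)^[j] p) ((GBS.tighten f)^[j'] p) := by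
  obtain ⟨A, hA, hA'⟩ := exists_finite_triples hT hG (2 * B)
  have := hA.fintype
  -- A type records the orbit of each of the `N` local triples. Only tightenings from the first on
  -- are compared, because the steps of `p` itself are not bounded.
  refine ⟨Fintype.card (Fin N → A) + 1, fun h p hp hB => ?_⟩
  have hpj := fun j => hp.iterate_tighten hf j
  have htype : ∀ (j : Fin (Fintype.card (Fin N → A) + 1)) (i : Fin N), ∃ e : A, ∃ g : G,
      g • (GBS.tighten f)^[j + 1] p i = vert e.1.1 ∧
      g • (GBS.tighten f)^[j + 1] p (i + 1) = vert e.1.2.1 ∧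
      g • (GBS.tighten f)^[j + 1] p (i + 2) = vert e.1.2.2 := by
    intro j i
    have h1 := hB j j.2 i
    have h2 := hB j j.2 (i + 1)
    obtain ⟨a, ha⟩ := (hpj (j + 1)).isVert i
    obtain ⟨b, hb⟩ := (hpj (j + 1)).isVert (i + 1)
    obtain ⟨c, hc⟩ := (hpj (j + 1)).isVert (i + 2)
    rw [add_assoc, show 1 + 1 = 2 from rfl] at h2
    rw [ha, hb] at h1
    rw [hb, hc] at h2
    have h0 : 0 ≤ B := dist_nonneg.trans h1
    obtain ⟨g, hg⟩ := hA' a b c (by linarith) (by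
      linarith [dist_triangle (vert a : T.Point) (vert b) (vert c)])
    exact ⟨⟨_, hg⟩, g, by rw [ha, smul_vert], by rw [hb, smul_vert], by rw [hc, smul_vert]⟩
  choose E g hg0 hg1 hg2 using htype
  obtain ⟨x, y, hxy, hE⟩ := Fintype.exists_ne_map_eq_of_card_lt E (by simp)
  have main : ∀ x y, E x = E y →
      LocallyEquivalent ((GBS.tighten f)^[x + 1] p) ((GBS.tighten f)^[y + 1] p) := by
    intro x y hE
    refine (hpj _).locallyEquivalent (hpj _) hN fun i hi => ?_
    have hE' := congrFun hE ⟨i, hi⟩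
    have e0 := hg0 x ⟨i, hi⟩
    have e1 := hg1 x ⟨i, hi⟩
    have e2 := hg2 x ⟨i, hi⟩
    rw [hE', ← hg0 y ⟨i, hi⟩] at e0
    rw [hE', ← hg1 y ⟨i, hi⟩] at e1
    rw [hE', ← hg2 y ⟨i, hi⟩] at e2
    refine ⟨(g y ⟨i, hi⟩)⁻¹ * g x ⟨i, hi⟩, ?_, ?_, ?_⟩
    · rw [mul_smul, inv_smul_eq_iff]; exact e0
    · rw [mul_smul, inv_smul_eq_iff]; exact e1
    · rw [mul_smul, inv_smul_eq_iff]; exact e2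
  rcases lt_or_gt_of_ne hxy with hlt | hlt
  · exact ⟨x + 1, y + 1, by simpa using hlt, main x y hE⟩
  · exact ⟨y + 1, x + 1, by simpa using hlt, main y x hE.symm⟩

/-- If two tightenings of a periodic sequence are locally equivalent, its translation element is
pseudo-periodic. -/
theorem PeriodicSeq.isPseudoPeriodic (hf : LegalMap θ f lam) (hp : PeriodicSeq f lam N h p)
    {φ : Out G} (hθ : (θ : Out G) = φ) {j j' : ℕ} (hj : j < j')
    (he : LocallyEquivalent ((GBS.tighten f)^[j] p) ((GBS.tighten f)^[j'] p)) :
    T.IsPseudoPeriodic φ h := by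
  set s : ℕ → ℝ := fun n => ∑ i ∈ Finset.range N,
    dist ((GBS.tighten f)^[n] p i) ((GBS.tighten f)^[n] p (i + 1)) with hs
  -- Local equivalence survives further tightening, so the lengths of a period repeat and take
  -- finitely many values.
  have hper : ∀ k, s (k + j) = s (k + j') := fun k => Finset.sum_congr rfl fun i _ => by
    rw [Function.iterate_add_apply, Function.iterate_add_apply]
    exact (he.iterate_tighten hf k).dist_eq i
  obtain ⟨C, hC⟩ := ((Set.finite_lt_nat j').image s).bddAbove
  have hbd : ∀ n, s n ≤ C := by
    intro n
    induction n using Nat.strong_induction_on with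
    | _ n ih =>
      by_cases hn : n < j'
      · exact hC ⟨n, hn, rfl⟩
      · have h1 := hper (n - j')
        rw [Nat.sub_add_cancel (not_lt.1 hn)] at h1
        rw [← h1]
        exact ih _ (by omega)
  refine isPseudoPeriodic_of hθ (B := C) fun n => ?_
  have hn := hp.iterate_tighten hf n
  have h1 := translationLength_le ((θ ^ n) h) ((GBS.tighten f)^[n] p 0)
  rw [← hn.shift, zero_add] at h1
  exact h1.trans ((dist_le_range_sum_dist _ _).trans (hbd n))

/-- The backward orbit of a loxodromic conjugacy class under a pseudo-atoroidal automorphism has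
unbounded translation lengths. -/
theorem LegalMap.not_bounded_backward (hf : LegalMap θ f lam) (hT : T.IsCyclicTree)
    (hG : Group.FG G) {φ : Out G} (hθ : (θ : Out G) = φ) (hator : T.IsPseudoAtoroidal φ)
    (hlox : T.IsLoxodromic h) {B : ℝ} (hB : ∀ n : ℕ, T.translationLength ((θ⁻¹ ^ n) h) ≤ B) :
    False := by
  set H : ℕ → G := fun n => (θ⁻¹ ^ n) h with hH
  have hstep : ∀ n, θ (H (n + 1)) = H n := fun n => by
    simp only [hH, pow_succ', MulAut.mul_apply, MulAut.apply_inv_self]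
  have hlox' : ∀ n, T.IsLoxodromic (H n) := by
    intro n
    induction n with
    | zero => exact hlox
    | succ n ih =>
      intro x hx
      apply ih (f x)
      rw [← hstep, ← hf.map_smul, hx]
  obtain ⟨K, hK⟩ := hf.exists_period_bound hT hG B
  have hex : ∀ n, ∃ k, 1 ≤ k ∧ ∃ p, PeriodicSeq f lam k (H n) p := fun n => by
    obtain ⟨k, h1, -, h2⟩ := hK (H n) (hB n)
    exact ⟨k, h1, h2⟩
  classical
  set μ : ℕ → ℕ := fun n => Nat.find (hex n) with hμ
  have hμK : ∀ n, μ n ≤ K := fun n => by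
    obtain ⟨k, h1, h2, h3⟩ := hK (H n) (hB n)
    exact (Nat.find_min' (hex n) ⟨h1, h3⟩).trans h2
  -- The image under `f` of a sequence for `H (n + 1)` is a sequence for `H n` of the same period.
  have hmono : Monotone μ := monotone_nat_of_le_succ fun n => by
    obtain ⟨h1, p, hp⟩ := Nat.find_spec (hex (n + 1))
    have := hp.map hf
    rw [hstep] at this
    exact Nat.find_min' (hex n) ⟨h1, _, this⟩
  obtain ⟨n₀, hn₀⟩ : ∃ n₀, ∀ n, n₀ ≤ n → μ n = μ n₀ := by
    have hfin : (Set.range μ).Finite := (Set.finite_le_nat K).subset (by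
      rintro _ ⟨n, rfl⟩; exact hμK n)
    obtain ⟨_, ⟨n₀, rfl⟩, hmax⟩ := hfin.exists_maximal (Set.range_nonempty μ)
    exact ⟨n₀, fun n hn => le_antisymm (hmax ⟨n, rfl⟩ (hmono hn)) (hmono hn)⟩
  set N := μ n₀ with hNdef
  have hN : 1 ≤ N := (Nat.find_spec (hex n₀)).1
  obtain ⟨J, hJ⟩ := PeriodicSeq.exists_locallyEquivalent hf hT hG N hN B
  -- Starting `J` steps further back leaves room for `J` tightenings during which `N` remains the
  -- minimal period.
  obtain ⟨p, hp⟩ : ∃ p, PeriodicSeq f lam N (H (n₀ + J)) p := by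
    rw [← hn₀ (n₀ + J) (by omega)]
    exact (Nat.find_spec (hex (n₀ + J))).2
  have hpow : ∀ j ≤ J, (θ ^ j) (H (n₀ + J)) = H (n₀ + J - j) := by
    intro j hj
    induction j with
    | zero => simp
    | succ j ih =>
      rw [pow_succ', MulAut.mul_apply, ih (by omega),
        show n₀ + J - j = n₀ + J - (j + 1) + 1 by omega, hstep]
  obtain ⟨j, j', hj, he⟩ := hJ _ p hp fun j hj i => by
    have h1 := hp.iterate_tighten hf j
    have h2 : θ ((θ ^ j) (H (n₀ + J))) = H (n₀ + J - (j + 1)) := by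
      rw [← hpow (j + 1) (by omega), pow_succ', MulAut.mul_apply]
    rw [Function.iterate_succ_apply']
    refine (h1.dist_tighten_le hf hN ?_ ?_ i).trans ?_
    · rw [h2]; exact hlox' _
    · intro k hk hk'
      rw [h2] at hk'
      rw [← hn₀ (n₀ + J - (j + 1)) (by omega)]
      exact Nat.find_min' _ ⟨hk, hk'⟩
    · rw [h2]; exact hB _
  exact hator _ (hlox' _) (hp.isPseudoPeriodic hf hθ hj he)

end PeriodicSeq

/-- Pseudo-atoroidality passes to the inverse. -/
theorem LegalMap.isPseudoAtoroidal_inv {G : Type u} [Group G] {T : GTree.{u, v} G}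
    {T' : GTree.{u, w} G} {θ θ' : MulAut G} {f : T.Point → T.Point} {f' : T'.Point → T'.Point}
    {lam lam' : ℝ} (hf : LegalMap θ f lam) (hf' : LegalMap θ' f' lam') (hT : T.IsCyclicTree)
    (hT' : T'.IsCyclicTree) (hG : Group.FG G) {φ : Out G} (hθ : (θ : Out G) = φ)
    (hθ' : (θ' : Out G) = φ⁻¹) (hator : T.IsPseudoAtoroidal φ) : T'.IsPseudoAtoroidal φ⁻¹ := by
  intro h hlox hper
  have hell : ∀ (v : T'.V), ∀ a : G, a • v = v → T.translationLength a = 0 := fun v a ha =>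
    hf'.translationLength_eq_zero hT' hG hθ' hator ha
  obtain ⟨B, hB⟩ := hper θ⁻¹ (by rw [QuotientGroup.mk_inv, hθ])
  obtain ⟨C, hC⟩ := exists_translationLength_bound hT' hG hell B
  exact hf.not_bounded_backward hT hG hθ hator (isLoxodromic_of_elliptic hT hT' hell hlox)
    (B := C) fun n => hC _ (hB ⟨n, rfl⟩)

/-- A train track map for a pseudo-atoroidal automorphism has bounded concatenations of periodic
Nielsen paths. -/
theorem LegalMap.exists_bound_of_isTrainTrack {G : Type u} [Group G] {T : GTree.{u, v} G}
    {θ : MulAut G} {f : T.Point → T.Point} {lam : ℝ} (hf : LegalMap θ f lam) {φ : Out G}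
    (hθ : (θ : Out G) = φ) (htt : GTree.IsTrainTrack φ f) (hT : T.IsCyclicTree)
    (hG : Group.FG G) (hator : T.IsPseudoAtoroidal φ) :
    ∃ m : ℕ, NielsenConcatenationBound f m := by
  obtain ⟨g, hg⟩ := exists_isLoxodromic hT.minimal hG htt.exists_two
  exact hf.exists_nielsenConcatenationBound hT hG hθ hator (hf.one_lt hθ hator hg)

end GBS

end

/-! ### The main theorem -/

theorem mainTheorem4 {G : Type*} [Group G] (hG : GBS.IsGBS G) (hns : ¬ Group.IsSolvable G)
    (φ : GBS.Out G) (T : GBS.GTree G) (hT : T.IsCyclicTree)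
    (hirr : T.IsFullyIrreducible φ) (hator : T.IsPseudoAtoroidal φ)
    (f : T.Point → T.Point) (hf : GBS.GTree.IsTrainTrack φ f) :
    (∃ m : ℕ, GBS.GTree.NielsenConcatenationBound f m) ∧
    ∀ (T' : GBS.GTree G) (f' : T'.Point → T'.Point), T'.IsCyclicTree →
      GBS.GTree.IsTrainTrack φ⁻¹ f' →
      ∃ m : ℕ, GBS.GTree.NielsenConcatenationBound f m ∧
        GBS.GTree.NielsenConcatenationBound f' m := by
  obtain ⟨θ, lam, hθ, hl⟩ := GBS.IsTrainTrack.exists_legalMap hf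
  obtain ⟨m, hm⟩ := hl.exists_bound_of_isTrainTrack hθ hf hT hG.fg hator
  refine ⟨⟨m, hm⟩, fun T' f' hT' hf' => ?_⟩
  obtain ⟨θ', lam', hθ', hl'⟩ := GBS.IsTrainTrack.exists_legalMap hf'
  obtain ⟨m', hm'⟩ := hl'.exists_bound_of_isTrainTrack hθ' hf' hT' hG.fg
    (hl.isPseudoAtoroidal_inv hl' hT hT' hG.fg hθ hθ' hator)
  exact ⟨max m m', fun k x hx => (hm k x hx).trans (le_max_left _ _),
    fun k x hx => (hm' k x hx).trans (le_max_right _ _)⟩
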